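/- For $k\ge 1$ write $\mathbf y=(y_1,\dots,y_k)$, $\mathbf y'=(y_1',\dots,y_k')\in\mathbb R^k$, and let $R_\varepsilon^{(k)}=\prod_{j=1}^k\langle\partial_{y_j}\rangle^{\varepsilon}\langle\partial_{y_j'}\rangle^{\varepsilon}$ with $\langle\xi\rangle=(1+|\xi|^2)^{1/2}$. For $1\le j\le k$ let $B_{j,k+1}u^{(k+1)}=\mathrm{Tr}_{k+1}[\delta(y_j-y_{k+1}),u^{(k+1)}]$, that is, formally, $$B_{j,k+1}u^{(k+1)}(\mathbf y;\mathbf y')=u^{(k+1)}(\mathbf y,y_j;\mathbf y',y_j)-u^{(k+1)}(\mathbf y,y_j';\mathbf y',y_j').$$ Here, for $\rho_\alpha(x)=\alpha^{-1}\rho(x/\alpha)$, the trace $u^{(k+1)}(\mathbf y,a;\mathbf y',a)$ is replaced by $\iint\rho_\alpha(a-z)\rho_\alpha(a-z')u^{(k+1)}(\mathbf y,z;\mathbf y',z')\,dz\,dz'$, and $B_{j,k+1}u^{(k+1)}$ is the limit of the resulting difference as $\alpha\to0^+$ in the sense of distributions on $(0,T)\times\mathbb R^{k}\times\mathbb R^k$;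 the limit is required to exist and to be the same for all smooth compactly supported probability densities $\rho$ on $\mathbb R$. Let $\omega\in\mathbb R$, $b_0\ge 0$, $T>0$, and $g(\tau)=(1+\omega^2\tau^2)^{-1/2}$. The one-dimensional focusing Gross–Pitaevskii hierarchy (in lens-transformed form) is $$i\partial_\tau u^{(k)}=\Big[-\tfrac12\Delta_{\mathbf y},u^{(k)}\Big]-g(\tau)\,b_0\sum_{j=1}^k B_{j,k+1}u^{(k+1)},\qquad k\ge1 .$$ A solution on $[0,T]$ is a family of kernels $u^{(k)}(\tau)\in L^2(\mathbb R^k\times\mathbb R^k)$, $k\ge1$, $\tau\in[0,T]$, invariant under simultaneous permutations of $(y_1,\dots,y_k)$ and $(y_1',\dots,y_k')$, such that $B_{j,k+1}u^{(k+1)}$ exists in $L^1([0,T];L^2)$ for all $1\le j\le k$ and, for all $k\ge 1$ and all $\tau\in[0,T]$, $$u^{(k)}(\tau)=U^{(k)}(\tau)u^{(k)}(0)+ib_0\sum_{j=1}^k\int_0^\tau U^{(k)}(\tau-s)\,g(s)\,B_{j,k+1}u^{(k+1)}(s)\,ds,\qquad U^{(k)}(\tau)=e^{i\tau\Delta_{\mathbf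 y}/2}e^{-i\tau\Delta_{\mathbf y'}/2}.$$ **Theorem.** Let $\{u^{(k)}\}_{k\ge1}$ be a solution of this hierarchy on $[0,T]$ with $u^{(k)}(0)=0$ for all $k\ge 1$. Suppose that for some $\varepsilon>0$ and $C>0$ $$\int_0^T\big\|R_\varepsilon^{(k)}B_{j,k+1}u^{(k+1)}(\tau)\big\|_{L^2_{\mathbf y,\mathbf y'}}\,d\tau\le C^k\qquad\text{for all }1\le j\le k .$$ Then for all $k\ge1$ and all $\tau\in[0,T]$ one has $\|R_\varepsilon^{(k)}u^{(k)}(\tau)\|_{L^2_{\mathbf y,\mathbf y'}}=0$; in particular $u^{(k)}(\tau)=0$. -/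

import Mathlib

open MeasureTheory Filter Topology
open scoped FourierTransform ENNReal

namespace GPHierarchy

noncomputable section

/-- The space `ℝᵏ × ℝᵏ` of the variables `(y; y')` of a `k`-particle kernel: the coordinate
`Sum.inl j` is `y_j` and the coordinate `Sum.inr j` is `y'_j`. -/
abbrev KernelSpace (k : ℕ) : Type := EuclideanSpace ℝ (Fin k ⊕ Fin k)

/-- Hilbert-Schmidt kernels `u(y; y')` in `L²(dy dy')`. -/
abbrev Kernel (k : ℕ) : Type := Lp ℂ 2 (volume : Measure (KernelSpace k))

/-- The symbol of `R_ε^{(k)} = ∏ⱼ ⟨∂_{y_j}⟩^ε ⟨∂_{y'_j}⟩^ε`. As Mathlib's Fourier transform uses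
the character `exp (-2πi x ξ)`, the symbol of `⟨∂⟩^ε` is `(1 + (2πξ)²)^{ε/2}`. -/
def sobolevSymbol {k : ℕ} (ε : ℝ) (ξ : KernelSpace k) : ℝ :=
  ∏ i, (1 + (2 * Real.pi * ξ i) ^ 2) ^ (ε / 2)

/-- The norm `‖R_ε^{(k)} f‖_{L²}`, in `[0, ∞]`, computed on the Fourier side. -/
def sobolevNorm {k : ℕ} (ε : ℝ) (f : Kernel k) : ℝ≥0∞ :=
  eLpNorm (fun ξ : KernelSpace k => (sobolevSymbol ε ξ : ℂ) * (𝓕 f) ξ) 2 volume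

/-- The real number `(|2πη|² - |2πη'|²) / 2` at the frequency `ξ = (η; η')`, the symbol of
`f ↦ [-½Δ, f] = -½ Δ_y f + ½ Δ_{y'} f`. -/
def dispersion {k : ℕ} (ξ : KernelSpace k) : ℝ :=
  ((∑ j, (2 * Real.pi * ξ (Sum.inl j)) ^ 2) - ∑ j, (2 * Real.pi * ξ (Sum.inr j)) ^ 2) / 2

theorem continuous_dispersion (k : ℕ) : Continuous (dispersion (k := k)) := by
  unfold dispersion
  fun_prop

/-- The symbol of the free evolution `U^{(k)}(τ)`. -/
def propagatorSymbol {k : ℕ} (τ : ℝ) (ξ : KernelSpace k) : ℂ :=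
  Complex.exp (((-(τ * dispersion ξ) : ℝ) : ℂ) * Complex.I)

theorem memLp_propagatorSymbol_mul {k : ℕ} (τ : ℝ) (f : Kernel k) :
    MemLp (fun ξ => propagatorSymbol τ ξ * f ξ) 2 (volume : Measure (KernelSpace k)) := by
  have hc : Continuous (propagatorSymbol (k := k) τ) := by
    have := continuous_dispersion k
    unfold propagatorSymbol
    fun_prop
  refine (Lp.memLp f).of_le (hc.aestronglyMeasurable.mul (Lp.aestronglyMeasurable f)) ?_
  refine Eventually.of_forall fun ξ => ?_
  rw [norm_mul, propagatorSymbol, Complex.norm_exp_ofReal_mul_I, one_mul]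

/-- The free evolution `U^{(k)}(τ) = e^{iτΔ_y/2} e^{-iτΔ_{y'}/2}`, which solves
`i ∂_τ u = [-½Δ, u]`. -/
def freeEvolution {k : ℕ} (τ : ℝ) (f : Kernel k) : Kernel k :=
  𝓕⁻ ((memLp_propagatorSymbol_mul τ (𝓕 f)).toLp : Kernel k)

/-- The point `(y, z; y', z')`. -/
def appendVar {k : ℕ} (y : KernelSpace k) (z z' : ℝ) : KernelSpace (k + 1) :=
  WithLp.toLp 2 (Sum.elim (Fin.snoc (α := fun _ => ℝ) (fun i => y (Sum.inl i)) z)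
    (Fin.snoc (α := fun _ => ℝ) (fun i => y (Sum.inr i)) z'))

/-- The permutation `σ` of the particles, acting on `y` and on `y'` at the same time. -/
def permute {k : ℕ} (σ : Equiv.Perm (Fin k)) (y : KernelSpace k) : KernelSpace k :=
  WithLp.toLp 2 fun i => y (Sum.map σ σ i)

/-- A smooth, compactly supported probability density on the line. -/
structure IsMollifier (ρ : ℝ → ℝ) : Prop where
  smooth : ContDiff ℝ (⊤ : ℕ∞) ρ
  compactSupport : HasCompactSupport ρ
  nonneg : ∀ x, 0 ≤ ρ x
  integral_eq_one : ∫ x, ρ x = 1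

/-- The approximation `ρ_α(x) = α⁻¹ ρ(x / α)` of the Dirac mass at `0`. -/
def rescale (ρ : ℝ → ℝ) (α x : ℝ) : ℝ := α⁻¹ * ρ (x / α)

/-- The approximation `∬ ρ_α(a - z) ρ_α(a - z') u(y, z; y', z') dz dz'` of `u(y, a; y', a)`. -/
def smearedTrace {k : ℕ} (ρ : ℝ → ℝ) (α : ℝ) (u : Kernel (k + 1)) (y : KernelSpace k) (a : ℝ) :
    ℂ :=
  ∫ z : ℝ × ℝ, ((rescale ρ α (a - z.1) * rescale ρ α (a - z.2) : ℝ) : ℂ) *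
    u (appendVar y z.1 z.2)

/-- The approximation, with `ρ_α` in the place of `δ`, of
`B_{j,k+1} u = Tr_{k+1} [δ(y_j - y_{k+1}), u]`, that is of
`u(y, y_j; y', y_j) - u(y, y'_j; y', y'_j)`. -/
def smearedCollision {k : ℕ} (ρ : ℝ → ℝ) (α : ℝ) (j : Fin k) (u : Kernel (k + 1))
    (y : KernelSpace k) : ℂ :=
  smearedTrace ρ α u y (y (Sum.inl j)) - smearedTrace ρ α u y (y (Sum.inr j))

/-- `f = B_{j,k+1} u = Tr_{k+1} [δ(y_j - y_{k+1}), u]` on `(0, T) × ℝᵏ × ℝᵏ`: for every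
mollifier, the mollified collision terms converge to `f` as `α → 0⁺` in the sense of
distributions. -/
def IsCollisionTerm {k : ℕ} (T : ℝ) (j : Fin k) (u : ℝ → Kernel (k + 1)) (f : ℝ → Kernel k) :
    Prop :=
  ∀ ρ : ℝ → ℝ, IsMollifier ρ →
    ∀ φ : ℝ × KernelSpace k → ℂ, ContDiff ℝ (⊤ : ℕ∞) φ → HasCompactSupport φ →
      tsupport φ ⊆ Set.Ioo 0 T ×ˢ Set.univ →
        Tendsto
          (fun α : ℝ => ∫ τ in Set.Ioo 0 T, ∫ y, φ (τ, y) * smearedCollision ρ α j (u τ) y)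
          (𝓝[>] 0) (𝓝 (∫ τ in Set.Ioo 0 T, ∫ y, φ (τ, y) * f τ y))

/-- The factor `g(τ) = (1 + ω²τ²)^{-1/2}` that the lens transform produces. -/
def lensFactor (ω τ : ℝ) : ℝ := (1 + ω ^ 2 * τ ^ 2) ^ (-(1 / 2) : ℝ)

/-- `{u^{(k)}}_{k ≥ 1}` is a solution on `[0, T]` of the focusing hierarchy
`i ∂_τ u^{(k)} = [-½Δ, u^{(k)}] - g(τ) b₀ ∑_{j ≤ k} B_{j,k+1} u^{(k+1)}`
in its integral form; `Bu k j τ` is the kernel `B_{j,k+1} u^{(k+1)}(τ)`. The kernels are invariant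
under permutations of the particles, as (differences of) limits of marginal densities of bosonic
wave functions are. -/
structure IsSolution (ω b₀ T : ℝ) (u : (k : ℕ) → ℝ → Kernel k)
    (Bu : (k : ℕ) → Fin k → ℝ → Kernel k) : Prop where
  symmetric : ∀ k, 1 ≤ k → ∀ τ ∈ Set.Icc 0 T, ∀ σ : Equiv.Perm (Fin k),
    (fun y => u k τ (permute σ y)) =ᵐ[volume] u k τ
  collision : ∀ (k : ℕ) (j : Fin k), IsCollisionTerm T j (u (k + 1)) (Bu k j)
  integrable : ∀ (k : ℕ) (j : Fin k), IntegrableOn (Bu k j) (Set.Icc 0 T) volume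
  duhamel : ∀ k, 1 ≤ k → ∀ τ ∈ Set.Icc 0 T,
    u k τ = freeEvolution τ (u k 0) +
      (Complex.I * (b₀ : ℂ)) •
        ∑ j : Fin k, ∫ s in (0 : ℝ)..τ, freeEvolution (τ - s) ((lensFactor ω s : ℂ) • Bu k j s)

end

end GPHierarchy

/-! Let `w k` be the inhomogeneity of the `k`-th equation, taken on the Fourier side, multiplied by
`⟨ξ⟩^ε` and pulled back by the free flow (`source`). Since the initial data vanish, Duhamel's
formula says that the Fourier transform of `u k τ` is the image of `∫₀^τ w k` under the injective
operator `evolve`, and the hierarchy becomes the linear system `w k r = ∑ j, b k j r (∫₀^r w (k +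
1))`. The a priori bound gives `‖w k‖_{L¹} ≤ k b₀ C ^ k`, and it has to be shown that all primitives
of `w k` vanish. Iterating the system `n` times expresses the primitive of `w k` through `w (k +
n)`, as a sum of `k (k + 1) ⋯ (k + n - 1)` terms. Two facts defeat this factorial.

Collapsing estimate. At a fixed output frequency a collision is an oscillatory integral over the
pair `(a, b)` of frequencies traced out, with phase `tΩ` and `Ω` proportional to `(a - η)(a + b)`.
Majorizing the time interval by a Gaussian, expanding the square and applying Schur's test reduces
the `L²` bound in time to `exists_lintegral_weight_le`, which holds for every `ε > 0`, uniformly in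
`η` and in the number of particles. The Cauchy-Schwarz inequality in time then gives a factor `√(t₁
- t₀)` per collision.

Combinatorics. Collisions with different particles commute up to relabelling, and `w` is symmetric.
If every particle carries its own upper time limit (`dyson`), the outermost collision of a chosen
particle can be moved to the outside of the whole product (`dyson_succ_eq_update_add`). Hence the
number `N(n, s)` of terms to estimate, with `n` collisions and `s` particles allowed to collide,
obeys `N(n + 1, s + 1) ≤ N(n + 1, s) + N(n, s + 2)`, which `2 ^ (2 n + s)` solves: exponential
instead of factorial growth.

On an interval of length `δ` the primitive of `w k` is thus at most `2 ^ (2 n + k) (K √δ) ^ n (k +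
n) b₀ C ^ (k + n)`, which tends to zero once `K √δ ≤ 1 / (8 C)`. As `δ` does not depend on where the
interval starts, finitely many steps cover `[0, T]`.

The collision operators are controlled only after integration in time, and the hierarchy defines
them by a limit of mollifications. All the algebra is therefore done with a cutoff in `(a, b)`, the
Fourier transform of the mollifier, which makes them bounded; the estimates are uniform in the
cutoff. Applied to primitives, the cutoff operators converge in `L¹` in time, and testing against
products identifies the limit with the given collision term (`ae_eq_interaction`). For fixed `n` the
iterated formula then holds up to an error that disappears with the cutoff. -/

namespace GPHierarchy

noncomputable section

/-! ### Combinatorics of iterated collisions -/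

/-- A family of one-step collision operators `b k j t : H (k + 1) → H k`, which merge the last
particle into the `j`-th one at time `t`, with an action of the permutations of the particles. -/
structure CollisionFamily (H : ℕ → Type) [∀ k, NormedAddCommGroup (H k)]
    [∀ k, NormedSpace ℝ (H k)] where
  b : ∀ k, Fin k → ℝ → H (k + 1) →L[ℝ] H k
  act : ∀ k, Equiv.Perm (Fin k) → H k →L[ℝ] H k
  continuous_b : ∀ k j, Continuous fun p : ℝ × H (k + 1) => b k j p.1 p.2
  equivariant : ∀ (k : ℕ) (σ : Equiv.Perm (Fin k)) (σ' : Equiv.Perm (Fin (k + 1))),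
    (∀ j : Fin k, σ' j.castSucc = (σ j).castSucc) → σ' (Fin.last k) = Fin.last k →
      ∀ j t h, act k σ (b k j t h) = b k (σ j) t (act (k + 1) σ' h)
  -- The inner collision consumes the last particle and the outer one the last but one, so
  -- exchanging the two collisions exchanges these particles; the transposition compensates for
  -- that.
  comm : ∀ (k : ℕ) (i j : Fin k), i ≠ j → ∀ r r' h,
    b k i r (b (k + 1) j.castSucc r' h) = b k j r' (b (k + 1) i.castSucc r
      (act (k + 2) (Equiv.swap (Fin.last k).castSucc (Fin.last (k + 1))) h))

theorem exists_perm_extend {k : ℕ} (σ : Equiv.Perm (Fin k)) :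
    ∃ σ' : Equiv.Perm (Fin (k + 1)), (∀ j : Fin k, σ' j.castSucc = (σ j).castSucc) ∧
      σ' (Fin.last k) = Fin.last k := by
  refine ⟨(finSuccEquivLast.trans (Equiv.optionCongr σ)).trans finSuccEquivLast.symm, ?_, ?_⟩
  · intro j
    simp
  · simp

/-- Interchange of the order of integration over `{(r, r') | r' ≤ r}`. -/
theorem integral_integral_min_swap {E : Type*} [NormedAddCommGroup E] [NormedSpace ℝ E]
    [CompleteSpace E] (K : ℝ → ℝ → E) (hK : Continuous K.uncurry) {s a b : ℝ} (ha : s ≤ a)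
    (hb : s ≤ b) :
    ∫ r in s..a, ∫ r' in s..min b r, K r r' = ∫ r' in s..b, ∫ r in min a r'..a, K r r' := by
  have hint : Integrable (Function.uncurry fun r r' => if r' ≤ r then K r r' else 0)
      ((volume.restrict (Set.Ioc s a)).prod (volume.restrict (Set.Ioc s b))) := by
    have h1 : Integrable (Function.uncurry K)
        ((volume.restrict (Set.Ioc s a)).prod (volume.restrict (Set.Ioc s b))) := by
      rw [Measure.prod_restrict]
      exact (hK.continuousOn.integrableOn_compact (μ := volume.prod volume)
        (isCompact_Icc.prod isCompact_Icc)).mono_set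
        (Set.prod_mono Set.Ioc_subset_Icc_self Set.Ioc_subset_Icc_self)
    have h2 : MeasurableSet {p : ℝ × ℝ | p.2 ≤ p.1} := measurableSet_le measurable_snd measurable_fst
    refine (h1.indicator h2).congr (Eventually.of_forall fun p => ?_)
    simp [Set.indicator, Function.uncurry]
  have := integral_integral_swap hint
  have e1 : ∀ r ∈ Set.Ioc s a, ∫ r' in s..min b r, K r r' =
      ∫ r' in Set.Ioc s b, if r' ≤ r then K r r' else 0 := by
    intro r hr
    rw [intervalIntegral.integral_of_le (le_min hb hr.1.le)]
    have : ∀ r', (if r' ≤ r then K r r' else 0) = (Set.Iic r).indicator (K r) r' := by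
      intro r'; simp [Set.indicator]
    simp_rw [this]
    rw [setIntegral_indicator measurableSet_Iic, Set.Ioc_inter_Iic]
  have e2 : ∀ r' ∈ Set.Ioc s b, ∫ r in min a r'..a, K r r' =
      ∫ r in Set.Ioc s a, if r' ≤ r then K r r' else 0 := by
    intro r' hr
    rw [intervalIntegral.integral_of_le (min_le_left _ _)]
    have : ∀ r, (if r' ≤ r then K r r' else 0) = (Set.Ici r').indicator (fun r => K r r') r := by
      intro r; simp [Set.indicator]
    simp_rw [this]
    rw [setIntegral_indicator measurableSet_Ici]
    rcases le_or_gt a r' with h | h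
    · rw [min_eq_left h, Set.Ioc_self, setIntegral_empty]
      have : Set.Ioc s a ∩ Set.Ici r' ⊆ {a} := by
        rintro x ⟨hx, hx'⟩
        exact le_antisymm hx.2 (h.trans hx')
      symm
      exact setIntegral_measure_zero _ (measure_mono_null this (by simp))
    · rw [min_eq_right h.le]
      rw [← integral_Icc_eq_integral_Ioc]
      congr 2
      ext x
      simp only [Set.mem_Icc, Set.mem_inter_iff, Set.mem_Ioc, Set.mem_Ici]
      constructor
      · rintro ⟨h1, h2⟩
        exact ⟨⟨lt_of_lt_of_le hr.1 h1, h2⟩, h1⟩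
      · rintro ⟨⟨h1, h2⟩, h3⟩
        exact ⟨h3, h2⟩
  rw [intervalIntegral.integral_of_le ha, intervalIntegral.integral_of_le hb,
    setIntegral_congr_fun measurableSet_Ioc e1, setIntegral_congr_fun measurableSet_Ioc e2, this]

namespace CollisionFamily

variable {H : ℕ → Type} [∀ k, NormedAddCommGroup (H k)] [∀ k, NormedSpace ℝ (H k)]

/-- The sum of all the `n`-fold iterated collision terms with the `k`-particle output, where the
collisions take place after time `s`, and those of the `i`-th particle before time `τ i`. -/
def dyson (c : CollisionFamily H) (s : ℝ) (f : ∀ m, H m) : ∀ (_ k : ℕ), (Fin k → ℝ) → H k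
  | 0, k, _ => f k
  | n + 1, k, τ => ∑ j, ∫ r in s..τ j,
      c.b k j r (dyson c s f n (k + 1) (Fin.snoc (fun i => min (τ i) r) r))

variable (c : CollisionFamily H)

theorem dyson_zero (s : ℝ) (f : ∀ m, H m) (k : ℕ) (τ : Fin k → ℝ) :
    c.dyson s f 0 k τ = f k := rfl

theorem dyson_succ (s : ℝ) (f : ∀ m, H m) (n k : ℕ) (τ : Fin k → ℝ) :
    c.dyson s f (n + 1) k τ = ∑ j, ∫ r in s..τ j,
      c.b k j r (c.dyson s f n (k + 1) (Fin.snoc (fun i => min (τ i) r) r)) := rfl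

theorem continuous_snoc {X : Type*} [TopologicalSpace X] {k : ℕ} {g : X → Fin k → ℝ} {h : X → ℝ}
    (hg : Continuous g) (hh : Continuous h) :
    Continuous fun x => (Fin.snoc (α := fun _ => ℝ) (g x) (h x) : Fin (k + 1) → ℝ) :=
  Continuous.finSnoc (A := fun _ => ℝ) hg hh

theorem continuous_b_apply {X : Type*} [TopologicalSpace X] {k : ℕ} (j : Fin k) {t : X → ℝ}
    {h : X → H (k + 1)} (ht : Continuous t) (hh : Continuous h) :
    Continuous fun x => c.b k j (t x) (h x) :=
  (c.continuous_b k j).comp (ht.prodMk hh)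

/-- Continuity is joint in the starting time, the seed and the limits, because the remainder of
Duhamel's formula integrates over a starting time on which the seed depends too. -/
theorem continuous_dyson (n : ℕ) : ∀ {X : Type} [TopologicalSpace X] {k : ℕ}
    {s : X → ℝ} {f : X → ∀ m, H m} {τ : X → Fin k → ℝ}, Continuous s → Continuous f →
    Continuous τ → Continuous fun x => c.dyson (s x) (f x) n k (τ x) := by
  induction n with
  | zero =>
    intro X _ k s f τ _ hf _
    exact (continuous_apply k).comp hf
  | succ n ih =>
    intro X _ k s f τ hs hf hτ
    simp only [dyson_succ]
    refine continuous_finsetSum _ fun j _ => ?_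
    have hF : Continuous (Function.uncurry fun (x : X) (r : ℝ) =>
        c.b k j r (c.dyson (s x) (f x) n (k + 1) (Fin.snoc (fun i => min (τ x i) r) r))) := by
      refine c.continuous_b_apply j continuous_snd ?_
      refine ih (hs.comp continuous_fst) (hf.comp continuous_fst) ?_
      refine continuous_snoc ?_ continuous_snd
      exact continuous_pi fun i => ((continuous_apply i).comp (hτ.comp continuous_fst)).min
        continuous_snd
    -- Both endpoints move with `x`; a fixed base point `0` reduces this to integrals with one
    -- moving endpoint.
    have hsub : ∀ x, (∫ r in s x..τ x j,
        c.b k j r (c.dyson (s x) (f x) n (k + 1) (Fin.snoc (fun i => min (τ x i) r) r))) =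
        (∫ r in (0 : ℝ)..τ x j,
          c.b k j r (c.dyson (s x) (f x) n (k + 1) (Fin.snoc (fun i => min (τ x i) r) r))) -
        ∫ r in (0 : ℝ)..s x,
          c.b k j r (c.dyson (s x) (f x) n (k + 1) (Fin.snoc (fun i => min (τ x i) r) r)) := by
      intro x
      have hc : Continuous fun r =>
          c.b k j r (c.dyson (s x) (f x) n (k + 1) (Fin.snoc (fun i => min (τ x i) r) r)) :=
        hF.comp (Continuous.prodMk_right x)
      rw [intervalIntegral.integral_interval_sub_left (hc.intervalIntegrable _ _)
        (hc.intervalIntegrable _ _)]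
    simp_rw [hsub]
    exact (intervalIntegral.continuous_parametric_intervalIntegral_of_continuous hF
      ((continuous_apply j).comp hτ)).sub
      (intervalIntegral.continuous_parametric_intervalIntegral_of_continuous hF hs)

/-- A family of vectors that are invariant under permutations of the particles. -/
def IsSymmetric (f : ∀ m, H m) : Prop := ∀ m σ, c.act m σ (f m) = f m

theorem continuous_dyson_comp {X : Type} [TopologicalSpace X] (s : ℝ) (f : ∀ m, H m) (n : ℕ)
    {k : ℕ} {τ : X → Fin k → ℝ} (hτ : Continuous τ) : Continuous fun x => c.dyson s f n k (τ x) :=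
  c.continuous_dyson n continuous_const continuous_const hτ

theorem continuous_dyson_min (s : ℝ) (f : ∀ m, H m) (n : ℕ) {k : ℕ} (τ : Fin k → ℝ) :
    Continuous fun r : ℝ => c.dyson s f n (k + 1) (Fin.snoc (fun i => min (τ i) r) r) :=
  c.continuous_dyson n continuous_const continuous_const <|
    continuous_snoc (continuous_pi fun _ => continuous_const.min continuous_id) continuous_id

theorem continuous_b_dyson_min (s : ℝ) (f : ∀ m, H m) (n : ℕ) {k : ℕ} (τ : Fin k → ℝ)
    (j : Fin k) : Continuous fun r : ℝ =>
      c.b k j r (c.dyson s f n (k + 1) (Fin.snoc (fun i => min (τ i) r) r)) :=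
  c.continuous_b_apply j continuous_id (c.continuous_dyson_min s f n τ)

variable {c} [∀ k, CompleteSpace (H k)]

/-- Equivariance pushes `σ` through each collision, extended so as to fix the newly created
particle, until it reaches the symmetric seed; only the time limits are permuted. -/
theorem act_dyson {f : ∀ m, H m} (hf : c.IsSymmetric f) (s : ℝ) (n : ℕ) :
    ∀ (k : ℕ) (σ : Equiv.Perm (Fin k)) (τ : Fin k → ℝ),
      c.act k σ (c.dyson s f n k (fun i => τ (σ i))) = c.dyson s f n k τ := by
  induction n with
  | zero => exact fun k σ _ => hf k σ
  | succ n ih =>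
    intro k σ τ
    obtain ⟨σ', h1, h2⟩ := exists_perm_extend σ
    rw [dyson_succ, dyson_succ, map_sum]
    conv_rhs => rw [← Equiv.sum_comp σ]
    refine Finset.sum_congr rfl fun j _ => ?_
    rw [← ContinuousLinearMap.intervalIntegral_comp_comm _
      ((c.continuous_b_dyson_min s f n (fun i => τ (σ i)) j).intervalIntegrable _ _)]
    refine intervalIntegral.integral_congr fun r _ => ?_
    rw [c.equivariant k σ σ' h1 h2, ← ih (k + 1) σ' (Fin.snoc (fun i => min (τ i) r) r)]
    congr 4
    funext i
    refine Fin.lastCases ?_ (fun i => ?_) i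
    · rw [h2, Fin.snoc_last, Fin.snoc_last]
    · rw [h1, Fin.snoc_castSucc, Fin.snoc_castSucc]

omit [∀ k, CompleteSpace (H k)] in
variable (c) in
-- The outermost collision is cut at the time `r'`. If it happens earlier, all inner limits are
-- already lowered below `r'`, so replacing `τ` by `min τ r'` changes nothing.
theorem dyson_succ_eq_min_add (f : ∀ m, H m) {s r' : ℝ} (hr' : s ≤ r') (n k : ℕ)
    {τ : Fin k → ℝ} (hτ : ∀ i, s ≤ τ i) :
    c.dyson s f (n + 1) k τ = c.dyson s f (n + 1) k (fun i => min (τ i) r') +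
      ∑ i, ∫ r in min (τ i) r'..τ i,
        c.b k i r (c.dyson s f n (k + 1) (Fin.snoc (fun i => min (τ i) r) r)) := by
  rw [dyson_succ, dyson_succ, ← Finset.sum_add_distrib]
  refine Finset.sum_congr rfl fun i _ => ?_
  have hc := c.continuous_b_dyson_min s f n τ i
  rw [← intervalIntegral.integral_add_adjacent_intervals (hc.intervalIntegrable s (min (τ i) r'))
    (hc.intervalIntegrable _ _)]
  congr 1
  refine intervalIntegral.integral_congr fun r hr => ?_
  rw [Set.uIcc_of_le (le_min (hτ i) hr')] at hr
  have : ∀ i, min (min (τ i) r') r = min (τ i) r := fun i => by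
    rw [min_assoc, min_eq_right (hr.2.trans (min_le_right _ _))]
  simp only [this]

/-- The collisions of the `j₀`-th particle may be carried out last. -/
theorem dyson_succ_eq_update_add {f : ∀ m, H m} (hf : c.IsSymmetric f) (s : ℝ) (n : ℕ) :
    ∀ (k : ℕ) (τ : Fin k → ℝ), (∀ i, s ≤ τ i) → ∀ j₀ : Fin k,
      c.dyson s f (n + 1) k τ = c.dyson s f (n + 1) k (Function.update τ j₀ s) +
        ∫ r in s..τ j₀,
          c.b k j₀ r (c.dyson s f n (k + 1) (Fin.snoc (Function.update τ j₀ r) r)) := by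
  induction n with
  | zero =>
    intro k τ _ j₀
    simp only [dyson_succ, dyson_zero]
    rw [← Finset.add_sum_erase _ _ (Finset.mem_univ j₀),
      ← Finset.add_sum_erase (a := j₀) _
        (fun j => ∫ r in s..Function.update τ j₀ s j, c.b k j r (f (k + 1)))
        (Finset.mem_univ j₀)]
    rw [Function.update_self, intervalIntegral.integral_same, zero_add, add_comm]
    congr 1
    refine Finset.sum_congr rfl fun j hj => ?_
    rw [Function.update_of_ne (Finset.ne_of_mem_erase hj)]
  | succ n ih =>
    intro k τ hτ j₀
    -- The terms that must be reordered: the outermost collision is that of `j` at `r`, and the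
    -- outermost one of `j₀` follows inside at `r' ≤ r`.
    set K : Fin k → ℝ → ℝ → H k := fun j r r' => c.b k j r (c.b (k + 1) j₀.castSucc r'
      (c.dyson s f n (k + 2) (Fin.snoc (Fin.snoc
        (Function.update (fun i => min (τ i) r) j₀ r') r : Fin (k + 1) → ℝ) r'))) with hKdef
    have hK : ∀ j, Continuous (K j).uncurry := by
      intro j
      refine c.continuous_b_apply j continuous_fst (c.continuous_b_apply _ continuous_snd
        (c.continuous_dyson n continuous_const continuous_const ?_))
      refine continuous_snoc (continuous_snoc ?_ continuous_fst) continuous_snd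
      exact Continuous.update (continuous_pi fun i => continuous_const.min continuous_fst) _
        continuous_snd
    -- Inside an outermost collision of `j ≠ j₀`, induction leaves two cases: `j₀` never collides,
    -- or it does so at some `r' ≤ min (τ j₀) r`. Fubini makes `r'` the outer variable.
    have hleft : ∀ j ∈ Finset.univ.erase j₀, (∫ r in s..τ j,
        c.b k j r (c.dyson s f (n + 1) (k + 1) (Fin.snoc (fun i => min (τ i) r) r))) =
        (∫ r in s..Function.update τ j₀ s j, c.b k j r (c.dyson s f (n + 1) (k + 1)
          (Fin.snoc (fun i => min (Function.update τ j₀ s i) r) r))) +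
        ∫ r' in s..τ j₀, ∫ r in min (τ j) r'..τ j, K j r r' := by
      intro j hj
      have hjne := Finset.ne_of_mem_erase hj
      have hcont : Continuous fun r => ∫ r' in s..min (τ j₀) r, K j r r' :=
        intervalIntegral.continuous_parametric_intervalIntegral_of_continuous (hK j)
          (continuous_const.min continuous_id)
      rw [Function.update_of_ne hjne, ← integral_integral_min_swap (K j) (hK j) (hτ j) (hτ j₀),
        ← intervalIntegral.integral_add
          ((c.continuous_b_dyson_min s f (n + 1) _ j).intervalIntegrable _ _)
          (hcont.intervalIntegrable _ _)]
      refine intervalIntegral.integral_congr fun r hr => ?_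
      rw [Set.uIcc_of_le (hτ j)] at hr
      rw [ih (k + 1) (Fin.snoc (fun i => min (τ i) r) r) ?_ j₀.castSucc, map_add]
      · congr 1
        · rw [← Fin.snoc_update]
          congr 4
          funext i
          by_cases h : i = j₀
          · subst h
            simp [hr.1]
          · simp [h]
        · rw [← ContinuousLinearMap.intervalIntegral_comp_comm]
          · simp only [Fin.snoc_castSucc, hKdef, Fin.snoc_update, min_def]
          · refine Continuous.intervalIntegrable (c.continuous_b_apply _ continuous_id
              (c.continuous_dyson n continuous_const continuous_const ?_)) _ _
            exact continuous_snoc (Continuous.update continuous_const _ continuous_id)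
              continuous_id
      · intro i
        refine Fin.lastCases ?_ (fun i => ?_) i
        · simpa using hr.1
        · simpa using ⟨hτ i, hr.1⟩
    -- The inner sum is cut at `r'`. The early part is the `j₀`-term of the definition of `dyson`;
    -- the late part is the reordered `K`. The particle `j₀` and the new one do not contribute to
    -- the late part, as their limit is `r'`.
    have hright : (∫ r' in s..τ j₀, c.b k j₀ r' (c.dyson s f (n + 1) (k + 1)
          (Fin.snoc (Function.update τ j₀ r') r'))) =
        (∫ r' in s..τ j₀, c.b k j₀ r' (c.dyson s f (n + 1) (k + 1)
          (Fin.snoc (fun i => min (τ i) r') r'))) +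
        ∑ j ∈ Finset.univ.erase j₀, ∫ r' in s..τ j₀, ∫ r in min (τ j) r'..τ j, K j r r' := by
      have hcont : ∀ j, Continuous fun r' => ∫ r in min (τ j) r'..τ j, K j r r' := by
        intro j
        have : Continuous fun r' => ∫ r in τ j..min (τ j) r', K j r r' :=
          intervalIntegral.continuous_parametric_intervalIntegral_of_continuous
            (f := fun r' r => K j r r') ((hK j).comp continuous_swap)
            (continuous_const.min continuous_id)
        simp_rw [intervalIntegral.integral_symm (τ j) (min _ _)]
        exact this.neg
      rw [← intervalIntegral.integral_finsetSum fun j _ => (hcont j).intervalIntegrable _ _,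
        ← intervalIntegral.integral_add
          ((c.continuous_b_dyson_min s f (n + 1) _ j₀).intervalIntegrable _ _)
          ((continuous_finsetSum _ fun j _ => hcont j).intervalIntegrable _ _)]
      refine intervalIntegral.integral_congr fun r' hr' => ?_
      rw [Set.uIcc_of_le (hτ j₀)] at hr'
      rw [c.dyson_succ_eq_min_add f hr'.1 n (k + 1), map_add]
      · congr 1
        · congr 2
          funext i
          refine Fin.lastCases ?_ (fun i => ?_) i
          · simp
          · by_cases h : i = j₀
            · subst h
              simp [hr'.2]
            · simp [h]
        · rw [Fin.sum_univ_castSucc, ← Finset.add_sum_erase _ _ (Finset.mem_univ j₀)]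
          simp only [Fin.snoc_castSucc, Fin.snoc_last, Function.update_self, min_self,
            intervalIntegral.integral_same, zero_add, add_zero, map_sum]
          refine Finset.sum_congr rfl fun j hj => ?_
          have hjne := Finset.ne_of_mem_erase hj
          rw [Function.update_of_ne hjne, ← ContinuousLinearMap.intervalIntegral_comp_comm _
            ((c.continuous_b_dyson_min s f n _ _).intervalIntegrable _ _)]
          rcases le_total (τ j) r' with h | h
          · simp only [min_eq_left h, intervalIntegral.integral_same]
          refine intervalIntegral.integral_congr fun r hr => ?_
          rw [min_eq_right h, Set.uIcc_of_le h] at hr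
          simp only [hKdef]
          -- The two collisions change places; the resulting transposition is absorbed by the
          -- symmetry of the inner sum, `act_dyson`.
          rw [c.comm k j j₀ hjne]
          congr 2
          rw [← act_dyson hf s n (k + 2)
            (Equiv.swap (Fin.last k).castSucc (Fin.last (k + 1)))]
          congr 2
          funext i
          refine Fin.lastCases ?_ (fun i => ?_) i
          · simp [-Fin.snoc_update, hr.1]
          · refine Fin.lastCases ?_ (fun i => ?_) i
            · simp [-Fin.snoc_update]
            · rw [Equiv.swap_apply_of_ne_of_ne (by simp [Fin.ext_iff, i.2.ne]) (by simp [Fin.ext_iff]; omega)]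
              simp only [Fin.snoc_castSucc]
              by_cases h : i = j₀
              · subst h
                simp [hr.1]
              · simp [h]
      · intro i
        refine Fin.lastCases ?_ (fun i => ?_) i
        · simpa using hr'.1
        · by_cases h : i = j₀
          · subst h
            simpa using hr'.1
          · simpa [h] using hτ i
    rw [hright, dyson_succ c s f (n + 1), dyson_succ c s f (n + 1),
      ← Finset.add_sum_erase _ _ (Finset.mem_univ j₀),
      ← Finset.add_sum_erase (a := j₀) _ (fun j => ∫ r in s..Function.update τ j₀ s j,
        c.b k j r (c.dyson s f (n + 1) (k + 1)
          (Fin.snoc (fun i => min (Function.update τ j₀ s i) r) r))) (Finset.mem_univ j₀),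
      Finset.sum_congr rfl hleft, Finset.sum_add_distrib, Function.update_self,
      intervalIntegral.integral_same]
    abel

end CollisionFamily

/-! ### Exponential bound on iterated collisions -/

namespace CollisionFamily

variable {H : ℕ → Type} [∀ k, NormedAddCommGroup (H k)] [∀ k, NormedSpace ℝ (H k)]
  [∀ k, CompleteSpace (H k)] {c : CollisionFamily H}

/-- The bound on the iterated collision terms, with parameters: at most `4 ^ n` times as many
terms as there are particles have to be estimated, and each of them loses the factor `κ ^ n`. -/
theorem lintegral_dyson_le {f : ∀ m, H m} (hf : c.IsSymmetric f) {s t₁ : ℝ} (hst : s ≤ t₁)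
    {κ F : ℝ≥0∞} (hF : ∀ m, ‖f m‖ₑ ≤ F)
    (hb : ∀ k j h, ∫⁻ r in Set.Icc s t₁, ‖c.b k j r h‖ₑ ≤ κ * ‖h‖ₑ) {E : Type}
    [NormedAddCommGroup E] [NormedSpace ℝ E] [CompleteSpace E] (n : ℕ) :
    ∀ (P : Type) [TopologicalSpace P] [MeasurableSpace P] [BorelSpace P]
      [SecondCountableTopology P] (μ : Measure P) [SFinite μ] (k : ℕ) (Q : P → H k →L[ℝ] E)
      (_ : Continuous fun p : P × H k => Q p.1 p.2) (a : ℝ≥0∞)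
      (_ : ∀ h, ∫⁻ p, ‖Q p h‖ₑ ∂μ ≤ a * ‖h‖ₑ) (S : Finset (Fin k)) (τ : P → Fin k → ℝ)
      (_ : Continuous τ) (_ : ∀ p i, s ≤ τ p i ∧ τ p i ≤ t₁) (_ : ∀ p, ∀ i ∉ S, τ p i = s),
      ∫⁻ p, ‖Q p (c.dyson s f n k (τ p))‖ₑ ∂μ ≤ 2 ^ (2 * n + S.card) * a * κ ^ n * F := by
  induction n with
  | zero =>
    intro P _ _ _ _ μ _ k Q hQ a ha S τ hτc hτ hS
    simp only [dyson_zero, Nat.mul_zero, zero_add, pow_zero, mul_one]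
    calc _ ≤ a * ‖f k‖ₑ := ha _
      _ ≤ a * F := by gcongr; exact hF k
      _ = 1 * a * F := by rw [one_mul]
      _ ≤ _ := by gcongr; exact one_le_pow₀ (by norm_num)
  | succ n ih =>
    intro P _ _ _ _ μ _ k Q hQ a ha S
    induction S using Finset.induction_on with
    | empty =>
      intro τ hτc hτ hS
      have : ∀ p, c.dyson s f (n + 1) k (τ p) = 0 := by
        intro p
        rw [dyson_succ]
        refine Finset.sum_eq_zero fun j _ => ?_
        rw [hS p j (by simp), intervalIntegral.integral_same]
      simp [this]
    | insert j₀ S hj₀ ihS =>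
      intro τ hτc hτ hS
      -- The induction hypothesis wants time limits in `[s, t₁]` for every parameter, while `r` runs
      -- over the whole line; clamping changes nothing on the support of the restricted measure.
      set cl : ℝ → ℝ := fun r => max s (min t₁ r) with hcl
      have hclc : Continuous cl := continuous_const.max (continuous_const.min continuous_id)
      set τ' : P × ℝ → Fin (k + 1) → ℝ := fun p =>
        Fin.snoc (Function.update (τ p.1) j₀ (cl p.2)) (cl p.2) with hτ'
      have hτ'c : Continuous τ' := continuous_snoc
        ((hτc.comp continuous_fst).update _ (hclc.comp continuous_snd))
        (hclc.comp continuous_snd)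
      -- The collision of `j₀` joins `Q` and its time joins the parameters, at the price of a factor
      -- `κ` by Tonelli. This is why the induction runs over all `P`, `Q` and `a`: the bound `hb` is
      -- for time-independent vectors, and the remaining sum depends on the times only through its
      -- limits.
      set Q' : P × ℝ → H (k + 1) →L[ℝ] E := fun p => (Q p.1).comp (c.b k j₀ p.2) with hQ'
      have hQ'c : Continuous fun p : (P × ℝ) × H (k + 1) => Q' p.1 p.2 := by
        refine hQ.comp (f := fun p : (P × ℝ) × H (k + 1) => (p.1.1, c.b k j₀ p.1.2 p.2)) ?_
        exact (continuous_fst.comp continuous_fst).prodMk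
          (c.continuous_b_apply _ (continuous_snd.comp continuous_fst) continuous_snd)
      have hmeas : ∀ h, Measurable fun p => ‖Q' p h‖ₑ := fun h =>
        (hQ'c.comp (continuous_id.prodMk continuous_const)).enorm.measurable
      have ha' : ∀ h, ∫⁻ p, ‖Q' p h‖ₑ ∂(μ.prod (volume.restrict (Set.Icc s t₁))) ≤
          (a * κ) * ‖h‖ₑ := by
        intro h
        rw [lintegral_prod_symm _ (hmeas h).aemeasurable]
        calc _ ≤ ∫⁻ r in Set.Icc s t₁, a * ‖c.b k j₀ r h‖ₑ := lintegral_mono fun r => ha _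
          _ ≤ a * (κ * ‖h‖ₑ) := by
            have hm : Measurable fun r : ℝ => ‖c.b k j₀ r h‖ₑ :=
              (c.continuous_b_apply j₀ continuous_id continuous_const).enorm.measurable
            rw [lintegral_const_mul _ hm]
            gcongr
            exact hb _ _ _
          _ = _ := by rw [mul_assoc]
      have hτ'b : ∀ p i, s ≤ τ' p i ∧ τ' p i ≤ t₁ := by
        intro p i
        have hc : s ≤ cl p.2 ∧ cl p.2 ≤ t₁ := ⟨le_max_left _ _, max_le hst (min_le_left _ _)⟩
        refine Fin.lastCases ?_ (fun i => ?_) i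
        · simpa [hτ', -Fin.snoc_update] using hc
        · by_cases h : i = j₀
          · subst h
            simpa [hτ', -Fin.snoc_update] using hc
          · simpa [hτ', h, -Fin.snoc_update] using hτ p.1 i
      have h1 := ih (P × ℝ) (μ.prod (volume.restrict (Set.Icc s t₁))) (k + 1) Q' hQ'c (a * κ) ha'
        (insert (Fin.last k) ((insert j₀ S).map Fin.castSuccEmb)) τ' hτ'c hτ'b (by
          intro p i
          refine Fin.lastCases ?_ (fun i => ?_) i
          · simp
          · intro hi
            have hi' : i ∉ insert j₀ S := by
              intro h
              exact hi (Finset.mem_insert_of_mem (by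
                rw [← Fin.coe_castSuccEmb]; exact Finset.mem_map_of_mem _ h))
            have hne : i ≠ j₀ := fun h => hi' (h ▸ Finset.mem_insert_self _ _)
            simpa [hτ', hne, -Fin.snoc_update] using hS p.1 i hi')
      have h2 := ihS (fun p => Function.update (τ p) j₀ s) (hτc.update _ continuous_const) (by
          intro p i
          by_cases h : i = j₀
          · subst h
            simpa using hst
          · simpa [h] using hτ p i) (by
          intro p i hi
          by_cases h : i = j₀
          · subst h
            simp
          · simpa [h] using hS p i (by simp [h, hi]))
      -- Besides those in `S`, the particle `j₀` may collide again and the new particle may collide.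
      have hcard : (insert (Fin.last k) ((insert j₀ S).map Fin.castSuccEmb)).card ≤ S.card + 2 :=
        (Finset.card_insert_le _ _).trans (by
          rw [Finset.card_map, Finset.card_insert_of_notMem hj₀])
      have hcont : Continuous fun p : P × ℝ => Q' p (c.dyson s f n (k + 1) (τ' p)) :=
        hQ'c.comp (continuous_id.prodMk
          (c.continuous_dyson_comp s f n hτ'c))
      have hpt : ∀ p, ‖Q p (c.dyson s f (n + 1) k (τ p))‖ₑ ≤
          ‖Q p (c.dyson s f (n + 1) k (Function.update (τ p) j₀ s))‖ₑ +
          ∫⁻ r in Set.Icc s t₁, ‖Q' (p, r) (c.dyson s f n (k + 1) (τ' (p, r)))‖ₑ := by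
        intro p
        rw [dyson_succ_eq_update_add hf s n k (τ p) (fun i => (hτ p i).1) j₀, map_add]
        refine (enorm_add_le _ _).trans ?_
        gcongr
        have hci : Continuous fun r : ℝ => c.b k j₀ r
            (c.dyson s f n (k + 1) (Fin.snoc (Function.update (τ p) j₀ r) r)) :=
          c.continuous_b_apply j₀ continuous_id (c.continuous_dyson_comp s f n
            (continuous_snoc (continuous_const.update _ continuous_id) continuous_id))
        rw [intervalIntegral.integral_of_le (hτ p j₀).1]
        have hint : IntegrableOn (fun r : ℝ => c.b k j₀ r
            (c.dyson s f n (k + 1) (Fin.snoc (Function.update (τ p) j₀ r) r)))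
            (Set.Ioc s (τ p j₀)) :=
          (hci.intervalIntegrable s (τ p j₀)).1
        rw [← ContinuousLinearMap.integral_comp_comm _ hint]
        refine (enorm_integral_le_lintegral_enorm _).trans ?_
        have hsub : Set.Ioc s (τ p j₀) ⊆ Set.Icc s t₁ := fun r hr =>
          ⟨hr.1.le, hr.2.trans (hτ p j₀).2⟩
        refine le_trans ?_ (lintegral_mono_set hsub)
        refine setLIntegral_mono' measurableSet_Ioc fun r hr => ?_
        have : cl r = r := by
          simp only [hcl]
          rw [min_eq_right (hsub hr).2, max_eq_right (hsub hr).1]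
        simp only [hQ', hτ', this]
        rfl
      calc _ ≤ ∫⁻ p, (‖Q p (c.dyson s f (n + 1) k (Function.update (τ p) j₀ s))‖ₑ +
          ∫⁻ r in Set.Icc s t₁, ‖Q' (p, r) (c.dyson s f n (k + 1) (τ' (p, r)))‖ₑ) ∂μ :=
            lintegral_mono hpt
        _ = ∫⁻ p, ‖Q p (c.dyson s f (n + 1) k (Function.update (τ p) j₀ s))‖ₑ ∂μ +
          ∫⁻ p, ‖Q' p (c.dyson s f n (k + 1) (τ' p))‖ₑ
            ∂(μ.prod (volume.restrict (Set.Icc s t₁))) := by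
            rw [lintegral_prod _ hcont.enorm.measurable.aemeasurable, lintegral_add_left]
            exact (hQ.comp (continuous_id.prodMk (c.continuous_dyson_comp s f (n + 1)
              (hτc.update _ continuous_const)))).enorm.measurable
        -- Both powers of two equal `2 ^ (2 n + 2 + S.card)`, so their sum accounts exactly for the
        -- additional particle `j₀`.
        _ ≤ 2 ^ (2 * (n + 1) + S.card) * a * κ ^ (n + 1) * F +
          2 ^ (2 * n + (S.card + 2)) * (a * κ) * κ ^ n * F := by
            refine add_le_add h2 (h1.trans ?_)
            gcongr
            norm_num
        _ = _ := by
            rw [Finset.card_insert_of_notMem hj₀]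
            ring

/-- The case of a one-point parameter space, the identity for `Q`, and all `k` particles allowed to
collide. -/
theorem enorm_dyson_le {f : ∀ m, H m} (hf : c.IsSymmetric f) {s t : ℝ} (hst : s ≤ t)
    {κ F : ℝ≥0∞} (hF : ∀ m, ‖f m‖ₑ ≤ F)
    (hb : ∀ k j h, ∫⁻ r in Set.Icc s t, ‖c.b k j r h‖ₑ ≤ κ * ‖h‖ₑ) (n k : ℕ) :
    ‖c.dyson s f n k fun _ => t‖ₑ ≤ 2 ^ (2 * n + k) * κ ^ n * F := by
  have := lintegral_dyson_le hf hst hF hb n Unit (Measure.dirac ()) k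
    (fun _ => ContinuousLinearMap.id ℝ (H k)) continuous_snd 1 (by simp) Finset.univ
    (fun _ _ => t) continuous_const (fun _ _ => ⟨hst, le_rfl⟩) (by simp)
  simpa using this

end CollisionFamily

/-! ### Iterated Duhamel formula and abstract uniqueness -/

theorem integral_integral_triangle_swap {E : Type*} [NormedAddCommGroup E] [NormedSpace ℝ E]
    (G : ℝ → ℝ → E) {a b : ℝ} (hab : a ≤ b)
    (hG : Integrable (Function.uncurry fun s r => if s ≤ r then G s r else 0)
      ((volume.restrict (Set.Ioc a b)).prod (volume.restrict (Set.Ioc a b)))) :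
    ∫ s in a..b, ∫ r in s..b, G s r = ∫ r in a..b, ∫ s in a..r, G s r := by
  have := integral_integral_swap hG
  have e1 : ∀ s ∈ Set.Ioc a b, ∫ r in s..b, G s r =
      ∫ r in Set.Ioc a b, if s ≤ r then G s r else 0 := by
    intro s hs
    rw [intervalIntegral.integral_of_le hs.2, ← integral_Icc_eq_integral_Ioc]
    have : ∀ r, (if s ≤ r then G s r else 0) = (Set.Ici s).indicator (G s) r := by
      intro r; simp [Set.indicator]
    simp_rw [this]
    rw [setIntegral_indicator measurableSet_Ici]
    congr 2
    ext x
    simp only [Set.mem_Icc, Set.mem_inter_iff, Set.mem_Ioc, Set.mem_Ici]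
    exact ⟨fun h => ⟨⟨hs.1.trans_le h.1, h.2⟩, h.1⟩, fun h => ⟨h.2, h.1.2⟩⟩
  have e2 : ∀ r ∈ Set.Ioc a b, ∫ s in a..r, G s r =
      ∫ s in Set.Ioc a b, if s ≤ r then G s r else 0 := by
    intro r hr
    rw [intervalIntegral.integral_of_le hr.1.le]
    have : ∀ s, (if s ≤ r then G s r else 0) = (Set.Iic r).indicator (fun s => G s r) s := by
      intro s; simp [Set.indicator]
    simp_rw [this]
    rw [setIntegral_indicator measurableSet_Iic, Set.Ioc_inter_Iic, min_eq_right hr.2]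
  rw [intervalIntegral.integral_of_le hab, intervalIntegral.integral_of_le hab,
    setIntegral_congr_fun measurableSet_Ioc e1, setIntegral_congr_fun measurableSet_Ioc e2, this]

/-- Taking norms allows the inner integral to be extended to the whole interval, and Tonelli puts
the integration in `r` first. In this way a bound in `L¹` of time for constant vectors passes to
primitives. -/
theorem lintegral_apply_primitive_le {E F : Type*} [NormedAddCommGroup E] [NormedSpace ℝ E]
    [NormedAddCommGroup F] [NormedSpace ℝ F] [CompleteSpace E] [CompleteSpace F]
    {β : ℝ → E →L[ℝ] F} (hβ : Continuous fun p : ℝ × E => β p.1 p.2) {d : ℝ → E} {a b : ℝ}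
    (hd : IntegrableOn d (Set.Icc a b)) :
    ∫⁻ r in Set.Icc a b, ‖β r (∫ s in a..r, d s)‖ₑ ≤
      ∫⁻ s in Set.Icc a b, ∫⁻ r in Set.Icc a b, ‖β r (d s)‖ₑ := by
  have hm : AEMeasurable (Function.uncurry fun s r => ‖β r (d s)‖ₑ)
      ((volume.restrict (Set.Icc a b)).prod (volume.restrict (Set.Icc a b))) :=
    (hβ.comp_aestronglyMeasurable
      (measurable_snd.stronglyMeasurable.aestronglyMeasurable.prodMk
        hd.aestronglyMeasurable.comp_fst)).enorm
  rw [lintegral_lintegral_swap hm]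
  refine setLIntegral_mono' measurableSet_Icc fun r hr => ?_
  have hsub : Set.Ioc a r ⊆ Set.Icc a b := fun s hs => ⟨hs.1.le, hs.2.trans hr.2⟩
  rw [intervalIntegral.integral_of_le hr.1,
    ← ContinuousLinearMap.integral_comp_comm _ (hd.mono_set hsub)]
  exact (enorm_integral_le_lintegral_enorm _).trans (lintegral_mono_set hsub)

theorem continuousOn_primitive_Icc {E : Type*} [NormedAddCommGroup E] [NormedSpace ℝ E]
    {d : ℝ → E} {a b : ℝ} (hd : IntegrableOn d (Set.Icc a b)) :
    ContinuousOn (fun t => ∫ s in a..t, d s) (Set.Icc a b) := by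
  rcases le_or_gt a b with h | h
  · have := intervalIntegral.continuousOn_primitive_interval (μ := volume) (f := d) (a := a) (b := b)
      (by rwa [Set.uIcc_of_le h])
    rwa [Set.uIcc_of_le h] at this
  · simp [Set.Icc_eq_empty_of_lt h]

namespace CollisionFamily

variable {H : ℕ → Type} [∀ k, NormedAddCommGroup (H k)] [∀ k, NormedSpace ℝ (H k)]

/-- The remainder term of the `n`-fold iterated Duhamel formula, with the source `w` inserted. -/
def remainder (c : CollisionFamily H) (w : ∀ k, ℝ → H k) (t₀ : ℝ) (N n k : ℕ) (t : ℝ) : H k :=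
  ∫ s in t₀..t, c.dyson s (Pi.single N (w N s)) n k fun _ => t

variable {c : CollisionFamily H} {w : ∀ k, ℝ → H k} {t₀ t₁ : ℝ}
  {κ : ℝ≥0∞}

theorem isSymmetric_single {N : ℕ} {h : H N} (hh : ∀ σ, c.act N σ h = h) :
    c.IsSymmetric (Pi.single N h) := by
  intro m σ
  by_cases hm : m = N
  · subst hm
    simpa using hh σ
  · simp [Pi.single_eq_of_ne hm]

omit [∀ k, NormedSpace ℝ (H k)] in
theorem enorm_single_le {N : ℕ} (h : H N) (m : ℕ) : ‖(Pi.single N h : ∀ m, H m) m‖ₑ ≤ ‖h‖ₑ := by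
  by_cases hm : m = N
  · subst hm
    simp
  · simp [Pi.single_eq_of_ne hm]

theorem aestronglyMeasurable_dyson_single {Y : Type*} [MeasurableSpace Y] {μ : Measure Y}
    {s t : Y → ℝ} {N : ℕ} {h : Y → H N} (hs : Measurable s) (ht : Measurable t)
    (hh : AEStronglyMeasurable h μ) (n k : ℕ) :
    AEStronglyMeasurable (fun y => c.dyson (s y) (Pi.single N (h y)) n k fun _ => t y) μ := by
  have hc : Continuous fun p : (ℝ × ℝ) × H N =>
      c.dyson p.1.1 (Pi.single N p.2) n k fun _ => p.1.2 :=
    c.continuous_dyson n (continuous_fst.comp continuous_fst)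
      ((continuous_single N).comp continuous_snd)
      (continuous_pi fun _ => continuous_snd.comp continuous_fst)
  exact hc.comp_aestronglyMeasurable
    ((hs.prodMk ht).stronglyMeasurable.aestronglyMeasurable.prodMk hh)

variable [∀ k, CompleteSpace (H k)]

theorem enorm_dyson_single_le (hκ : ∀ k j h, ∫⁻ r in Set.Icc t₀ t₁, ‖c.b k j r h‖ₑ ≤ κ * ‖h‖ₑ)
    {N : ℕ} {h : H N} (hh : ∀ σ, c.act N σ h = h) {s t : ℝ} (hs : t₀ ≤ s) (hst : s ≤ t)
    (ht : t ≤ t₁) (n k : ℕ) :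
    ‖c.dyson s (Pi.single N h) n k fun _ => t‖ₑ ≤ 2 ^ (2 * n + k) * κ ^ n * ‖h‖ₑ :=
  enorm_dyson_le (isSymmetric_single hh) hst (enorm_single_le h)
    (fun k j h => (lintegral_mono_set (Set.Icc_subset_Icc hs ht)).trans (hκ k j h)) n k

theorem enorm_remainder_le (hκ : ∀ k j h, ∫⁻ r in Set.Icc t₀ t₁, ‖c.b k j r h‖ₑ ≤ κ * ‖h‖ₑ)
    {N : ℕ} (hsym : ∀ᵐ s ∂volume.restrict (Set.Icc t₀ t₁), ∀ σ, c.act N σ (w N s) = w N s)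
    {t : ℝ} (ht : t ∈ Set.Icc t₀ t₁) (hw : IntegrableOn (w N) (Set.Icc t₀ t₁)) (n k : ℕ) :
    ‖c.remainder w t₀ N n k t‖ₑ ≤
      2 ^ (2 * n + k) * κ ^ n * ∫⁻ s in Set.Icc t₀ t₁, ‖w N s‖ₑ := by
  have hsub : Set.Ioc t₀ t ⊆ Set.Icc t₀ t₁ := fun s hs => ⟨hs.1.le, hs.2.trans ht.2⟩
  rw [remainder, intervalIntegral.integral_of_le ht.1]
  refine (enorm_integral_le_lintegral_enorm _).trans ?_
  have h1 : ∀ᵐ s ∂volume.restrict (Set.Ioc t₀ t),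
      ‖c.dyson s (Pi.single N (w N s)) n k fun _ => t‖ₑ ≤ 2 ^ (2 * n + k) * κ ^ n * ‖w N s‖ₑ := by
    filter_upwards [ae_restrict_of_ae_restrict_of_subset hsub hsym,
      ae_restrict_mem measurableSet_Ioc] with s hs hmem
    exact enorm_dyson_single_le hκ hs hmem.1.le hmem.2 ht.2 n k
  refine (lintegral_mono_ae h1).trans ?_
  rw [lintegral_const_mul'' _ (hw.mono_set hsub).aestronglyMeasurable.enorm]
  gcongr

/-- Fubini on the triangle `s ≤ r`. The bound `hbd` on the operators at fixed times only makes the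
integrand integrable and enters no estimate; it may therefore degenerate as a cutoff is removed. -/
theorem remainder_succ (hκ : ∀ k j h, ∫⁻ r in Set.Icc t₀ t₁, ‖c.b k j r h‖ₑ ≤ κ * ‖h‖ₑ)
    (hκ' : κ ≠ ∞) (hbd : ∀ k j, ∃ K : ℝ, ∀ t, ‖c.b k j t‖ ≤ K) {N : ℕ}
    (hsym : ∀ᵐ s ∂volume.restrict (Set.Icc t₀ t₁), ∀ σ, c.act N σ (w N s) = w N s)
    {t : ℝ} (ht : t ∈ Set.Icc t₀ t₁) (hw : IntegrableOn (w N) (Set.Icc t₀ t₁)) (n k : ℕ) :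
    c.remainder w t₀ N (n + 1) k t =
      ∫ r in t₀..t, ∑ j, c.b k j r (c.remainder w t₀ N n (k + 1) r) := by
  have hsub : Set.Ioc t₀ t ⊆ Set.Icc t₀ t₁ := fun s hs => ⟨hs.1.le, hs.2.trans ht.2⟩
  have hw' := (hw.mono_set hsub)
  set G : Fin k → ℝ → ℝ → H k := fun j s r =>
    c.b k j r (c.dyson s (Pi.single N (w N s)) n (k + 1) fun _ => r) with hG
  have hGint : ∀ j, Integrable (Function.uncurry fun s r => if s ≤ r then G j s r else 0)
      ((volume.restrict (Set.Ioc t₀ t)).prod (volume.restrict (Set.Ioc t₀ t))) := by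
    intro j
    obtain ⟨K, hK⟩ := hbd k j
    have hmeas : AEStronglyMeasurable (Function.uncurry (G j))
        ((volume.restrict (Set.Ioc t₀ t)).prod (volume.restrict (Set.Ioc t₀ t))) :=
      (c.continuous_b k j).comp_aestronglyMeasurable
        (measurable_snd.stronglyMeasurable.aestronglyMeasurable.prodMk
          (aestronglyMeasurable_dyson_single measurable_fst measurable_snd
            hw'.aestronglyMeasurable.comp_fst n (k + 1)))
    have hms : MeasurableSet {p : ℝ × ℝ | p.1 ≤ p.2} :=
      measurableSet_le measurable_fst measurable_snd
    have hmeas' : AEStronglyMeasurable (Function.uncurry fun s r => if s ≤ r then G j s r else 0)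
        ((volume.restrict (Set.Ioc t₀ t)).prod (volume.restrict (Set.Ioc t₀ t))) := by
      refine (hmeas.indicator hms).congr (Eventually.of_forall fun p => ?_)
      simp [Set.indicator, Function.uncurry]
    set D : ℝ := K * (2 ^ (2 * n + (k + 1)) * κ ^ n).toReal with hD
    have hbound : Integrable (fun p : ℝ × ℝ => D * ‖w N p.1‖)
        ((volume.restrict (Set.Ioc t₀ t)).prod (volume.restrict (Set.Ioc t₀ t))) :=
      (hw'.norm.comp_fst _).const_mul _
    refine hbound.mono' hmeas' ?_
    have hs1 : ∀ᵐ p ∂((volume.restrict (Set.Ioc t₀ t)).prod (volume.restrict (Set.Ioc t₀ t))),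
        (∀ σ, c.act N σ (w N p.1) = w N p.1) ∧ p.1 ∈ Set.Ioc t₀ t :=
      Measure.quasiMeasurePreserving_fst.ae
        ((ae_restrict_of_ae_restrict_of_subset hsub hsym).and (ae_restrict_mem measurableSet_Ioc))
    have hs2 : ∀ᵐ p ∂((volume.restrict (Set.Ioc t₀ t)).prod (volume.restrict (Set.Ioc t₀ t))),
        p.2 ∈ Set.Ioc t₀ t :=
      Measure.quasiMeasurePreserving_snd.ae (ae_restrict_mem measurableSet_Ioc)
    filter_upwards [hs1, hs2] with p hp1 hp2
    have hK0 : 0 ≤ K := (norm_nonneg _).trans (hK 0)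
    simp only [Function.uncurry]
    split_ifs with h
    · have h1 := enorm_dyson_single_le hκ hp1.1 hp1.2.1.le h (hp2.2.trans ht.2) n (k + 1)
      have h2 : ‖c.dyson p.1 (Pi.single N (w N p.1)) n (k + 1) fun _ => p.2‖ ≤
          (2 ^ (2 * n + (k + 1)) * κ ^ n).toReal * ‖w N p.1‖ := by
        rw [← toReal_enorm, ← toReal_enorm, ← ENNReal.toReal_mul]
        refine ENNReal.toReal_mono ?_ h1
        exact ENNReal.mul_ne_top (ENNReal.mul_ne_top (by simp) (ENNReal.pow_ne_top hκ'))
          enorm_ne_top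
      calc _ ≤ ‖c.b k j p.2‖ * _ := (c.b k j p.2).le_opNorm _
        _ ≤ K * ((2 ^ (2 * n + (k + 1)) * κ ^ n).toReal * ‖w N p.1‖) := by
          gcongr
          exact hK _
        _ = _ := by rw [hD, mul_assoc]
    · simp only [norm_zero]
      positivity
  have hR : ∀ j, ∀ r ∈ Set.Ioc t₀ t, c.b k j r (c.remainder w t₀ N n (k + 1) r) =
      ∫ s in t₀..r, G j s r := by
    intro j r hr
    rw [remainder, ← ContinuousLinearMap.intervalIntegral_comp_comm]
    rw [intervalIntegrable_iff_integrableOn_Ioc_of_le hr.1.le]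
    have hsub' : Set.Ioc t₀ r ⊆ Set.Icc t₀ t₁ := fun s hs => hsub ⟨hs.1, hs.2.trans hr.2⟩
    refine Integrable.mono'
      (g := fun s => (2 ^ (2 * n + (k + 1)) * κ ^ n).toReal * ‖w N s‖)
      ((hw.mono_set hsub').norm.const_mul _)
      (aestronglyMeasurable_dyson_single measurable_id measurable_const
        (hw.mono_set hsub').aestronglyMeasurable n (k + 1)) ?_
    filter_upwards [ae_restrict_of_ae_restrict_of_subset hsub' hsym,
      ae_restrict_mem measurableSet_Ioc] with s hs hmem
    have h1 := enorm_dyson_single_le hκ hs hmem.1.le hmem.2 (hr.2.trans ht.2) n (k + 1)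
    rw [← toReal_enorm, ← toReal_enorm, ← ENNReal.toReal_mul]
    refine ENNReal.toReal_mono ?_ h1
    exact ENNReal.mul_ne_top (ENNReal.mul_ne_top (by simp) (ENNReal.pow_ne_top hκ'))
      enorm_ne_top
  have hL : ∀ s ∈ Set.Ioc t₀ t, c.dyson s (Pi.single N (w N s)) (n + 1) k (fun _ => t) =
      ∑ j, ∫ r in s..t, G j s r := by
    intro s hs
    rw [dyson_succ]
    refine Finset.sum_congr rfl fun j _ => ?_
    refine intervalIntegral.integral_congr fun r hr => ?_
    rw [Set.uIcc_of_le hs.2] at hr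
    -- At the outermost collision time `r ≤ t` the limit of the old particles drops from `t` to `r`,
    -- which is also the limit of the new particle.
    simp only [hG, min_eq_right hr.2]
    congr 2
    funext i
    refine Fin.lastCases ?_ (fun i => ?_) i <;> simp
  have hi1 : ∀ j, IntegrableOn (fun s => ∫ r in s..t, G j s r) (Set.Ioc t₀ t) := by
    intro j
    refine (hGint j).integral_prod_left.congr ?_
    filter_upwards [ae_restrict_mem measurableSet_Ioc] with s hs
    rw [intervalIntegral.integral_of_le hs.2, ← integral_Icc_eq_integral_Ioc (x := s)]
    have : ∀ r, (Function.uncurry (fun s r => if s ≤ r then G j s r else 0) (s, r)) =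
        (Set.Ici s).indicator (G j s) r := by
      intro r; simp [Set.indicator]
    simp_rw [this]
    rw [setIntegral_indicator measurableSet_Ici]
    congr 2
    ext x
    simp only [Set.mem_Icc, Set.mem_inter_iff, Set.mem_Ioc, Set.mem_Ici]
    exact ⟨fun h => ⟨h.2, h.1.2⟩, fun h => ⟨⟨hs.1.trans_le h.1, h.2⟩, h.1⟩⟩
  have hi2 : ∀ j, IntegrableOn (fun r => ∫ s in t₀..r, G j s r) (Set.Ioc t₀ t) := by
    intro j
    refine (hGint j).integral_prod_right.congr ?_
    filter_upwards [ae_restrict_mem measurableSet_Ioc] with r hr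
    rw [intervalIntegral.integral_of_le hr.1.le]
    have : ∀ s, (Function.uncurry (fun s r => if s ≤ r then G j s r else 0) (s, r)) =
        (Set.Iic r).indicator (fun s => G j s r) s := by
      intro s; simp [Set.indicator]
    simp_rw [this]
    rw [setIntegral_indicator measurableSet_Iic, Set.Ioc_inter_Iic, min_eq_right hr.2]
  rw [remainder, intervalIntegral.integral_of_le ht.1, intervalIntegral.integral_of_le ht.1,
    setIntegral_congr_fun measurableSet_Ioc hL, integral_finsetSum _ fun j _ => hi1 j,
    setIntegral_congr_fun measurableSet_Ioc (fun r hr => Finset.sum_congr rfl fun j _ => hR j r hr),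
    integral_finsetSum _ fun j _ => hi2 j]
  refine Finset.sum_congr rfl fun j _ => ?_
  have := integral_integral_triangle_swap (G j) ht.1 (hGint j)
  rwa [intervalIntegral.integral_of_le ht.1, intervalIntegral.integral_of_le ht.1] at this

/-- The iterated Duhamel formula holds up to an error that vanishes along a sequence of collision
families for which the Duhamel formula holds in the limit. -/
theorem exists_remainder_sub_eq {c : ℕ → CollisionFamily H}
    (hκ : ∀ m k j h, ∫⁻ r in Set.Icc t₀ t₁, ‖(c m).b k j r h‖ₑ ≤ κ * ‖h‖ₑ)
    (hκ' : κ ≠ ∞) (hbd : ∀ m k j, ∃ K : ℝ, ∀ t, ‖(c m).b k j t‖ ≤ K)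
    (hsym : ∀ m k, ∀ᵐ s ∂volume.restrict (Set.Icc t₀ t₁), ∀ σ, (c m).act k σ (w k s) = w k s)
    (hw : ∀ k, IntegrableOn (w k) (Set.Icc t₀ t₁))
    (hconv : ∀ k, Tendsto (fun m => ∫⁻ r in Set.Icc t₀ t₁,
      ‖∑ j, (c m).b k j r (∫ s in t₀..r, w (k + 1) s) - w k r‖ₑ) atTop (𝓝 0)) (n : ℕ) :
    ∀ k, ∃ err : ℕ → ℝ≥0∞, Tendsto err atTop (𝓝 0) ∧ ∀ m, ∃ d : ℝ → H k,
      IntegrableOn d (Set.Icc t₀ t₁) ∧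
      (∀ t ∈ Set.Icc t₀ t₁, (c m).remainder w t₀ (k + n) n k t - ∫ s in t₀..t, w k s =
        ∫ s in t₀..t, d s) ∧ ∫⁻ s in Set.Icc t₀ t₁, ‖d s‖ₑ ≤ err m := by
  induction n with
  | zero =>
    intro k
    refine ⟨fun _ => 0, tendsto_const_nhds, fun m => ⟨fun _ => 0, integrableOn_zero, ?_, ?_⟩⟩
    · intro t _
      simp [remainder, dyson_zero]
    · simp
  | succ n ih =>
    intro k
    obtain ⟨err, herr, hd⟩ := ih (k + 1)
    -- One more iteration applies `k` collisions to the error at level `k + 1`, each costing `κ`,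
    -- and adds the defect of the system at level `k`.
    refine ⟨fun m => ∑ _j : Fin k, κ * err m + ∫⁻ r in Set.Icc t₀ t₁,
      ‖∑ j, (c m).b k j r (∫ s in t₀..r, w (k + 1) s) - w k r‖ₑ, ?_, fun m => ?_⟩
    · have h1 : Tendsto (fun m => κ * err m) atTop (𝓝 0) := by
        simpa using ENNReal.Tendsto.const_mul herr (Or.inr hκ')
      simpa using (tendsto_finsetSum (Finset.univ : Finset (Fin k)) fun _ _ => h1).add (hconv k)
    obtain ⟨d, hdint, hdeq, hdle⟩ := hd m
    have hcontb : ∀ (j : Fin k) {φ : ℝ → H (k + 1)}, ContinuousOn φ (Set.Icc t₀ t₁) →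
        ContinuousOn (fun r => (c m).b k j r (φ r)) (Set.Icc t₀ t₁) := fun j φ hφ =>
      ((c m).continuous_b k j).comp_continuousOn (continuousOn_id.prodMk hφ)
    have hc1 : ∀ j : Fin k, ContinuousOn (fun r => (c m).b k j r (∫ s in t₀..r, d s))
        (Set.Icc t₀ t₁) := fun j => hcontb j (continuousOn_primitive_Icc hdint)
    have hc2 : ∀ j : Fin k, ContinuousOn (fun r => (c m).b k j r (∫ s in t₀..r, w (k + 1) s))
        (Set.Icc t₀ t₁) := fun j => hcontb j (continuousOn_primitive_Icc (hw _))
    have hi1 : IntegrableOn (fun r => ∑ j, (c m).b k j r (∫ s in t₀..r, d s))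
        (Set.Icc t₀ t₁) := (continuousOn_finsetSum _ fun j _ => hc1 j).integrableOn_Icc
    have hi2 : IntegrableOn (fun r => ∑ j, (c m).b k j r (∫ s in t₀..r, w (k + 1) s))
        (Set.Icc t₀ t₁) := (continuousOn_finsetSum _ fun j _ => hc2 j).integrableOn_Icc
    have hi3 : IntegrableOn (fun r => ∑ j, (c m).b k j r (∫ s in t₀..r, w (k + 1) s) - w k r)
        (Set.Icc t₀ t₁) := hi2.sub (hw k)
    refine ⟨fun r => ∑ j, (c m).b k j r (∫ s in t₀..r, d s) +
      (∑ j, (c m).b k j r (∫ s in t₀..r, w (k + 1) s) - w k r),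
      hi1.add hi3, fun t ht => ?_, ?_⟩
    · have hsub : Set.Icc t₀ t ⊆ Set.Icc t₀ t₁ := Set.Icc_subset_Icc_right ht.2
      have ii : ∀ {φ : ℝ → H k}, IntegrableOn φ (Set.Icc t₀ t₁) →
          IntervalIntegrable φ volume t₀ t := fun hφ => by
        rw [intervalIntegrable_iff_integrableOn_Icc_of_le ht.1]
        exact hφ.mono_set hsub
      simp only
      rw [intervalIntegral.integral_add (ii hi1) (ii hi3),
        intervalIntegral.integral_sub (ii hi2) (ii (hw k)), ← add_sub_assoc,
        ← intervalIntegral.integral_add (ii hi1) (ii hi2),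
        show k + (n + 1) = k + 1 + n by omega,
        remainder_succ (hκ m) hκ' (hbd m) (hsym m _) ht (hw _)]
      congr 1
      refine intervalIntegral.integral_congr fun r hr => ?_
      rw [Set.uIcc_of_le ht.1] at hr
      rw [← Finset.sum_add_distrib]
      refine Finset.sum_congr rfl fun j _ => ?_
      rw [← map_add, ← hdeq r (hsub hr), sub_add_cancel]
    · calc _ ≤ ∫⁻ r in Set.Icc t₀ t₁, (∑ j, ‖(c m).b k j r (∫ s in t₀..r, d s)‖ₑ +
          ‖∑ j, (c m).b k j r (∫ s in t₀..r, w (k + 1) s) - w k r‖ₑ) := by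
            refine lintegral_mono fun r => (enorm_add_le _ _).trans ?_
            gcongr
            exact enorm_sum_le _ _
        _ = ∑ j, (∫⁻ r in Set.Icc t₀ t₁, ‖(c m).b k j r (∫ s in t₀..r, d s)‖ₑ) + _ := by
            rw [lintegral_add_right' _ hi3.aestronglyMeasurable.enorm,
              lintegral_finsetSum' _ fun j _ =>
                (hc1 j).integrableOn_Icc.aestronglyMeasurable.enorm]
        _ ≤ _ := by
            refine add_le_add (Finset.sum_le_sum fun j _ => ?_) le_rfl
            refine (lintegral_apply_primitive_le ((c m).continuous_b k j) hdint).trans ?_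
            calc _ ≤ ∫⁻ s in Set.Icc t₀ t₁, κ * ‖d s‖ₑ := lintegral_mono fun s => hκ m k j _
              _ = κ * ∫⁻ s in Set.Icc t₀ t₁, ‖d s‖ₑ :=
                lintegral_const_mul'' _ hdint.aestronglyMeasurable.enorm
              _ ≤ _ := by gcongr

/-- Uniqueness for a linear hierarchy with zero initial data: the source `w` of a solution
vanishes, in the sense that its primitive does. -/
theorem primitive_eq_zero {c : ℕ → CollisionFamily H}
    (hκ : ∀ m k j h, ∫⁻ r in Set.Icc t₀ t₁, ‖(c m).b k j r h‖ₑ ≤ κ * ‖h‖ₑ)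
    (hκ' : κ ≠ ∞) (hbd : ∀ m k j, ∃ K : ℝ, ∀ t, ‖(c m).b k j t‖ ≤ K)
    (hsym : ∀ m k, ∀ᵐ s ∂volume.restrict (Set.Icc t₀ t₁), ∀ σ, (c m).act k σ (w k s) = w k s)
    (hw : ∀ k, IntegrableOn (w k) (Set.Icc t₀ t₁))
    (hconv : ∀ k, Tendsto (fun m => ∫⁻ r in Set.Icc t₀ t₁,
      ‖∑ j, (c m).b k j r (∫ s in t₀..r, w (k + 1) s) - w k r‖ₑ) atTop (𝓝 0))
    (hgrow : ∀ k, Tendsto (fun n => 2 ^ (2 * n + k) * κ ^ n *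
      ∫⁻ s in Set.Icc t₀ t₁, ‖w (k + n) s‖ₑ) atTop (𝓝 0)) (k : ℕ) {t : ℝ}
    (ht : t ∈ Set.Icc t₀ t₁) : ∫ s in t₀..t, w k s = 0 := by
  rw [← enorm_eq_zero, ← nonpos_iff_eq_zero]
  -- The order of limits matters: `m → ∞` for fixed `n` removes the error, which is not controlled
  -- uniformly in `n`; only then does `n → ∞`.
  refine ge_of_tendsto' (hgrow k) fun n => ?_
  obtain ⟨err, herr, hd⟩ := exists_remainder_sub_eq hκ hκ' hbd hsym hw hconv n k
  have hlim : Tendsto (fun m => 2 ^ (2 * n + k) * κ ^ n *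
      (∫⁻ s in Set.Icc t₀ t₁, ‖w (k + n) s‖ₑ) + err m) atTop
      (𝓝 (2 ^ (2 * n + k) * κ ^ n * (∫⁻ s in Set.Icc t₀ t₁, ‖w (k + n) s‖ₑ) + 0)) :=
    tendsto_const_nhds.add herr
  rw [add_zero] at hlim
  refine ge_of_tendsto' hlim fun m => ?_
  obtain ⟨d, hdint, hdeq, hdle⟩ := hd m
  have h1 : ∫ s in t₀..t, w k s =
      (c m).remainder w t₀ (k + n) n k t - ∫ s in t₀..t, d s := by
    rw [← hdeq t ht]
    abel
  rw [h1]
  refine (enorm_sub_le).trans (add_le_add (enorm_remainder_le (hκ m) (hsym m _) ht (hw _) n k) ?_)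
  refine le_trans ?_ hdle
  rw [intervalIntegral.integral_of_le ht.1]
  refine (enorm_integral_le_lintegral_enorm _).trans (lintegral_mono_set ?_)
  exact fun s hs => ⟨hs.1.le, hs.2.trans ht.2⟩

end CollisionFamily

/-! ### Oscillatory integrals in time and Schur's test -/

/-- The modulus of the Fourier transform of the Gaussian `t ↦ exp (1 - (t / T) ^ 2)`. -/
def gaussianWeight (T x : ℝ) : ℝ≥0∞ :=
  ENNReal.ofReal (Real.exp 1 * (T * √Real.pi) * Real.exp (-(T ^ 2 / 4) * x ^ 2))

theorem gaussianWeight_neg (T x : ℝ) : gaussianWeight T (-x) = gaussianWeight T x := by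
  simp [gaussianWeight]

theorem measurable_gaussianWeight (T : ℝ) : Measurable (gaussianWeight T) := by
  unfold gaussianWeight
  fun_prop

theorem lintegral_gaussianWeight_ne_top {T : ℝ} (hT : 0 < T) : ∫⁻ x, gaussianWeight T x ≠ ∞ := by
  have : Integrable fun x : ℝ =>
      Real.exp 1 * (T * √Real.pi) * Real.exp (-(T ^ 2 / 4) * x ^ 2) :=
    (integrable_exp_neg_mul_sq (by positivity)).const_mul _
  exact this.lintegral_lt_top.ne

theorem enorm_integral_gaussian {T : ℝ} (hT : 0 < T) (x : ℝ) :
    ‖∫ t : ℝ, (Real.exp (1 - (t / T) ^ 2) : ℂ) * Complex.exp ((t * x : ℝ) * Complex.I)‖ₑ =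
      gaussianWeight T x := by
  have h := fourierIntegral_gaussian (b := ((1 / T ^ 2 : ℝ) : ℂ))
    (by rw [Complex.ofReal_re]; positivity) (x : ℂ)
  have e : ∀ t : ℝ, (Real.exp (1 - (t / T) ^ 2) : ℂ) * Complex.exp ((t * x : ℝ) * Complex.I) =
      (Real.exp 1 : ℂ) * (Complex.exp (Complex.I * x * t) *
        Complex.exp (-((1 / T ^ 2 : ℝ) : ℂ) * (t : ℂ) ^ 2)) := by
    intro t
    rw [Complex.ofReal_exp, Complex.ofReal_exp, ← Complex.exp_add, ← Complex.exp_add,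
      ← Complex.exp_add]
    congr 1
    push_cast
    ring
  simp_rw [e]
  rw [integral_const_mul, h, gaussianWeight, ← ofReal_norm]
  congr 1
  have e1 : ((Real.pi : ℂ) / ((1 / T ^ 2 : ℝ) : ℂ)) ^ (1 / 2 : ℂ) = ((T * √Real.pi : ℝ) : ℂ) := by
    rw [← Complex.ofReal_div, show (1 / 2 : ℂ) = ((1 / 2 : ℝ) : ℂ) by push_cast; rfl,
      ← Complex.ofReal_cpow (by positivity), ← Real.sqrt_eq_rpow]
    congr 1
    rw [div_div_eq_mul_div, div_one, mul_comm, Real.sqrt_mul (by positivity),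
      Real.sqrt_sq hT.le]
  have e2 : Complex.exp (-(x : ℂ) ^ 2 / (4 * ((1 / T ^ 2 : ℝ) : ℂ))) =
      ((Real.exp (-(T ^ 2 / 4) * x ^ 2) : ℝ) : ℂ) := by
    rw [Complex.ofReal_exp]
    congr 1
    have : (T : ℂ) ≠ 0 := by exact_mod_cast hT.ne'
    push_cast
    field_simp
  rw [e1, e2, ← Complex.ofReal_mul, ← Complex.ofReal_mul, Complex.norm_real,
    Real.norm_of_nonneg (by positivity)]
  ring

variable {Z : Type*} [MeasurableSpace Z] {ν : Measure Z}

theorem continuous_integral_exp_mul {Ω : Z → ℝ} (hΩ : Measurable Ω) {h : Z → ℂ}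
    (hh : Integrable h ν) :
    Continuous fun t : ℝ => ∫ z, Complex.exp ((t * Ω z : ℝ) * Complex.I) * h z ∂ν := by
  refine continuous_of_dominated (bound := fun z => ‖h z‖) ?_ ?_ hh.norm ?_
  · intro t
    refine AEStronglyMeasurable.mul ?_ hh.aestronglyMeasurable
    exact Measurable.aestronglyMeasurable (by fun_prop)
  · intro t
    refine Eventually.of_forall fun z => ?_
    rw [norm_mul, Complex.norm_exp_ofReal_mul_I, one_mul]
  · refine Eventually.of_forall fun z => ?_
    fun_prop

variable [SFinite ν]

/-- The Gaussian `exp (1 - (t / T) ^ 2)` is at least `1` on `[0, T]`. With it as a weight the square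
can be expanded and the time integral done explicitly, which leaves its Fourier transform at the
difference of the phases. -/
theorem lintegral_sq_oscillatory_le {T : ℝ} (hT : 0 < T) {Ω : Z → ℝ} (hΩ : Measurable Ω)
    {h : Z → ℂ} (hh : Integrable h ν) :
    ∫⁻ t in Set.Icc 0 T, ‖∫ z, Complex.exp ((t * Ω z : ℝ) * Complex.I) * h z ∂ν‖ₑ ^ 2 ≤
      ∫⁻ p, ‖h p.1‖ₑ * ‖h p.2‖ₑ * gaussianWeight T (Ω p.1 - Ω p.2) ∂(ν.prod ν) := by
  set A : ℝ → ℂ := fun t => ∫ z, Complex.exp ((t * Ω z : ℝ) * Complex.I) * h z ∂ν with hA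
  set θ : ℝ → ℝ := fun t => Real.exp (1 - (t / T) ^ 2) with hθ
  have hAc : Continuous A := continuous_integral_exp_mul hΩ hh
  have hAb : ∀ t, ‖A t‖ ≤ ∫ z, ‖h z‖ ∂ν := by
    intro t
    refine (norm_integral_le_integral_norm _).trans (le_of_eq ?_)
    congr 1
    funext z
    rw [norm_mul, Complex.norm_exp_ofReal_mul_I, one_mul]
  have hθi : Integrable θ := by
    have : Integrable fun t : ℝ => Real.exp 1 * Real.exp (-(1 / T ^ 2) * t ^ 2) :=
      (integrable_exp_neg_mul_sq (by positivity)).const_mul _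
    refine this.congr (Eventually.of_forall fun t => ?_)
    simp only [hθ]
    rw [← Real.exp_add]
    congr 1
    field_simp
    ring
  have hθ1 : ∀ t ∈ Set.Icc 0 T, 1 ≤ θ t := by
    intro t ht
    refine Real.one_le_exp ?_
    have h1 : t / T ≤ 1 := (div_le_one hT).2 ht.2
    have h0 : 0 ≤ t / T := div_nonneg ht.1 hT.le
    nlinarith
  have hθA : Integrable fun t => θ t * ‖A t‖ ^ 2 := by
    refine (hθi.mul_const ((∫ z, ‖h z‖ ∂ν) ^ 2)).mono'
      (hθi.aestronglyMeasurable.mul (hAc.norm.pow 2).aestronglyMeasurable)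
      (Eventually.of_forall fun t => ?_)
    rw [Real.norm_of_nonneg (by positivity)]
    gcongr
    exact hAb t
  have key : ((∫ t, θ t * ‖A t‖ ^ 2 : ℝ) : ℂ) = ∫ p, h p.1 * (starRingEnd ℂ) (h p.2) *
      (∫ t : ℝ, (θ t : ℂ) * Complex.exp ((t * (Ω p.1 - Ω p.2) : ℝ) * Complex.I)) ∂(ν.prod ν) := by
    have hint : Integrable (Function.uncurry fun (t : ℝ) (p : Z × Z) =>
        (θ t : ℂ) * Complex.exp ((t * (Ω p.1 - Ω p.2) : ℝ) * Complex.I) *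
          (h p.1 * (starRingEnd ℂ) (h p.2))) (volume.prod (ν.prod ν)) := by
      have hconj : Integrable (fun z => (starRingEnd ℂ) (h z)) ν :=
        Complex.conjCLE.toContinuousLinearMap.integrable_comp hh
      have h1 : Integrable (fun q : ℝ × Z × Z => (θ q.1 : ℂ) *
          (h q.2.1 * (starRingEnd ℂ) (h q.2.2))) (volume.prod (ν.prod ν)) :=
        hθi.ofReal.mul_prod (hh.mul_prod hconj)
      refine h1.norm.mono' ?_ (Eventually.of_forall fun q => ?_)
      · have h2 : AEStronglyMeasurable (fun q : ℝ × Z × Z =>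
            Complex.exp ((q.1 * (Ω q.2.1 - Ω q.2.2) : ℝ) * Complex.I))
            (volume.prod (ν.prod ν)) := Measurable.aestronglyMeasurable (by fun_prop)
        refine (h2.mul h1.aestronglyMeasurable).congr (Eventually.of_forall fun q => ?_)
        simp only [Function.uncurry, Pi.mul_apply]
        ring
      · simp only [Function.uncurry]
        rw [norm_mul, norm_mul, Complex.norm_exp_ofReal_mul_I, mul_one, ← norm_mul]
    have hswap := integral_integral_swap hint
    rw [← integral_complex_ofReal]
    refine Eq.trans (integral_congr_ae (Eventually.of_forall fun t => ?_))
      (hswap.trans (integral_congr_ae (Eventually.of_forall fun p => ?_)))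
    · have e1 : (starRingEnd ℂ) (A t) =
          ∫ z, (starRingEnd ℂ) (Complex.exp ((t * Ω z : ℝ) * Complex.I) * h z) ∂ν :=
        integral_conj.symm
      simp only
      rw [Complex.ofReal_mul, Complex.ofReal_pow, ← Complex.mul_conj', e1, hA,
        ← integral_prod_mul, ← integral_const_mul]
      refine integral_congr_ae (Eventually.of_forall fun p => ?_)
      simp only [map_mul, ← Complex.exp_conj, Complex.conj_I, Complex.conj_ofReal]
      rw [show Complex.exp (((t * (Ω p.1 - Ω p.2) : ℝ) : ℂ) * Complex.I) =
        Complex.exp (((t * Ω p.1 : ℝ) : ℂ) * Complex.I) *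
          Complex.exp (((t * Ω p.2 : ℝ) : ℂ) * -Complex.I) by
        rw [← Complex.exp_add]; congr 1; push_cast; ring]
      ring
    · simp only
      rw [integral_mul_const, mul_comm]
  calc ∫⁻ t in Set.Icc 0 T, ‖A t‖ₑ ^ 2
      ≤ ∫⁻ t in Set.Icc 0 T, ENNReal.ofReal (θ t * ‖A t‖ ^ 2) := by
        refine setLIntegral_mono' measurableSet_Icc fun t ht => ?_
        rw [← ofReal_norm, ← ENNReal.ofReal_pow (norm_nonneg _)]
        refine ENNReal.ofReal_le_ofReal ?_
        have := hθ1 t ht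
        nlinarith [sq_nonneg ‖A t‖]
    _ ≤ ∫⁻ t, ENNReal.ofReal (θ t * ‖A t‖ ^ 2) := setLIntegral_le_lintegral _ _
    _ = ENNReal.ofReal (∫ t, θ t * ‖A t‖ ^ 2) :=
        (ofReal_integral_eq_lintegral_ofReal hθA
          (Eventually.of_forall fun t => by positivity)).symm
    _ = ‖((∫ t, θ t * ‖A t‖ ^ 2 : ℝ) : ℂ)‖ₑ := by
        rw [← ofReal_norm, Complex.norm_real, Real.norm_of_nonneg]
        exact integral_nonneg fun t => by positivity
    _ ≤ _ := by
        rw [key]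
        refine (enorm_integral_le_lintegral_enorm _).trans (lintegral_mono fun p => ?_)
        rw [enorm_mul, enorm_mul, RCLike.enorm_conj]
        have := enorm_integral_gaussian hT (Ω p.1 - Ω p.2)
        rw [← this]

/-- Schur's test for an oscillatory integral operator. -/
theorem lintegral_sq_oscillatory_le_of_schur {T : ℝ} (hT : 0 < T) {Ω : Z → ℝ} (hΩ : Measurable Ω)
    {q F : Z → ℂ} (hq : Measurable q) (hF : AEMeasurable F ν)
    (hqF : Integrable (fun z => q z * F z) ν) {S : ℝ≥0∞}
    (hS : ∀ x, ∫⁻ z, ‖q z‖ₑ ^ 2 * gaussianWeight T (x - Ω z) ∂ν ≤ S) :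
    ∫⁻ t in Set.Icc 0 T, ‖∫ z, Complex.exp ((t * Ω z : ℝ) * Complex.I) * (q z * F z) ∂ν‖ₑ ^ 2 ≤
      2 * S * ∫⁻ z, ‖F z‖ₑ ^ 2 ∂ν := by
  refine (lintegral_sq_oscillatory_le hT hΩ hqF).trans ?_
  have hg := measurable_gaussianWeight T
  have hm : AEMeasurable (fun p : Z × Z => ‖F p.1‖ₑ ^ 2 *
      (‖q p.2‖ₑ ^ 2 * gaussianWeight T (Ω p.1 - Ω p.2))) (ν.prod ν) :=
    (hF.comp_fst.enorm.pow_const 2).mul (Measurable.aemeasurable (by fun_prop))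
  have hm' : AEMeasurable (fun p : Z × Z => ‖F p.2‖ₑ ^ 2 *
      (‖q p.1‖ₑ ^ 2 * gaussianWeight T (Ω p.2 - Ω p.1))) (ν.prod ν) :=
    (hF.comp_snd.enorm.pow_const 2).mul (Measurable.aemeasurable (by fun_prop))
  have hS' : ∀ z, ∫⁻ z', ‖F z‖ₑ ^ 2 * (‖q z'‖ₑ ^ 2 * gaussianWeight T (Ω z - Ω z')) ∂ν ≤
      ‖F z‖ₑ ^ 2 * S := by
    intro z
    rw [lintegral_const_mul _ (by fun_prop)]
    gcongr
    exact hS _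
  calc _ ≤ ∫⁻ p : Z × Z, (‖F p.1‖ₑ ^ 2 * (‖q p.2‖ₑ ^ 2 * gaussianWeight T (Ω p.1 - Ω p.2)) +
        ‖F p.2‖ₑ ^ 2 * (‖q p.1‖ₑ ^ 2 * gaussianWeight T (Ω p.2 - Ω p.1))) ∂(ν.prod ν) := by
        refine lintegral_mono fun p => ?_
        -- The four factors are grouped so that each `F` goes with the `q` at the other point, and
        -- `a b ≤ a² + b²` separates the groups; then `q` can be integrated out at a fixed value of
        -- the phase of `F`.
        rw [show Ω p.2 - Ω p.1 = -(Ω p.1 - Ω p.2) by ring, gaussianWeight_neg, ← mul_assoc,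
          ← mul_assoc, ← add_mul, enorm_mul, enorm_mul]
        gcongr
        rw [← mul_pow, ← mul_pow]
        set a := ‖F p.1‖ₑ * ‖q p.2‖ₑ
        set b := ‖F p.2‖ₑ * ‖q p.1‖ₑ
        calc _ = a * b := by simp only [a, b]; ring
          _ ≤ a ^ 2 + b ^ 2 := by
            rcases le_total a b with h | h
            · calc a * b ≤ b * b := by gcongr
                _ ≤ _ := by rw [← sq]; exact le_add_self
            · calc a * b ≤ a * a := by gcongr
                _ ≤ _ := by rw [← sq]; exact le_self_add
    _ = (∫⁻ z, ∫⁻ z', ‖F z‖ₑ ^ 2 * (‖q z'‖ₑ ^ 2 * gaussianWeight T (Ω z - Ω z')) ∂ν ∂ν) +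
        ∫⁻ z, ∫⁻ z', ‖F z‖ₑ ^ 2 * (‖q z'‖ₑ ^ 2 * gaussianWeight T (Ω z - Ω z')) ∂ν ∂ν := by
        rw [lintegral_add_left' hm, lintegral_prod _ hm, lintegral_prod_symm _ hm']
    _ ≤ (∫⁻ z, ‖F z‖ₑ ^ 2 * S ∂ν) + ∫⁻ z, ‖F z‖ₑ ^ 2 * S ∂ν := by
        gcongr <;> exact hS' _
    _ = _ := by
        rw [lintegral_mul_const'' _ (hF.enorm.pow_const 2)]
        ring


/-! ### Weights and the uniform resonance estimate -/

/-- The symbol of `⟨∂⟩²`. -/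
def bracketSq (x : ℝ) : ℝ := 1 + (2 * Real.pi * x) ^ 2

theorem one_le_bracketSq (x : ℝ) : 1 ≤ bracketSq x := by
  unfold bracketSq; nlinarith [sq_nonneg (2 * Real.pi * x)]

theorem bracketSq_pos (x : ℝ) : 0 < bracketSq x := zero_lt_one.trans_le (one_le_bracketSq x)

theorem bracketSq_neg (x : ℝ) : bracketSq (-x) = bracketSq x := by simp [bracketSq]

theorem continuous_bracketSq : Continuous bracketSq := by unfold bracketSq; fun_prop

theorem bracketSq_add_le_mul (x y : ℝ) : bracketSq (x + y) ≤ 4 * (bracketSq x * bracketSq y) := by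
  unfold bracketSq
  nlinarith [sq_nonneg (2 * Real.pi * x - 2 * Real.pi * y), sq_nonneg (2 * Real.pi * x),
    sq_nonneg (2 * Real.pi * y), mul_nonneg (sq_nonneg (2 * Real.pi * x))
      (sq_nonneg (2 * Real.pi * y))]

theorem bracketSq_add_add_le (x y z : ℝ) :
    bracketSq (x + y + z) ≤ 3 * (bracketSq x + bracketSq y + bracketSq z) := by
  unfold bracketSq
  nlinarith [sq_nonneg (2 * Real.pi * x - 2 * Real.pi * y),
    sq_nonneg (2 * Real.pi * x - 2 * Real.pi * z), sq_nonneg (2 * Real.pi * y - 2 * Real.pi * z)]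

/-- With `w` the largest of the three brackets, `3 * (3 * w)` bounds the left bracket, whence the
`9`. Passing through the maximum avoids a distinction between `ε ≤ 1` and `ε > 1`. -/
theorem bracketSq_rpow_add_add_le {ε : ℝ} (hε : 0 < ε) (x y z : ℝ) :
    bracketSq (x + y + z) ^ ε ≤ 9 ^ ε * (bracketSq x ^ ε + bracketSq y ^ ε + bracketSq z ^ ε) := by
  have hx := bracketSq_pos x
  have hy := bracketSq_pos y
  have hz := bracketSq_pos z
  obtain ⟨w, hw, hw0, hwle⟩ : ∃ w : ℝ, bracketSq x + bracketSq y + bracketSq z ≤ 3 * w ∧ 0 < w ∧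
      w ^ ε ≤ bracketSq x ^ ε + bracketSq y ^ ε + bracketSq z ^ ε := by
    have h1 := Real.rpow_pos_of_pos hx ε
    have h2 := Real.rpow_pos_of_pos hy ε
    have h3 := Real.rpow_pos_of_pos hz ε
    rcases le_total (bracketSq x) (bracketSq y) with h | h
    · rcases le_total (bracketSq y) (bracketSq z) with h' | h'
      · exact ⟨_, by linarith, hz, by linarith⟩
      · exact ⟨_, by linarith, hy, by linarith⟩
    · rcases le_total (bracketSq x) (bracketSq z) with h' | h'
      · exact ⟨_, by linarith, hz, by linarith⟩
      · exact ⟨_, by linarith, hx, by linarith⟩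
  calc bracketSq (x + y + z) ^ ε ≤ (9 * w) ^ ε := by
        refine Real.rpow_le_rpow (bracketSq_pos _).le ?_ hε.le
        linarith [bracketSq_add_add_le x y z]
    _ = 9 ^ ε * w ^ ε := Real.mul_rpow (by norm_num) hw0.le
    _ ≤ _ := by gcongr

/-- The quotient `⟨η⟩^ε / (⟨η - a - b⟩^ε ⟨a⟩^ε ⟨b⟩^ε)`, up to the constant in the brackets. -/
def collisionWeight (ε η a b : ℝ) : ℝ :=
  bracketSq η ^ (ε / 2) / (bracketSq (η - a - b) ^ (ε / 2) * bracketSq a ^ (ε / 2) *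
    bracketSq b ^ (ε / 2))

theorem collisionWeight_nonneg (ε η a b : ℝ) : 0 ≤ collisionWeight ε η a b := by
  unfold collisionWeight
  have := bracketSq_pos η
  have := bracketSq_pos a
  have := bracketSq_pos b
  have := bracketSq_pos (η - a - b)
  positivity

theorem collisionWeight_swap (ε η a b : ℝ) :
    collisionWeight ε η b a = collisionWeight ε η a b := by
  unfold collisionWeight
  rw [show η - b - a = η - a - b by ring]
  ring

theorem continuous_collisionWeight {X : Type*} [TopologicalSpace X] (ε : ℝ) {η a b : X → ℝ}
    (hη : Continuous η) (ha : Continuous a) (hb : Continuous b) :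
    Continuous fun x => collisionWeight ε (η x) (a x) (b x) := by
  have h : ∀ {φ : X → ℝ}, Continuous φ → Continuous fun x => bracketSq (φ x) ^ (ε / 2) :=
    fun hφ => (continuous_bracketSq.comp hφ).rpow_const fun x => Or.inl (bracketSq_pos _).ne'
  unfold collisionWeight
  refine (h hη).div (((h ((hη.sub ha).sub hb)).mul (h ha)).mul (h hb)) fun x => ?_
  have := bracketSq_pos (a x)
  have := bracketSq_pos (b x)
  have := bracketSq_pos (η x - a x - b x)
  positivity

/-- As `η = (η - a - b) + a + b`, the numerator is controlled by the sum of the three factors of the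
denominator, each of which cancels one of them. -/
theorem collisionWeight_sq_le {ε : ℝ} (hε : 0 < ε) (η a b : ℝ) :
    collisionWeight ε η a b ^ 2 ≤ 9 ^ ε * (bracketSq a ^ (-ε) * bracketSq b ^ (-ε) +
      bracketSq (η - a - b) ^ (-ε) * bracketSq b ^ (-ε) +
      bracketSq (η - a - b) ^ (-ε) * bracketSq a ^ (-ε)) := by
  have hη := bracketSq_pos η
  have ha := bracketSq_pos a
  have hb := bracketSq_pos b
  have hs := bracketSq_pos (η - a - b)
  have hsq : ∀ {x : ℝ}, 0 < x → (x ^ (ε / 2)) ^ 2 = x ^ ε := fun {x} hx => by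
    rw [← Real.rpow_natCast, ← Real.rpow_mul hx.le]
    congr 1
    push_cast
    ring
  have h := bracketSq_rpow_add_add_le hε (η - a - b) a b
  rw [show η - a - b + a + b = η by ring] at h
  have pa := Real.rpow_pos_of_pos ha ε
  have pb := Real.rpow_pos_of_pos hb ε
  have ps := Real.rpow_pos_of_pos hs ε
  unfold collisionWeight
  rw [div_pow, mul_pow, mul_pow, hsq hη, hsq ha, hsq hb, hsq hs, Real.rpow_neg ha.le,
    Real.rpow_neg hb.le, Real.rpow_neg hs.le, div_le_iff₀ (by positivity)]
  refine h.trans (le_of_eq ?_)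
  field_simp

theorem bracketSq_rpow_neg_le_one {ε : ℝ} (hε : 0 < ε) (x : ℝ) : bracketSq x ^ (-ε) ≤ 1 :=
  Real.rpow_le_one_of_one_le_of_nonpos (one_le_bracketSq x) (by linarith)

theorem bracketSq_rpow_neg_mul_le {ε : ℝ} (hε : 0 < ε) (x y : ℝ) :
    bracketSq x ^ (-ε) * bracketSq y ^ (-ε) ≤ 4 ^ ε * bracketSq (x + y) ^ (-ε) := by
  have hx := bracketSq_pos x
  have hy := bracketSq_pos y
  have hxy := bracketSq_pos (x + y)
  rw [← Real.mul_rpow hx.le hy.le, Real.rpow_neg (by positivity), Real.rpow_neg hxy.le,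
    ← div_eq_mul_inv, inv_le_comm₀ (by positivity) (by positivity), inv_div,
    div_le_iff₀ (by positivity), ← Real.mul_rpow (by positivity) (by positivity)]
  refine Real.rpow_le_rpow hxy.le ?_ hε.le
  linarith [bracketSq_add_le_mul x y]

/-- A constant for which the bounds of the collision weight hold. -/
def weightConst (ε : ℝ) : ℝ := 9 ^ ε * (2 + 4 ^ ε)

theorem weightConst_pos (ε : ℝ) : 0 < weightConst ε := by unfold weightConst; positivity

/-- The bound is independent of `b`, so that `b` can be integrated against the function of the phase
alone. The two terms containing `a` lose their other factor; in the third, the product of brackets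
decays in the sum `a - η` of their arguments, up to sign. -/
theorem collisionWeight_sq_le_left {ε : ℝ} (hε : 0 < ε) (η a b : ℝ) :
    collisionWeight ε η a b ^ 2 ≤
      weightConst ε * (bracketSq a ^ (-ε) + bracketSq (a - η) ^ (-ε)) := by
  refine (collisionWeight_sq_le hε η a b).trans ?_
  have h1 := bracketSq_rpow_neg_mul_le hε (η - a - b) b
  rw [show η - a - b + b = -(a - η) by ring, bracketSq_neg] at h1
  have pa := Real.rpow_pos_of_pos (bracketSq_pos a) (-ε)
  have px := Real.rpow_pos_of_pos (bracketSq_pos (a - η)) (-ε)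
  have h2 := mul_le_mul_of_nonneg_left (bracketSq_rpow_neg_le_one hε b) pa.le
  have h3 := mul_le_mul_of_nonneg_right (bracketSq_rpow_neg_le_one hε (η - a - b)) pa.le
  unfold weightConst
  rw [mul_assoc]
  have h4 : (0 : ℝ) < 4 ^ ε := by positivity
  gcongr
  nlinarith

/-- The counterpart for fixed `a + b`: nothing else of `a` and `b` appears, so the integration along
that line falls on the function of the phase only. -/
theorem collisionWeight_sq_le_right {ε : ℝ} (hε : 0 < ε) (η a b : ℝ) :
    collisionWeight ε η a b ^ 2 ≤
      weightConst ε * (bracketSq (a + b - η) ^ (-ε) + bracketSq (a + b) ^ (-ε)) := by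
  refine (collisionWeight_sq_le hε η a b).trans ?_
  have h1 := bracketSq_rpow_neg_mul_le hε a b
  rw [show η - a - b = -(a + b - η) by ring, bracketSq_neg]
  have pa := Real.rpow_pos_of_pos (bracketSq_pos (a + b)) (-ε)
  have px := Real.rpow_pos_of_pos (bracketSq_pos (a + b - η)) (-ε)
  have h2 := mul_le_mul_of_nonneg_left (bracketSq_rpow_neg_le_one hε b) px.le
  have h3 := mul_le_mul_of_nonneg_left (bracketSq_rpow_neg_le_one hε a) px.le
  unfold weightConst
  rw [mul_assoc]
  have h4 : (0 : ℝ) < 4 ^ ε := by positivity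
  gcongr
  nlinarith

theorem collisionWeight_sq_le_const {ε : ℝ} (hε : 0 < ε) (η a b : ℝ) :
    collisionWeight ε η a b ^ 2 ≤ weightConst ε * 2 := by
  refine (collisionWeight_sq_le_left hε η a b).trans ?_
  have := weightConst_pos ε
  gcongr
  linarith [bracketSq_rpow_neg_le_one hε a, bracketSq_rpow_neg_le_one hε (a - η)]

/-- For `|x| > 1` one has `1 + 4π²x² ≤ 41 x² ≤ (8x)²`. -/
theorem inv_abs_le_bracketSq {x : ℝ} (hx : 1 < |x|) :
    |x|⁻¹ ≤ 8 * bracketSq x ^ (-(1 / 2) : ℝ) := by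
  have h0 : 0 < |x| := zero_lt_one.trans hx
  rw [Real.rpow_neg (bracketSq_pos x).le, ← Real.sqrt_eq_rpow, ← div_eq_mul_inv,
    inv_eq_one_div, div_le_div_iff₀ h0 (Real.sqrt_pos.2 (bracketSq_pos x)), one_mul]
  refine Real.sqrt_le_iff.2 ⟨by positivity, ?_⟩
  unfold bracketSq
  have h1 : 1 ≤ x ^ 2 := by
    rw [← sq_abs]
    nlinarith
  rw [mul_pow 8, sq_abs]
  have hpi := Real.pi_lt_d2
  have hpi0 := Real.pi_pos
  have h2 : Real.pi ^ 2 ≤ 10 := by nlinarith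
  nlinarith [mul_le_mul_of_nonneg_right h2 (sq_nonneg x)]

/-- Replacing the larger of the two brackets by the smaller one gives one of the terms on the right.
The exponent corresponds to `⟨·⟩^(-1 - 2ε)`, which is integrable on the line for every `ε > 0`; no
more regularity is needed. -/
theorem bracketSq_rpow_mul_le {ε : ℝ} (hε : 0 < ε) (x z : ℝ) :
    bracketSq z ^ (-ε) * bracketSq x ^ (-(1 / 2) : ℝ) ≤
      bracketSq z ^ (-(1 / 2) - ε) + bracketSq x ^ (-(1 / 2) - ε) := by
  have hx := bracketSq_pos x
  have hz := bracketSq_pos z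
  have e1 : ∀ {w : ℝ}, 0 < w → w ^ (-(1 / 2) - ε) = w ^ (-ε) * w ^ (-(1 / 2) : ℝ) := fun hw => by
    rw [← Real.rpow_add hw]
    congr 1
    ring
  rw [e1 hx, e1 hz]
  have p1 := Real.rpow_pos_of_pos hx (-ε)
  have p2 := Real.rpow_pos_of_pos hx (-(1 / 2) : ℝ)
  have p3 := Real.rpow_pos_of_pos hz (-ε)
  have p4 := Real.rpow_pos_of_pos hz (-(1 / 2) : ℝ)
  rcases le_total (bracketSq x) (bracketSq z) with h | h
  · have := Real.rpow_le_rpow_of_nonpos hx h (z := -ε) (by linarith)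
    nlinarith [mul_pos p3 p4]
  · have := Real.rpow_le_rpow_of_nonpos hz h (z := -(1 / 2)) (by norm_num)
    nlinarith [mul_pos p1 p2]

theorem integrable_bracketSq_rpow {ε : ℝ} (hε : 0 < ε) :
    Integrable fun x => bracketSq x ^ (-(1 / 2) - ε) := by
  have h := integrable_rpow_neg_one_add_norm_sq (E := ℝ) (μ := volume) (r := 1 + 2 * ε)
    (by simp [hε])
  have h2 := h.comp_mul_left' (R := 2 * Real.pi) (by positivity)
  refine h2.congr (Eventually.of_forall fun x => ?_)
  simp only [Real.norm_eq_abs, sq_abs, bracketSq]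
  congr 1
  ring

/-- The finite number `∫ ⟨x⟩^{-1-2ε} dx`. -/
def bracketIntegral (ε : ℝ) : ℝ≥0∞ := ∫⁻ x, ENNReal.ofReal (bracketSq x ^ (-(1 / 2) - ε))

theorem bracketIntegral_ne_top {ε : ℝ} (hε : 0 < ε) : bracketIntegral ε ≠ ∞ :=
  (integrable_bracketSq_rpow hε).lintegral_lt_top.ne

theorem lintegral_comp_add_mul {G : ℝ → ℝ≥0∞} (hG : Measurable G) (c : ℝ) {μ : ℝ} (hμ : μ ≠ 0) :
    ∫⁻ y, G (c + μ * y) = ENNReal.ofReal |μ|⁻¹ * ∫⁻ y, G y := by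
  have h1 : ∫⁻ y, G (c + μ * y) = ∫⁻ y, G (c + y) ∂(Measure.map (μ * ·) volume) := by
    rw [lintegral_map (by fun_prop) (by fun_prop)]
  rw [h1, Real.map_volume_mul_left hμ, lintegral_smul_measure, abs_inv,
    lintegral_add_left_eq_self G c, smul_eq_mul]

/-- The uniform estimate behind the collapsing estimate: the resonance function is
`(a - η) (a + b)`, up to a factor. -/
theorem exists_lintegral_weight_le {ε : ℝ} (hε : 0 < ε) {lam : ℝ} (hlam : lam ≠ 0) {G : ℝ → ℝ≥0∞}
    (hG : Measurable G) (hGi : ∫⁻ x, G x ≠ ∞) {B : ℝ≥0∞} (hB : B ≠ ∞) (hGB : ∀ x, G x ≤ B) :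
    ∃ S : ℝ≥0∞, S ≠ ∞ ∧ ∀ η c : ℝ, ∫⁻ p : ℝ × ℝ,
      ENNReal.ofReal (collisionWeight ε η p.1 p.2 ^ 2) *
        G (c + lam * ((p.1 - η) * (p.1 + p.2))) ≤ S := by
  set I := ∫⁻ x, G x with hI
  set W := weightConst ε with hW
  have hW0 : 0 < W := weightConst_pos ε
  set V : ℝ → ℝ → ℝ := fun x z => W * (bracketSq z ^ (-ε) + bracketSq x ^ (-ε)) with hV
  set K : ℝ≥0∞ := ENNReal.ofReal (8 * W * |lam|⁻¹) * I with hK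
  have hVc : ∀ {f g : ℝ × ℝ → ℝ}, Continuous f → Continuous g →
      Continuous fun p => V (f p) (g p) := by
    intro f g hf hg
    have h : ∀ {φ : ℝ × ℝ → ℝ}, Continuous φ → Continuous fun x => bracketSq (φ x) ^ (-ε) :=
      fun hφ => (continuous_bracketSq.comp hφ).rpow_const fun x => Or.inl (bracketSq_pos _).ne'
    exact continuous_const.mul ((h hg).add (h hf))
  -- the one-dimensional bound, after the integration of `G`
  have hone : ∀ x z : ℝ, 1 < |x| → ENNReal.ofReal (V x z) * (ENNReal.ofReal |lam * x|⁻¹ * I) ≤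
      K * (ENNReal.ofReal (bracketSq z ^ (-(1 / 2) - ε)) +
        2 * ENNReal.ofReal (bracketSq x ^ (-(1 / 2) - ε))) := by
    intro x z hx
    have p1 := Real.rpow_pos_of_pos (bracketSq_pos x) (-(1 / 2) - ε)
    have p2 := Real.rpow_pos_of_pos (bracketSq_pos z) (-(1 / 2) - ε)
    have p3 := Real.rpow_pos_of_pos (bracketSq_pos x) (-ε)
    have p4 := Real.rpow_pos_of_pos (bracketSq_pos z) (-ε)
    have hVn : 0 ≤ V x z := by simp only [hV]; positivity
    suffices hmain : V x z * |lam * x|⁻¹ ≤ 8 * W * |lam|⁻¹ *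
        (bracketSq z ^ (-(1 / 2) - ε) + 2 * bracketSq x ^ (-(1 / 2) - ε)) by
      calc _ = ENNReal.ofReal (V x z * |lam * x|⁻¹) * I := by
            rw [ENNReal.ofReal_mul hVn, mul_assoc]
        _ ≤ ENNReal.ofReal (8 * W * |lam|⁻¹ *
            (bracketSq z ^ (-(1 / 2) - ε) + 2 * bracketSq x ^ (-(1 / 2) - ε))) * I := by gcongr
        _ = _ := by
          rw [ENNReal.ofReal_mul (p := 8 * W * |lam|⁻¹) (by positivity),
            ENNReal.ofReal_add p2.le (by positivity), ENNReal.ofReal_mul (p := 2) (by norm_num),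
            hK, ENNReal.ofReal_ofNat]
          ring
    rw [abs_mul, mul_inv]
    have h1 := inv_abs_le_bracketSq hx
    have h2 := bracketSq_rpow_mul_le hε x z
    have h3 := bracketSq_rpow_mul_le hε x x
    have hl : 0 < |lam|⁻¹ := by positivity
    calc V x z * (|lam|⁻¹ * |x|⁻¹) ≤ V x z * (|lam|⁻¹ * (8 * bracketSq x ^ (-(1 / 2) : ℝ))) := by
          gcongr
      _ = 8 * W * |lam|⁻¹ * (bracketSq z ^ (-ε) * bracketSq x ^ (-(1 / 2) : ℝ) +
          bracketSq x ^ (-ε) * bracketSq x ^ (-(1 / 2) : ℝ)) := by simp only [hV]; ring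
      _ ≤ 8 * W * |lam|⁻¹ * (bracketSq z ^ (-(1 / 2) - ε) + bracketSq x ^ (-(1 / 2) - ε) +
          (bracketSq x ^ (-(1 / 2) - ε))) := by
          have : bracketSq x ^ (-ε) * bracketSq x ^ (-(1 / 2) : ℝ) = bracketSq x ^ (-(1 / 2) - ε) := by
            rw [← Real.rpow_add (bracketSq_pos x)]
            congr 1
            ring
          rw [this]
          gcongr
      _ = _ := by ring
  have hmJ : Measurable fun x => ENNReal.ofReal (bracketSq x ^ (-(1 / 2) - ε)) :=
    ((continuous_bracketSq.rpow_const fun x => Or.inl (bracketSq_pos x).ne').measurable).ennreal_ofReal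
  have hsum : ∀ (f g : ℝ → ℝ), MeasurePreserving f → MeasurePreserving g →
      ∫⁻ x, K * (ENNReal.ofReal (bracketSq (f x) ^ (-(1 / 2) - ε)) +
        2 * ENNReal.ofReal (bracketSq (g x) ^ (-(1 / 2) - ε))) ≤ K * (3 * bracketIntegral ε) := by
    intro f g hf hg
    have h1 : Measurable fun x => ENNReal.ofReal (bracketSq (f x) ^ (-(1 / 2) - ε)) :=
      hmJ.comp hf.measurable
    have h2 : Measurable fun x => ENNReal.ofReal (bracketSq (g x) ^ (-(1 / 2) - ε)) :=
      hmJ.comp hg.measurable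
    have e1 : ∫⁻ x, ENNReal.ofReal (bracketSq (f x) ^ (-(1 / 2) - ε)) = bracketIntegral ε :=
      hf.lintegral_comp hmJ
    have e2 : ∫⁻ x, ENNReal.ofReal (bracketSq (g x) ^ (-(1 / 2) - ε)) = bracketIntegral ε :=
      hg.lintegral_comp hmJ
    have h12 : Measurable fun x => ENNReal.ofReal (bracketSq (f x) ^ (-(1 / 2) - ε)) +
        2 * ENNReal.ofReal (bracketSq (g x) ^ (-(1 / 2) - ε)) := h1.add (h2.const_mul 2)
    rw [lintegral_const_mul _ h12, lintegral_add_left h1,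
      lintegral_const_mul _ h2, e1, e2]
    apply le_of_eq
    ring
  refine ⟨K * (3 * bracketIntegral ε) + K * (3 * bracketIntegral ε) +
    ENNReal.ofReal (W * 2) * B * 4, ?_, fun η c => ?_⟩
  · have hKt : K ≠ ∞ := ENNReal.mul_ne_top (by simp) hGi
    have hJ := bracketIntegral_ne_top hε
    finiteness
  have hGm : Measurable fun p : ℝ × ℝ => G (c + lam * ((p.1 - η) * (p.1 + p.2))) := by fun_prop
  -- The phase is affine in `b` for fixed `a`, with slope proportional to `a - η`, and affine in `a`
  -- for fixed `a + b`, with slope proportional to `a + b`. Where one of these slopes is large, that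
  -- direction is integrated first and the inverse slope supplies the missing decay; where both are
  -- small, the region is bounded.
  set T1 : ℝ × ℝ → ℝ≥0∞ := {p : ℝ × ℝ | 1 < |p.1 - η|}.indicator fun p =>
    ENNReal.ofReal (V (p.1 - η) p.1) * G (c + lam * ((p.1 - η) * (p.1 + p.2))) with hT1
  set T2 : ℝ × ℝ → ℝ≥0∞ := {p : ℝ × ℝ | 1 < |p.1 + p.2|}.indicator fun p =>
    ENNReal.ofReal (V (p.1 + p.2) (p.1 + p.2 - η)) *
      G (c + lam * ((p.1 - η) * (p.1 + p.2))) with hT2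
  set T3 : ℝ × ℝ → ℝ≥0∞ := {p : ℝ × ℝ | |p.1 - η| ≤ 1 ∧ |p.1 + p.2| ≤ 1}.indicator fun _ =>
    ENNReal.ofReal (W * 2) * B with hT3
  have hm1 : Measurable T1 := by
    refine Measurable.indicator ?_ (measurableSet_lt (by fun_prop) (by fun_prop))
    exact (hVc (by fun_prop) (by fun_prop)).measurable.ennreal_ofReal.mul hGm
  have hm2 : Measurable T2 := by
    refine Measurable.indicator ?_ (measurableSet_lt (by fun_prop) (by fun_prop))
    exact (hVc (by fun_prop) (by fun_prop)).measurable.ennreal_ofReal.mul hGm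
  have hset3 : MeasurableSet {p : ℝ × ℝ | |p.1 - η| ≤ 1 ∧ |p.1 + p.2| ≤ 1} :=
    (measurableSet_le (f := fun p : ℝ × ℝ => |p.1 - η|) (g := fun _ => 1) (by fun_prop)
      (by fun_prop)).inter (measurableSet_le (f := fun p : ℝ × ℝ => |p.1 + p.2|) (g := fun _ => 1)
      (by fun_prop) (by fun_prop))
  have hm3 : Measurable T3 := by
    exact Measurable.indicator measurable_const hset3
  have hpt : ∀ p : ℝ × ℝ, ENNReal.ofReal (collisionWeight ε η p.1 p.2 ^ 2) *
        G (c + lam * ((p.1 - η) * (p.1 + p.2))) ≤ T1 p + T2 p + T3 p := by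
    intro p
    by_cases h1 : 1 < |p.1 - η|
    · refine le_trans ?_ (le_self_add.trans le_self_add)
      rw [hT1, Set.indicator_of_mem (by exact h1)]
      gcongr
      exact collisionWeight_sq_le_left hε η p.1 p.2
    by_cases h2 : 1 < |p.1 + p.2|
    · refine le_trans ?_ (le_add_self.trans le_self_add)
      rw [hT2, Set.indicator_of_mem (by exact h2)]
      gcongr
      exact collisionWeight_sq_le_right hε η p.1 p.2
    · refine le_trans ?_ le_add_self
      rw [hT3, Set.indicator_of_mem (by exact ⟨not_lt.1 h1, not_lt.1 h2⟩)]
      gcongr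
      · exact collisionWeight_sq_le_const hε η p.1 p.2
      · exact hGB _
  refine (lintegral_mono hpt).trans ?_
  have hm12 : Measurable fun p => T1 p + T2 p := hm1.add hm2
  rw [lintegral_add_left hm12, lintegral_add_left hm1]
  refine add_le_add (add_le_add ?_ ?_) ?_
  · rw [Measure.volume_eq_prod, lintegral_prod _ hm1.aemeasurable]
    refine le_trans (lintegral_mono fun a => ?_) (hsum (fun a => a) (fun a => a - η)
      (MeasurePreserving.id _) (measurePreserving_sub_right volume η))
    by_cases h : 1 < |a - η|
    · have e : ∀ b, T1 (a, b) = ENNReal.ofReal (V (a - η) a) *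
          G (c + lam * (a - η) * a + lam * (a - η) * b) := by
        intro b
        rw [hT1, Set.indicator_of_mem (by exact h)]
        congr 2
        ring
      simp_rw [e]
      have hne : lam * (a - η) ≠ 0 := mul_ne_zero hlam fun h0 => by
        rw [h0, abs_zero] at h
        linarith
      rw [lintegral_const_mul _ (by fun_prop), lintegral_comp_add_mul hG _ hne]
      exact hone _ _ h
    · have e : ∀ b, T1 (a, b) = 0 := fun b => Set.indicator_of_notMem (by exact h) _
      simp [e]
  -- The shear `y = a + b` gives coordinates in which the phase is affine in `a` at fixed `y`.
  · have hm2' : Measurable fun p : ℝ × ℝ => T2 (p.1, p.2 - p.1) := hm2.comp (by fun_prop)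
    have e0 : ∫⁻ p, T2 p = ∫⁻ y, ∫⁻ a, T2 (a, y - a) := by
      rw [Measure.volume_eq_prod, lintegral_prod _ hm2.aemeasurable,
        ← lintegral_lintegral_swap (f := fun a y => T2 (a, y - a)) hm2'.aemeasurable]
      refine lintegral_congr fun a => ?_
      exact (lintegral_sub_right_eq_self (fun b => T2 (a, b)) a).symm
    rw [e0]
    refine le_trans (lintegral_mono fun y => ?_) (hsum (fun y => y - η) (fun y => y)
      (measurePreserving_sub_right volume η) (MeasurePreserving.id _))
    by_cases h : 1 < |y|
    · have e : ∀ a, T2 (a, y - a) = ENNReal.ofReal (V y (y - η)) *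
          G (c - lam * η * y + lam * y * a) := by
        intro a
        have ha : a + (y - a) = y := by ring
        rw [hT2, Set.indicator_of_mem (by simpa [ha] using h)]
        simp only [ha]
        congr 2
        ring
      simp_rw [e]
      have hne : lam * y ≠ 0 := mul_ne_zero hlam fun h0 => by
        rw [h0, abs_zero] at h
        linarith
      rw [lintegral_const_mul _ (by fun_prop), lintegral_comp_add_mul hG _ hne]
      exact hone _ _ h
    · have e : ∀ a, T2 (a, y - a) = 0 := fun a => Set.indicator_of_notMem (by simpa using h) _
      simp [e]
  -- The same shear carries the bounded region into a product of two intervals of length `2`, whence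
  -- the factor `4`.
  · rw [hT3, lintegral_indicator hset3, setLIntegral_const]
    gcongr
    have hset : {p : ℝ × ℝ | |p.1 - η| ≤ 1 ∧ |p.1 + p.2| ≤ 1} ⊆
        (fun p : ℝ × ℝ => (p.1, p.1 + p.2)) ⁻¹'
          (Metric.closedBall η 1 ×ˢ Metric.closedBall 0 1) := by
      rintro p ⟨h1, h2⟩
      simp [Real.dist_eq, h1, h2]
    refine (measure_mono hset).trans ?_
    have hmp : MeasurePreserving (fun p : ℝ × ℝ => (p.1, p.1 + p.2)) (volume.prod volume)
        (volume.prod volume) := measurePreserving_prod_add _ _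
    rw [Measure.volume_eq_prod, hmp.measure_preimage
      (Metric.isClosed_closedBall.measurableSet.prod
        Metric.isClosed_closedBall.measurableSet).nullMeasurableSet, Measure.prod_prod,
      Real.volume_closedBall, Real.volume_closedBall]
    norm_num


/-! ### Multiplication operators and partial integration on `L²` -/

section L2Operators

variable {X Z : Type*} [MeasurableSpace X] [MeasurableSpace Z] {μ : Measure X} {ν : Measure Z}

theorem eLpNorm_two_sq {E : Type*} [NormedAddCommGroup E] (f : X → E) :
    eLpNorm f 2 μ ^ 2 = ∫⁻ x, ‖f x‖ₑ ^ 2 ∂μ := by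
  have := eLpNorm_nnreal_pow_eq_lintegral (f := f) (μ := μ) (p := 2) (by norm_num)
  simpa using this

theorem enorm_sq_eq_lintegral (f : Lp ℂ 2 μ) : ‖f‖ₑ ^ 2 = ∫⁻ x, ‖f x‖ₑ ^ 2 ∂μ := by
  rw [Lp.enorm_def, eLpNorm_two_sq]

/-- A bounded measurable symbol. -/
structure IsSymbol (m : X → ℂ) : Prop where
  measurable : Measurable m
  bounded : ∃ C : ℝ, ∀ x, ‖m x‖ ≤ C

theorem IsSymbol.memLp_mul {m : X → ℂ} (hm : IsSymbol m) (f : Lp ℂ 2 μ) :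
    MemLp (fun x => m x * f x) 2 μ := by
  obtain ⟨C, hC⟩ := hm.bounded
  refine (Lp.memLp f).of_le_mul (c := C)
    (hm.measurable.aestronglyMeasurable.mul (Lp.aestronglyMeasurable f))
    (Eventually.of_forall fun x => ?_)
  rw [norm_mul]
  gcongr
  exact hC x

/-- The multiplication operator by a bounded symbol on `L²`. -/
def mulOp (m : X → ℂ) (hm : IsSymbol m) : Lp ℂ 2 μ →L[ℂ] Lp ℂ 2 μ :=
  LinearMap.mkContinuous
    { toFun := fun f => (hm.memLp_mul f).toLp
      map_add' := fun f g => by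
        rw [← MemLp.toLp_add]
        refine MemLp.toLp_congr _ _ ?_
        filter_upwards [Lp.coeFn_add f g] with x hx
        simp only [hx, Pi.add_apply, mul_add]
      map_smul' := fun a f => by
        rw [RingHom.id_apply, ← MemLp.toLp_const_smul]
        refine MemLp.toLp_congr _ _ ?_
        filter_upwards [Lp.coeFn_smul a f] with x hx
        simp only [hx, Pi.smul_apply, smul_eq_mul]
        ring } (max hm.bounded.choose 0) (fun f => by
      refine Lp.norm_le_mul_norm_of_ae_le_mul ?_
      filter_upwards [MemLp.coeFn_toLp (hm.memLp_mul f)] with x hx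
      simp only [LinearMap.coe_mk, AddHom.coe_mk]
      rw [hx, norm_mul]
      gcongr
      exact (hm.bounded.choose_spec x).trans (le_max_left _ _))

theorem coeFn_mulOp {m : X → ℂ} (hm : IsSymbol m) (f : Lp ℂ 2 μ) :
    mulOp m hm f =ᵐ[μ] fun x => m x * f x := MemLp.coeFn_toLp (hm.memLp_mul f)

theorem norm_mulOp_apply_le {m : X → ℂ} (hm : IsSymbol m) {C : ℝ} (hC : ∀ x, ‖m x‖ ≤ C)
    (f : Lp ℂ 2 μ) : ‖mulOp m hm f‖ ≤ C * ‖f‖ := by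
  refine Lp.norm_le_mul_norm_of_ae_le_mul ?_
  filter_upwards [coeFn_mulOp hm f] with x hx
  rw [hx, norm_mul]
  gcongr
  exact hC x

/-- Dominated convergence for a fixed `f`. Only strong convergence can be expected: phases `e^{itΩ}`
with unbounded `Ω` are not norm continuous in `t`. -/
theorem tendsto_mulOp {ι : Type*} {l : Filter ι} [l.IsCountablyGenerated] {m : ι → X → ℂ}
    (hm : ∀ i, IsSymbol (m i)) {m₀ : X → ℂ} (hm₀ : IsSymbol m₀) {C : ℝ}
    (hC : ∀ i x, ‖m i x‖ ≤ C) (hlim : ∀ x, Tendsto (fun i => m i x) l (𝓝 (m₀ x)))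
    (f : Lp ℂ 2 μ) : Tendsto (fun i => mulOp (m i) (hm i) f) l (𝓝 (mulOp m₀ hm₀ f)) := by
  obtain ⟨C₀, hC₀⟩ := hm₀.bounded
  rw [Lp.tendsto_Lp_iff_tendsto_eLpNorm']
  have hsq : Tendsto (fun i => eLpNorm (mulOp (m i) (hm i) f - mulOp m₀ hm₀ f : X → ℂ) 2 μ ^ 2) l
      (𝓝 0) := by
    have h1 : ∀ i, eLpNorm (mulOp (m i) (hm i) f - mulOp m₀ hm₀ f : X → ℂ) 2 μ ^ 2 =
        ∫⁻ x, ‖(m i x - m₀ x) * f x‖ₑ ^ 2 ∂μ := by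
      intro i
      rw [eLpNorm_two_sq]
      refine lintegral_congr_ae ?_
      filter_upwards [coeFn_mulOp (hm i) f, coeFn_mulOp hm₀ f] with x hx hx'
      rw [Pi.sub_apply, hx, hx', sub_mul]
    simp_rw [h1]
    have h0 : (0 : ℝ≥0∞) = ∫⁻ _, 0 ∂μ := by simp
    rw [h0]
    refine tendsto_lintegral_filter_of_dominated_convergence
      (fun x => (ENNReal.ofReal (C + C₀) * ‖f x‖ₑ) ^ 2) ?_ ?_ ?_ ?_
    · exact Eventually.of_forall fun i => ((((hm i).measurable.sub hm₀.measurable).mul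
        (Lp.stronglyMeasurable f).measurable).enorm.pow_const 2)
    · refine Eventually.of_forall fun i => Eventually.of_forall fun x => ?_
      rw [enorm_mul]
      gcongr
      rw [← ofReal_norm]
      refine ENNReal.ofReal_le_ofReal ((norm_sub_le _ _).trans (add_le_add (hC i x) (hC₀ x)))
    · simp_rw [mul_pow]
      rw [lintegral_const_mul'' _ ((Lp.aestronglyMeasurable f).enorm.pow_const 2),
        ← enorm_sq_eq_lintegral]
      finiteness
    · refine Eventually.of_forall fun x => ?_
      have : Tendsto (fun i => (m i x - m₀ x) * f x) l (𝓝 ((m₀ x - m₀ x) * f x)) :=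
        ((hlim x).sub_const _).mul_const _
      have h2 := (ENNReal.continuous_pow 2).tendsto _ |>.comp this.enorm
      simpa [Function.comp_def] using h2
  have h := (ENNReal.continuous_rpow_const (y := ((2 : ℕ) : ℝ)⁻¹)).tendsto _ |>.comp hsq
  rw [ENNReal.zero_rpow_of_pos (by norm_num)] at h
  simpa only [Function.comp_def, ENNReal.pow_rpow_inv_natCast two_ne_zero] using h

theorem enorm_integral_mul_sq_le {χ F : Z → ℂ} (hχ : AEStronglyMeasurable χ ν)
    (hF : AEStronglyMeasurable F ν) :
    ‖∫ z, χ z * F z ∂ν‖ₑ ^ 2 ≤ (∫⁻ z, ‖χ z‖ₑ ^ 2 ∂ν) * ∫⁻ z, ‖F z‖ₑ ^ 2 ∂ν := by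
  have h := ENNReal.lintegral_mul_le_Lp_mul_Lq ν Real.HolderConjugate.two_two hχ.enorm hF.enorm
  have h1 : ‖∫ z, χ z * F z ∂ν‖ₑ ≤ (∫⁻ z, ‖χ z‖ₑ ^ (2 : ℝ) ∂ν) ^ (1 / 2 : ℝ) *
      (∫⁻ z, ‖F z‖ₑ ^ (2 : ℝ) ∂ν) ^ (1 / 2 : ℝ) := by
    refine (enorm_integral_le_lintegral_enorm _).trans (le_trans (le_of_eq ?_) h)
    simp
  refine (pow_le_pow_left' h1 2).trans (le_of_eq ?_)
  rw [mul_pow, ← ENNReal.rpow_natCast, ← ENNReal.rpow_mul, ← ENNReal.rpow_natCast,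
    ← ENNReal.rpow_mul]
  norm_num

variable [SFinite ν]

theorem ae_memLp_slice (F : Lp ℂ 2 (μ.prod ν)) : ∀ᵐ x ∂μ, MemLp (fun z => F (x, z)) 2 ν := by
  have h1 : ∫⁻ x, ∫⁻ z, ‖F (x, z)‖ₑ ^ 2 ∂ν ∂μ ≠ ∞ := by
    rw [← lintegral_prod (fun p => ‖F p‖ₑ ^ 2)
      ((Lp.aestronglyMeasurable F).enorm.pow_const 2), ← enorm_sq_eq_lintegral]
    finiteness
  have hm : AEMeasurable (fun x => ∫⁻ z, ‖F (x, z)‖ₑ ^ 2 ∂ν) μ :=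
    AEMeasurable.lintegral_prod_right' ((Lp.aestronglyMeasurable F).enorm.pow_const 2)
  filter_upwards [ae_lt_top' hm h1, (Lp.aestronglyMeasurable F).prodMk_left] with x hx hx'
  refine ⟨hx', ?_⟩
  have := eLpNorm_two_sq (μ := ν) fun z => F (x, z)
  rw [← this] at hx
  exact (ENNReal.pow_lt_top_iff.1 hx).resolve_right (by norm_num)

theorem memLp_integral_mul {χ : Z → ℂ} (hχ : MemLp χ 2 ν) (F : Lp ℂ 2 (μ.prod ν)) :
    MemLp (fun x => ∫ z, χ z * F (x, z) ∂ν) 2 μ ∧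
      eLpNorm (fun x => ∫ z, χ z * F (x, z) ∂ν) 2 μ ^ 2 ≤ eLpNorm χ 2 ν ^ 2 * ‖F‖ₑ ^ 2 := by
  have hle : eLpNorm (fun x => ∫ z, χ z * F (x, z) ∂ν) 2 μ ^ 2 ≤
      eLpNorm χ 2 ν ^ 2 * ‖F‖ₑ ^ 2 := by
    rw [eLpNorm_two_sq, eLpNorm_two_sq, enorm_sq_eq_lintegral,
      lintegral_prod _ ((Lp.aestronglyMeasurable F).enorm.pow_const 2),
      ← lintegral_const_mul'' _ (AEMeasurable.lintegral_prod_right'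
        ((Lp.aestronglyMeasurable F).enorm.pow_const 2))]
    refine lintegral_mono_ae ?_
    filter_upwards [(Lp.aestronglyMeasurable F).prodMk_left] with x hx
    exact enorm_integral_mul_sq_le hχ.aestronglyMeasurable hx
  refine ⟨⟨?_, ?_⟩, hle⟩
  · exact (hχ.aestronglyMeasurable.comp_snd.mul
      (Lp.aestronglyMeasurable F)).integral_prod_right'
  · have : eLpNorm (fun x => ∫ z, χ z * F (x, z) ∂ν) 2 μ ^ 2 < ∞ := by
      refine hle.trans_lt ?_
      have := hχ.eLpNorm_ne_top
      finiteness
    exact (ENNReal.pow_lt_top_iff.1 this).resolve_right (by norm_num)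

/-- The operator `F ↦ ∫ χ(z) F(·, z) dz` on `L²`. -/
def intOp (χ : Z → ℂ) (hχ : MemLp χ 2 ν) : Lp ℂ 2 (μ.prod ν) →L[ℂ] Lp ℂ 2 μ :=
  LinearMap.mkContinuous
    { toFun := fun F => (memLp_integral_mul hχ F).1.toLp
      map_add' := fun F G => by
        rw [← MemLp.toLp_add]
        refine MemLp.toLp_congr _ _ ?_
        filter_upwards [Measure.ae_ae_of_ae_prod (Lp.coeFn_add F G), ae_memLp_slice F,
          ae_memLp_slice G] with x hx hF hG
        have hiF : Integrable (fun z => χ z * F (x, z)) ν := hχ.integrable_mul hF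
        have hiG : Integrable (fun z => χ z * G (x, z)) ν := hχ.integrable_mul hG
        rw [Pi.add_apply, ← integral_add hiF hiG]
        refine integral_congr_ae ?_
        filter_upwards [hx] with z hz
        rw [hz, Pi.add_apply, mul_add]
      map_smul' := fun a F => by
        rw [RingHom.id_apply, ← MemLp.toLp_const_smul]
        refine MemLp.toLp_congr _ _ ?_
        filter_upwards [Measure.ae_ae_of_ae_prod (Lp.coeFn_smul a F)] with x hx
        rw [Pi.smul_apply, ← integral_smul]
        refine integral_congr_ae ?_
        filter_upwards [hx] with z hz
        rw [hz, Pi.smul_apply, smul_eq_mul, smul_eq_mul]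
        ring } (eLpNorm χ 2 ν).toReal (fun F => by
      have h := (memLp_integral_mul hχ F).2
      rw [← mul_pow, ENNReal.pow_le_pow_left_iff (by norm_num)] at h
      simp only [LinearMap.coe_mk, AddHom.coe_mk]
      rw [Lp.norm_toLp, ← toReal_enorm, ← ENNReal.toReal_mul]
      exact ENNReal.toReal_mono (ENNReal.mul_ne_top hχ.eLpNorm_ne_top enorm_ne_top) h)

theorem coeFn_intOp {χ : Z → ℂ} (hχ : MemLp χ 2 ν) (F : Lp ℂ 2 (μ.prod ν)) :
    intOp (μ := μ) χ hχ F =ᵐ[μ] fun x => ∫ z, χ z * F (x, z) ∂ν :=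
  MemLp.coeFn_toLp (memLp_integral_mul hχ F).1

theorem norm_intOp_le {χ : Z → ℂ} (hχ : MemLp χ 2 ν) :
    ‖intOp (μ := μ) χ hχ‖ ≤ (eLpNorm χ 2 ν).toReal :=
  LinearMap.mkContinuous_norm_le _ ENNReal.toReal_nonneg _

attribute [irreducible] mulOp intOp

end L2Operators


/-! ### The collision as a substitution of frequencies -/

theorem appendVar_inl_castSucc {k : ℕ} (y : KernelSpace k) (z z' : ℝ) (j : Fin k) :
    appendVar y z z' (Sum.inl j.castSucc) = y (Sum.inl j) := by
  simp [appendVar]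

theorem appendVar_inr_castSucc {k : ℕ} (y : KernelSpace k) (z z' : ℝ) (j : Fin k) :
    appendVar y z z' (Sum.inr j.castSucc) = y (Sum.inr j) := by
  simp [appendVar]

theorem appendVar_inl_last {k : ℕ} (y : KernelSpace k) (z z' : ℝ) :
    appendVar y z z' (Sum.inl (Fin.last k)) = z := by
  simp [appendVar]

theorem appendVar_inr_last {k : ℕ} (y : KernelSpace k) (z z' : ℝ) :
    appendVar y z z' (Sum.inr (Fin.last k)) = z' := by
  simp [appendVar]

theorem kernelSpace_succ_ext {k : ℕ} {x y : KernelSpace (k + 1)}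
    (h1 : ∀ j : Fin k, x (Sum.inl j.castSucc) = y (Sum.inl j.castSucc))
    (h2 : x (Sum.inl (Fin.last k)) = y (Sum.inl (Fin.last k)))
    (h3 : ∀ j : Fin k, x (Sum.inr j.castSucc) = y (Sum.inr j.castSucc))
    (h4 : x (Sum.inr (Fin.last k)) = y (Sum.inr (Fin.last k))) : x = y := by
  ext i
  rcases i with i | i
  · exact Fin.lastCases h2 h1 i
  · exact Fin.lastCases h4 h3 i

theorem continuous_appendVar {k : ℕ} {X : Type*} [TopologicalSpace X] {y : X → KernelSpace k}
    {z z' : X → ℝ} (hy : Continuous y) (hz : Continuous z) (hz' : Continuous z') :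
    Continuous fun x => appendVar (y x) (z x) (z' x) := by
  refine (PiLp.continuous_toLp 2 _).comp (continuous_pi fun i => ?_)
  rcases i with i | i
  · refine Fin.lastCases ?_ (fun i => ?_) i
    · simpa using hz
    · simp only [Sum.elim_inl, Fin.snoc_castSucc]
      fun_prop
  · refine Fin.lastCases ?_ (fun i => ?_) i
    · simpa using hz'
    · simp only [Sum.elim_inr, Fin.snoc_castSucc]
      fun_prop

theorem measurePreserving_appendVar (k : ℕ) :
    MeasurePreserving (fun p : KernelSpace k × ℝ × ℝ => appendVar p.1 p.2.1 p.2.2)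
      (volume.prod (volume.prod volume)) volume := by
  have hc : Continuous fun p : KernelSpace k × ℝ × ℝ => appendVar p.1 p.2.1 p.2.2 :=
    continuous_appendVar continuous_fst (continuous_fst.comp continuous_snd)
      (continuous_snd.comp continuous_snd)
  have hof : Continuous fun p : KernelSpace k × ℝ × ℝ =>
      (WithLp.ofLp (appendVar p.1 p.2.1 p.2.2) : Fin (k + 1) ⊕ Fin (k + 1) → ℝ) :=
    (PiLp.continuous_ofLp 2 _).comp hc
  suffices h : MeasurePreserving (fun p : KernelSpace k × ℝ × ℝ =>
      (WithLp.ofLp (appendVar p.1 p.2.1 p.2.2) : Fin (k + 1) ⊕ Fin (k + 1) → ℝ))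
      (volume.prod (volume.prod volume)) volume from
    (PiLp.volume_preserving_toLp (Fin (k + 1) ⊕ Fin (k + 1))).comp h
  refine ⟨hof.measurable, ?_⟩
  rw [volume_pi]
  refine (Measure.pi_eq fun s hs => ?_).symm
  rw [Measure.map_apply hof.measurable (MeasurableSet.univ_pi hs)]
  have hpre : (fun p : KernelSpace k × ℝ × ℝ =>
      (WithLp.ofLp (appendVar p.1 p.2.1 p.2.2) : Fin (k + 1) ⊕ Fin (k + 1) → ℝ)) ⁻¹'
        (Set.univ.pi s) =
      (WithLp.ofLp ⁻¹' Set.univ.pi fun i : Fin k ⊕ Fin k =>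
        s (Sum.map Fin.castSucc Fin.castSucc i)) ×ˢ
          (s (Sum.inl (Fin.last k)) ×ˢ s (Sum.inr (Fin.last k))) := by
    ext p
    simp only [Set.mem_preimage, Set.mem_pi, Set.mem_univ, true_implies, Set.mem_prod, Sum.forall,
      Fin.forall_fin_succ', Sum.map_inl, Sum.map_inr, appendVar_inl_castSucc,
      appendVar_inr_castSucc, appendVar_inl_last, appendVar_inr_last]
    tauto
  have hms : MeasurableSet (Set.univ.pi fun i : Fin k ⊕ Fin k =>
      s (Sum.map Fin.castSucc Fin.castSucc i)) := MeasurableSet.univ_pi fun i => hs _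
  rw [hpre, Measure.prod_prod, Measure.prod_prod,
    (PiLp.volume_preserving_ofLp (Fin k ⊕ Fin k)).measure_preimage hms.nullMeasurableSet,
    volume_pi, Measure.pi_pi, Fintype.prod_sum_type, Fintype.prod_sum_type,
    Fin.prod_univ_castSucc, Fin.prod_univ_castSucc]
  simp only [Sum.map_inl, Sum.map_inr]
  ring

/-- The frequency `(η, a; η', b)` with the `i`-th entry of `ξ = (η; η')` lowered by `a + b`. -/
def mergeFreq {k : ℕ} (i : Fin k ⊕ Fin k) (ξ : KernelSpace k) (z : ℝ × ℝ) : KernelSpace (k + 1) :=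
  appendVar (ξ - EuclideanSpace.single i (z.1 + z.2)) z.1 z.2

/-- A shear, translating the `i`-th coordinate by an amount that depends on `z`, followed by the
appending of the two new coordinates. -/
theorem measurePreserving_mergeFreq {k : ℕ} (i : Fin k ⊕ Fin k) :
    MeasurePreserving (fun p : KernelSpace k × ℝ × ℝ => mergeFreq i p.1 p.2)
      (volume.prod (volume.prod volume)) volume := by
  have hcs : Continuous fun p : (ℝ × ℝ) × KernelSpace k =>
      p.2 - EuclideanSpace.single i (p.1.1 + p.1.2) := by
    refine continuous_snd.sub ?_
    refine (PiLp.continuous_toLp 2 _).comp ?_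
    exact (continuous_single i).comp (by fun_prop)
  have h1 : MeasurePreserving (fun p : (ℝ × ℝ) × KernelSpace k =>
      (p.1, p.2 - EuclideanSpace.single i (p.1.1 + p.1.2)))
      ((volume.prod volume).prod volume) ((volume.prod volume).prod volume) := by
    refine (MeasurePreserving.id (volume.prod volume)).skew_product
      (g := fun z ξ => ξ - EuclideanSpace.single i (z.1 + z.2)) hcs.measurable
      (Eventually.of_forall fun z => ?_)
    exact (measurePreserving_sub_right volume _).map_eq
  have h2 := (measurePreserving_appendVar k).comp
    (Measure.measurePreserving_swap.comp (h1.comp Measure.measurePreserving_swap))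
  exact h2

theorem mergeFreq_inl_castSucc {k : ℕ} (i : Fin k ⊕ Fin k) (ξ : KernelSpace k) (z : ℝ × ℝ)
    (j : Fin k) : mergeFreq i ξ z (Sum.inl j.castSucc) =
      ξ (Sum.inl j) - if Sum.inl j = i then z.1 + z.2 else 0 := by
  simp [mergeFreq, appendVar_inl_castSucc]

theorem mergeFreq_inr_castSucc {k : ℕ} (i : Fin k ⊕ Fin k) (ξ : KernelSpace k) (z : ℝ × ℝ)
    (j : Fin k) : mergeFreq i ξ z (Sum.inr j.castSucc) =
      ξ (Sum.inr j) - if Sum.inr j = i then z.1 + z.2 else 0 := by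
  simp [mergeFreq, appendVar_inr_castSucc]

theorem mergeFreq_inl_last {k : ℕ} (i : Fin k ⊕ Fin k) (ξ : KernelSpace k) (z : ℝ × ℝ) :
    mergeFreq i ξ z (Sum.inl (Fin.last k)) = z.1 := by
  simp [mergeFreq, appendVar_inl_last]

theorem mergeFreq_inr_last {k : ℕ} (i : Fin k ⊕ Fin k) (ξ : KernelSpace k) (z : ℝ × ℝ) :
    mergeFreq i ξ z (Sum.inr (Fin.last k)) = z.2 := by
  simp [mergeFreq, appendVar_inr_last]

/-- The resonance function of the collision of a particle with the frequency `η` (in the variable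
`y` or in `y'`). -/
def resonance {k : ℕ} : Fin k ⊕ Fin k → ℝ → ℝ × ℝ → ℝ
  | Sum.inl _, η, z => -(4 * Real.pi ^ 2) * ((z.1 - η) * (z.1 + z.2))
  | Sum.inr _, η, z => 4 * Real.pi ^ 2 * ((z.2 - η) * (z.1 + z.2))

/-- All other particles cancel. For a collision in `y` what remains is `η² - (η - a - b)² - a² + b²
= -2 (a - η) (a + b)`; in `y'` the signs change and `a`, `b` trade places. This factorization is
what the resonance estimate exploits. -/
theorem dispersion_sub_dispersion_mergeFreq {k : ℕ} (i : Fin k ⊕ Fin k) (ξ : KernelSpace k)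
    (z : ℝ × ℝ) : dispersion ξ - dispersion (mergeFreq i ξ z) = resonance i (ξ i) z := by
  have hsum : ∀ (φ : Fin k → ℝ) (j : Fin k) (d : ℝ),
      ∑ x, (2 * Real.pi * (φ x - if x = j then d else 0)) ^ 2 =
        ∑ x, (2 * Real.pi * φ x) ^ 2 - (2 * Real.pi * φ j) ^ 2 + (2 * Real.pi * (φ j - d)) ^ 2 := by
    intro φ j d
    rw [← Finset.add_sum_erase _ _ (Finset.mem_univ j),
      ← Finset.add_sum_erase (a := j) _ (fun x => (2 * Real.pi * φ x) ^ 2) (Finset.mem_univ j)]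
    rw [Finset.sum_congr rfl (g := fun x => (2 * Real.pi * φ x) ^ 2) fun x hx => by
      rw [if_neg (Finset.ne_of_mem_erase hx), sub_zero]]
    simp only [if_true]
    ring
  unfold dispersion
  rw [Fin.sum_univ_castSucc, Fin.sum_univ_castSucc]
  simp only [mergeFreq_inl_castSucc, mergeFreq_inr_castSucc, mergeFreq_inl_last,
    mergeFreq_inr_last]
  rcases i with j | j
  · simp only [Sum.inl.injEq, reduceCtorEq, if_false, sub_zero, resonance]
    rw [hsum (fun x => ξ (Sum.inl x))]
    ring
  · simp only [Sum.inr.injEq, reduceCtorEq, if_false, sub_zero, resonance]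
    rw [hsum (fun x => ξ (Sum.inr x))]
    ring

theorem continuous_resonance {k : ℕ} (i : Fin k ⊕ Fin k) {X : Type*} [TopologicalSpace X]
    {η : X → ℝ} {z : X → ℝ × ℝ} (hη : Continuous η) (hz : Continuous z) :
    Continuous fun x => resonance i (η x) (z x) := by
  rcases i with j | j <;> simp only [resonance] <;> fun_prop

theorem sobolevSymbol_eq {k : ℕ} (ε : ℝ) (ξ : KernelSpace k) :
    sobolevSymbol ε ξ = ∏ i, bracketSq (ξ i) ^ (ε / 2) := rfl

theorem sobolevSymbol_pos {k : ℕ} (ε : ℝ) (ξ : KernelSpace k) : 0 < sobolevSymbol ε ξ :=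
  Finset.prod_pos fun _ _ => Real.rpow_pos_of_pos (bracketSq_pos _) _

theorem one_le_sobolevSymbol {k : ℕ} {ε : ℝ} (hε : 0 < ε) (ξ : KernelSpace k) :
    1 ≤ sobolevSymbol ε ξ :=
  Finset.one_le_prod (fun _ _ => Real.one_le_rpow (one_le_bracketSq _) (by positivity))

theorem continuous_sobolevSymbol {k : ℕ} (ε : ℝ) :
    Continuous (sobolevSymbol (k := k) ε) := by
  refine continuous_finsetProd _ fun i _ => ?_
  exact (continuous_bracketSq.comp (by fun_prop)).rpow_const fun x => Or.inl (bracketSq_pos _).ne'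

/-- Only the `i`-th factor and the two new ones differ, so the quotient of the weights sees three
frequencies and is independent of the number of particles. -/
theorem sobolevSymbol_mergeFreq {k : ℕ} (ε : ℝ) (i : Fin k ⊕ Fin k) (ξ : KernelSpace k)
    (z : ℝ × ℝ) :
    sobolevSymbol ε ξ = collisionWeight ε (ξ i) z.1 z.2 * sobolevSymbol ε (mergeFreq i ξ z) := by
  have hprod : ∀ (φ : Fin k → ℝ) (j : Fin k) (d : ℝ),
      bracketSq (φ j) ^ (ε / 2) * ∏ x, bracketSq (φ x - if x = j then d else 0) ^ (ε / 2) =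
        (∏ x, bracketSq (φ x) ^ (ε / 2)) * bracketSq (φ j - d) ^ (ε / 2) := by
    intro φ j d
    rw [← Finset.mul_prod_erase _ _ (Finset.mem_univ j),
      ← Finset.mul_prod_erase (a := j) _ (fun x => bracketSq (φ x) ^ (ε / 2)) (Finset.mem_univ j)]
    rw [Finset.prod_congr rfl (g := fun x => bracketSq (φ x) ^ (ε / 2)) fun x hx => by
      rw [if_neg (Finset.ne_of_mem_erase hx), sub_zero]]
    simp only [if_true]
    ring
  have hpos : ∀ x : ℝ, 0 < bracketSq x ^ (ε / 2) := fun x => Real.rpow_pos_of_pos (bracketSq_pos x) _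
  rw [sobolevSymbol_eq, sobolevSymbol_eq, Fintype.prod_sum_type, Fintype.prod_sum_type,
    Fin.prod_univ_castSucc, Fin.prod_univ_castSucc]
  simp only [mergeFreq_inl_castSucc, mergeFreq_inr_castSucc, mergeFreq_inl_last,
    mergeFreq_inr_last]
  unfold collisionWeight
  have h1 := hpos z.1
  have h2 := hpos z.2
  have h3 := hpos (ξ i - z.1 - z.2)
  rw [div_mul_eq_mul_div, eq_div_iff (by positivity)]
  rw [sub_sub] at h3 ⊢
  rcases i with j | j
  · simp only [Sum.inl.injEq, reduceCtorEq, if_false, sub_zero]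
    have := hprod (fun x => ξ (Sum.inl x)) j (z.1 + z.2)
    simp only at this
    linear_combination (-(bracketSq z.1 ^ (ε / 2)) * bracketSq z.2 ^ (ε / 2) *
      ∏ x, bracketSq (ξ (Sum.inr x)) ^ (ε / 2)) * this
  · simp only [Sum.inr.injEq, reduceCtorEq, if_false, sub_zero]
    have := hprod (fun x => ξ (Sum.inr x)) j (z.1 + z.2)
    simp only at this
    linear_combination (-(bracketSq z.1 ^ (ε / 2)) * bracketSq z.2 ^ (ε / 2) *
      ∏ x, bracketSq (ξ (Sum.inl x)) ^ (ε / 2)) * this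

theorem permute_apply {k : ℕ} (σ : Equiv.Perm (Fin k)) (y : KernelSpace k) (i : Fin k ⊕ Fin k) :
    permute σ y i = y (Sum.map σ σ i) := rfl

theorem exists_linearIsometryEquiv_eq_permute {k : ℕ} (σ : Equiv.Perm (Fin k)) :
    ∃ A : KernelSpace k ≃ₗᵢ[ℝ] KernelSpace k, ⇑A = permute σ := by
  refine ⟨LinearIsometryEquiv.piLpCongrLeft 2 ℝ ℝ (Equiv.sumCongr σ σ).symm, ?_⟩
  funext y
  ext i
  simp [permute, LinearIsometryEquiv.piLpCongrLeft_apply, Equiv.piCongrLeft'_apply]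

theorem measurePreserving_permute {k : ℕ} (σ : Equiv.Perm (Fin k)) :
    MeasurePreserving (permute σ) := by
  obtain ⟨A, hA⟩ := exists_linearIsometryEquiv_eq_permute σ
  exact hA ▸ LinearIsometryEquiv.measurePreserving A


/-! ### Collision operators with cutoff and the collapsing estimate -/

/-- The symbol `p(ξ_i, a, b) e^{itΩ}` of the collision operator in the interaction picture. -/
def collisionSymbol {k : ℕ} (ε : ℝ) (i : Fin k ⊕ Fin k) (t η : ℝ) (z : ℝ × ℝ) : ℂ :=
  Complex.exp ((t * resonance i η z : ℝ) * Complex.I) * (collisionWeight ε η z.1 z.2 : ℂ)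

theorem continuous_collisionSymbol {k : ℕ} (ε : ℝ) (i : Fin k ⊕ Fin k) {X : Type*}
    [TopologicalSpace X] {t η : X → ℝ} {z : X → ℝ × ℝ} (ht : Continuous t) (hη : Continuous η)
    (hz : Continuous z) : Continuous fun x => collisionSymbol ε i (t x) (η x) (z x) := by
  have h1 := continuous_resonance i hη hz
  have h2 := continuous_collisionWeight ε hη hz.fst hz.snd
  unfold collisionSymbol
  fun_prop

theorem norm_collisionSymbol {k : ℕ} (ε : ℝ) (i : Fin k ⊕ Fin k) (t η : ℝ) (z : ℝ × ℝ) :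
    ‖collisionSymbol ε i t η z‖ = collisionWeight ε η z.1 z.2 := by
  rw [collisionSymbol, norm_mul, Complex.norm_exp_ofReal_mul_I, one_mul, Complex.norm_real,
    Real.norm_of_nonneg (collisionWeight_nonneg _ _ _ _)]

theorem norm_collisionSymbol_le {k : ℕ} {ε : ℝ} (hε : 0 < ε) (i : Fin k ⊕ Fin k) (t η : ℝ)
    (z : ℝ × ℝ) : ‖collisionSymbol ε i t η z‖ ≤ Real.sqrt (weightConst ε * 2) := by
  rw [norm_collisionSymbol]
  exact Real.le_sqrt_of_sq_le (collisionWeight_sq_le_const hε _ _ _)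

theorem isSymbol_collisionSymbol {k : ℕ} {ε : ℝ} (hε : 0 < ε) (i : Fin k ⊕ Fin k) (t : ℝ) :
    IsSymbol fun p : KernelSpace k × ℝ × ℝ => collisionSymbol ε i t (p.1 i) p.2 :=
  ⟨(continuous_collisionSymbol ε i continuous_const (by fun_prop) continuous_snd).measurable,
    _, fun _ => norm_collisionSymbol_le hε i t _ _⟩

/-- `L²` functions of a frequency `ξ` and of a further pair of frequencies. -/
abbrev PairKernel (k : ℕ) : Type :=
  Lp ℂ 2 ((volume : Measure (KernelSpace k)).prod (volume : Measure (ℝ × ℝ)))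

/-- The function `(ξ, z) ↦ f (mergeFreq i ξ z)`. -/
def pullOp {k : ℕ} (i : Fin k ⊕ Fin k) : Kernel (k + 1) →L[ℂ] PairKernel k :=
  (Lp.compMeasurePreservingₗᵢ ℂ _ (measurePreserving_mergeFreq i)).toContinuousLinearMap

theorem coeFn_pullOp {k : ℕ} (i : Fin k ⊕ Fin k) (f : Kernel (k + 1)) :
    pullOp i f =ᵐ[volume.prod volume] fun p => f (mergeFreq i p.1 p.2) :=
  Lp.coeFn_compMeasurePreserving f (measurePreserving_mergeFreq i)

theorem norm_pullOp {k : ℕ} (i : Fin k ⊕ Fin k) (f : Kernel (k + 1)) : ‖pullOp i f‖ = ‖f‖ :=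
  Lp.norm_compMeasurePreserving f (measurePreserving_mergeFreq i)

attribute [irreducible] pullOp

/-- A cutoff of the frequencies of the particle that is traced out. -/
structure IsCutoff (χ : ℝ × ℝ → ℂ) : Prop where
  continuous : Continuous χ
  memLp : MemLp χ 2 volume

theorem IsCutoff.sub {χ χ' : ℝ × ℝ → ℂ} (h : IsCutoff χ) (h' : IsCutoff χ') :
    IsCutoff fun z => χ z - χ' z :=
  ⟨h.continuous.sub h'.continuous, h.memLp.sub h'.memLp⟩

variable {k : ℕ} {ε : ℝ}

/-- The collision operator with the cutoff `χ`, on the Fourier side and in the interaction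
picture. -/
def freqCollision (hε : 0 < ε) {χ : ℝ × ℝ → ℂ} (hχ : IsCutoff χ) (i : Fin k ⊕ Fin k) (t : ℝ) :
    Kernel (k + 1) →L[ℂ] Kernel k :=
  intOp χ hχ.memLp ∘L mulOp _ (isSymbol_collisionSymbol hε i t) ∘L pullOp i

theorem freqCollision_apply (hε : 0 < ε) {χ : ℝ × ℝ → ℂ} (hχ : IsCutoff χ) (i : Fin k ⊕ Fin k)
    (t : ℝ) (f : Kernel (k + 1)) : freqCollision hε hχ i t f =
      intOp χ hχ.memLp (mulOp _ (isSymbol_collisionSymbol hε i t) (pullOp i f)) := rfl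

attribute [irreducible] freqCollision

theorem coeFn_freqCollision (hε : 0 < ε) {χ : ℝ × ℝ → ℂ} (hχ : IsCutoff χ) (i : Fin k ⊕ Fin k)
    (t : ℝ) (f : Kernel (k + 1)) : freqCollision hε hχ i t f =ᵐ[volume] fun ξ =>
      ∫ z : ℝ × ℝ, χ z * (collisionSymbol ε i t (ξ i) z * f (mergeFreq i ξ z)) := by
  rw [freqCollision_apply]
  refine (coeFn_intOp hχ.memLp _).trans ?_
  filter_upwards [Measure.ae_ae_of_ae_prod (coeFn_mulOp (isSymbol_collisionSymbol hε i t)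
    (pullOp i f)), Measure.ae_ae_of_ae_prod (coeFn_pullOp i f)] with ξ h1 h2
  refine integral_congr_ae ?_
  filter_upwards [h1, h2] with z hz hz'
  rw [hz, hz']

/-- Here the composed function stays an element of `L²` on the product space, to which
`ae_memLp_slice` and Tonelli apply. -/
theorem coeFn_freqCollision' (hε : 0 < ε) {χ : ℝ × ℝ → ℂ} (hχ : IsCutoff χ) (i : Fin k ⊕ Fin k)
    (t : ℝ) (f : Kernel (k + 1)) : freqCollision hε hχ i t f =ᵐ[volume] fun ξ =>
      ∫ z : ℝ × ℝ, χ z * (collisionSymbol ε i t (ξ i) z * pullOp i f (ξ, z)) := by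
  rw [freqCollision_apply]
  refine (coeFn_intOp hχ.memLp _).trans ?_
  filter_upwards [Measure.ae_ae_of_ae_prod (coeFn_mulOp (isSymbol_collisionSymbol hε i t)
    (pullOp i f))] with ξ h1
  refine integral_congr_ae ?_
  filter_upwards [h1] with z hz
  rw [hz]

theorem norm_freqCollision_apply_le (hε : 0 < ε) {χ : ℝ × ℝ → ℂ} (hχ : IsCutoff χ)
    (i : Fin k ⊕ Fin k) (t : ℝ) (f : Kernel (k + 1)) :
    ‖freqCollision hε hχ i t f‖ ≤
      (eLpNorm χ 2 volume).toReal * Real.sqrt (weightConst ε * 2) * ‖f‖ := by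
  rw [freqCollision_apply]
  calc ‖intOp χ hχ.memLp (mulOp _ (isSymbol_collisionSymbol hε i t) (pullOp i f))‖
      ≤ (eLpNorm χ 2 volume).toReal *
        ‖mulOp _ (isSymbol_collisionSymbol hε i t) (pullOp i f)‖ :=
        ContinuousLinearMap.le_of_opNorm_le _ (norm_intOp_le hχ.memLp) _
    _ ≤ (eLpNorm χ 2 volume).toReal * (Real.sqrt (weightConst ε * 2) * ‖pullOp i f‖) := by
        gcongr
        exact norm_mulOp_apply_le _ (fun _ => norm_collisionSymbol_le hε i t _ _) _
    _ = _ := by rw [norm_pullOp, mul_assoc]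

theorem norm_freqCollision_le (hε : 0 < ε) {χ : ℝ × ℝ → ℂ} (hχ : IsCutoff χ)
    (i : Fin k ⊕ Fin k) (t : ℝ) : ‖freqCollision hε hχ i t‖ ≤
      (eLpNorm χ 2 volume).toReal * Real.sqrt (weightConst ε * 2) :=
  ContinuousLinearMap.opNorm_le_bound _ (by positivity) (norm_freqCollision_apply_le hε hχ i t)

/-- Strong continuity in `t` together with a Lipschitz bound uniform in `t`. That bound involves the
`L²` norm of the cutoff and serves qualitative purposes only. -/
theorem continuous_freqCollision (hε : 0 < ε) {χ : ℝ × ℝ → ℂ} (hχ : IsCutoff χ)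
    (i : Fin k ⊕ Fin k) :
    Continuous fun p : ℝ × Kernel (k + 1) => freqCollision hε hχ i p.1 p.2 := by
  refine continuous_prod_of_continuous_lipschitzWith' _
    (Real.toNNReal ((eLpNorm χ 2 volume).toReal * Real.sqrt (weightConst ε * 2))) (fun t => ?_)
    (fun f => ?_)
  · refine (freqCollision hε hχ i t).lipschitz.weaken ?_
    rw [← NNReal.coe_le_coe, Real.coe_toNNReal _ (by positivity), coe_nnnorm]
    exact norm_freqCollision_le hε hχ i t
  · have h : Continuous fun t => mulOp _ (isSymbol_collisionSymbol hε i t) (pullOp i f) := by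
      refine continuous_iff_continuousAt.2 fun t => ?_
      refine tendsto_mulOp (fun s => isSymbol_collisionSymbol hε i s) _
        (fun s p => norm_collisionSymbol_le hε i s _ _) (fun p => ?_) _
      exact (continuous_collisionSymbol ε i continuous_id continuous_const
        continuous_const).tendsto t
    simp only [freqCollision_apply]
    exact (intOp χ hχ.memLp).continuous.comp h

/-- The collision in `y` has slope parameter `4π²`; exchanging the two traced frequencies turns the
collision in `y'` into the case `-4π²`. One constant therefore serves all `k`, `i` and `η`. -/
theorem exists_collisionSymbol_schur (hε : 0 < ε) {T : ℝ} (hT : 0 < T) :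
    ∃ S : ℝ≥0∞, S ≠ ∞ ∧ ∀ (k : ℕ) (i : Fin k ⊕ Fin k) (η x : ℝ),
      ∫⁻ z : ℝ × ℝ, ‖(collisionWeight ε η z.1 z.2 : ℂ)‖ₑ ^ 2 *
        gaussianWeight T (x - resonance i η z) ≤ S := by
  have hGB : ∀ x, gaussianWeight T x ≤ ENNReal.ofReal (Real.exp 1 * (T * √Real.pi)) := by
    intro x
    refine ENNReal.ofReal_le_ofReal (mul_le_of_le_one_right (by positivity) ?_)
    exact Real.exp_le_one_iff.2 (by nlinarith [sq_nonneg (T * x)])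
  have hpi : (0 : ℝ) < 4 * Real.pi ^ 2 := by positivity
  obtain ⟨S₁, hS₁, h1⟩ := exists_lintegral_weight_le hε hpi.ne'
    (measurable_gaussianWeight T) (lintegral_gaussianWeight_ne_top hT) ENNReal.ofReal_ne_top hGB
  obtain ⟨S₂, hS₂, h2⟩ := exists_lintegral_weight_le hε (neg_ne_zero.2 hpi.ne')
    (measurable_gaussianWeight T) (lintegral_gaussianWeight_ne_top hT) ENNReal.ofReal_ne_top hGB
  have hw : ∀ η a b : ℝ, ‖(collisionWeight ε η a b : ℂ)‖ₑ ^ 2 =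
      ENNReal.ofReal (collisionWeight ε η a b ^ 2) := by
    intro η a b
    rw [← ofReal_norm, Complex.norm_real, Real.norm_of_nonneg (collisionWeight_nonneg _ _ _ _),
      ENNReal.ofReal_pow (collisionWeight_nonneg _ _ _ _)]
  refine ⟨max S₁ S₂, by simp [hS₁, hS₂], fun k i η x => ?_⟩
  rcases i with j | j
  · refine le_trans (le_of_eq ?_) ((h1 η x).trans (le_max_left _ _))
    refine lintegral_congr fun z => ?_
    rw [hw, resonance]
    congr 2
    ring
  · refine le_trans (le_of_eq ?_) ((h2 η x).trans (le_max_right _ _))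
    rw [Measure.volume_eq_prod, ← lintegral_prod_swap]
    refine lintegral_congr fun z => ?_
    rw [hw, resonance, Prod.fst_swap, Prod.snd_swap, collisionWeight_swap]
    congr 2
    ring

/-- The collapsing estimate. For almost every fixed `ξ` the collision is an oscillatory integral in
`z`, and Schur's test applies with the collision weight in the role of `q`. The cutoff stays with
the function, so `S` does not depend on it and differences of cutoffs are seen to be small. -/
theorem exists_lintegral_freqCollision_sq_le (hε : 0 < ε) {T : ℝ} (hT : 0 < T) :
    ∃ S : ℝ≥0∞, S ≠ ∞ ∧ ∀ (k : ℕ) (i : Fin k ⊕ Fin k) (χ : ℝ × ℝ → ℂ) (hχ : IsCutoff χ)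
      (f : Kernel (k + 1)), ∫⁻ t in Set.Icc 0 T, ‖freqCollision hε hχ i t f‖ₑ ^ 2 ≤
        S * ∫⁻ p : KernelSpace k × ℝ × ℝ, ‖χ p.2 * pullOp i f p‖ₑ ^ 2 := by
  obtain ⟨S, hS, hSb⟩ := exists_collisionSymbol_schur hε hT
  refine ⟨2 * S, by finiteness, fun k i χ hχ f => ?_⟩
  set F : KernelSpace k × ℝ × ℝ → ℂ := ⇑(pullOp i f) with hFdef
  have hF : StronglyMeasurable F := Lp.stronglyMeasurable _
  have hjoint : Measurable fun p : ℝ × KernelSpace k => ∫ z : ℝ × ℝ,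
      χ z * (collisionSymbol ε i p.1 (p.2 i) z * F (p.2, z)) := by
    refine (StronglyMeasurable.integral_prod_right' (f := fun q : (ℝ × KernelSpace k) × ℝ × ℝ =>
      χ q.2 * (collisionSymbol ε i q.1.1 (q.1.2 i) q.2 * F (q.1.2, q.2))) ?_).measurable
    have h1 : Continuous fun q : (ℝ × KernelSpace k) × ℝ × ℝ =>
        collisionSymbol ε i q.1.1 (q.1.2 i) q.2 :=
      continuous_collisionSymbol ε i (by fun_prop) (by fun_prop) continuous_snd
    have h2 : Continuous fun q : (ℝ × KernelSpace k) × ℝ × ℝ => χ q.2 :=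
      hχ.continuous.comp continuous_snd
    exact h2.stronglyMeasurable.mul (h1.stronglyMeasurable.mul
      (hF.comp_measurable (by fun_prop)))
  calc ∫⁻ t in Set.Icc 0 T, ‖freqCollision hε hχ i t f‖ₑ ^ 2
      = ∫⁻ t in Set.Icc 0 T, ∫⁻ ξ : KernelSpace k, ‖∫ z : ℝ × ℝ,
          χ z * (collisionSymbol ε i t (ξ i) z * F (ξ, z))‖ₑ ^ 2 := by
        refine lintegral_congr fun t => ?_
        rw [enorm_sq_eq_lintegral]
        refine lintegral_congr_ae ?_
        filter_upwards [coeFn_freqCollision' hε hχ i t f] with ξ hξ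
        rw [hξ]
    _ = ∫⁻ ξ : KernelSpace k, ∫⁻ t in Set.Icc 0 T, ‖∫ z : ℝ × ℝ,
          χ z * (collisionSymbol ε i t (ξ i) z * F (ξ, z))‖ₑ ^ 2 := by
        rw [lintegral_lintegral_swap]
        exact (hjoint.enorm.pow_const 2).aemeasurable
    _ ≤ ∫⁻ ξ : KernelSpace k, 2 * S * ∫⁻ z : ℝ × ℝ, ‖χ z * F (ξ, z)‖ₑ ^ 2 := by
        refine lintegral_mono_ae ?_
        filter_upwards [ae_memLp_slice (pullOp i f)] with ξ hξ
        have hint : Integrable (fun z : ℝ × ℝ => (collisionWeight ε (ξ i) z.1 z.2 : ℂ) *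
            (χ z * F (ξ, z))) := by
          refine Integrable.bdd_mul (c := Real.sqrt (weightConst ε * 2))
            (hχ.memLp.integrable_mul hξ) ?_ (Eventually.of_forall fun z => ?_)
          · exact (Complex.continuous_ofReal.comp (continuous_collisionWeight ε continuous_const
              continuous_fst continuous_snd)).aestronglyMeasurable
          · rw [Complex.norm_real, Real.norm_of_nonneg (collisionWeight_nonneg _ _ _ _), ← norm_collisionSymbol ε i 0]
            exact norm_collisionSymbol_le hε i 0 _ _
        refine le_trans (le_of_eq ?_) (lintegral_sq_oscillatory_le_of_schur hT
          (Ω := fun z => resonance i (ξ i) z) (S := S)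
          (continuous_resonance i continuous_const continuous_id).measurable
          (Complex.continuous_ofReal.comp (continuous_collisionWeight ε continuous_const
              continuous_fst continuous_snd)).measurable
          (hχ.continuous.aestronglyMeasurable.mul hξ.1).aemeasurable hint (hSb k i (ξ i)))
        refine lintegral_congr fun t => ?_
        congr 2
        refine integral_congr_ae (Eventually.of_forall fun z => ?_)
        simp only [collisionSymbol, Function.comp_apply, Pi.mul_apply, hFdef]
        ring
    _ = _ := by
        have hm : Measurable fun p : KernelSpace k × ℝ × ℝ => ‖χ p.2 * F p‖ₑ ^ 2 :=
          (((hχ.continuous.comp continuous_snd).measurable.mul hF.measurable).enorm.pow_const 2)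
        rw [lintegral_const_mul _ hm.lintegral_prod_right']
        congr 1
        exact (lintegral_prod _ hm.aemeasurable).symm

theorem lintegral_le_sqrt_measure_mul {s : Set ℝ} {g : ℝ → ℝ≥0∞}
    (hg : AEMeasurable g (volume.restrict s)) :
    ∫⁻ t in s, g t ≤ volume s ^ (1 / 2 : ℝ) * (∫⁻ t in s, g t ^ 2) ^ (1 / 2 : ℝ) := by
  have h := ENNReal.lintegral_mul_le_Lp_mul_Lq (volume.restrict s) Real.HolderConjugate.two_two
    (f := fun _ => 1) (g := g) aemeasurable_const hg
  simpa using h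


/-! ### Relabelling and commutation of collisions -/

/-- The action of a permutation of the particles on kernels. -/
def permOp (σ : Equiv.Perm (Fin k)) : Kernel k →L[ℂ] Kernel k :=
  (Lp.compMeasurePreservingₗᵢ ℂ _ (measurePreserving_permute σ)).toContinuousLinearMap

theorem coeFn_permOp (σ : Equiv.Perm (Fin k)) (f : Kernel k) :
    permOp σ f =ᵐ[volume] fun ξ => f (permute σ ξ) :=
  Lp.coeFn_compMeasurePreserving f (measurePreserving_permute σ)

attribute [irreducible] permOp

theorem ae_mergeFreq (i : Fin k ⊕ Fin k) {P : KernelSpace (k + 1) → Prop}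
    (hP : ∀ᵐ ζ, P ζ) : ∀ᵐ ξ : KernelSpace k, ∀ᵐ z : ℝ × ℝ, P (mergeFreq i ξ z) :=
  Measure.ae_ae_of_ae_prod ((measurePreserving_mergeFreq i).quasiMeasurePreserving.ae hP)

theorem permute_mergeFreq {σ : Equiv.Perm (Fin k)} {σ' : Equiv.Perm (Fin (k + 1))}
    (h : ∀ j, σ' j.castSucc = (σ j).castSucc) (hlast : σ' (Fin.last k) = Fin.last k)
    (i : Fin k ⊕ Fin k) (ξ : KernelSpace k) (z : ℝ × ℝ) :
    permute σ' (mergeFreq (Sum.map σ σ i) ξ z) = mergeFreq i (permute σ ξ) z := by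
  refine kernelSpace_succ_ext (fun j => ?_) ?_ (fun j => ?_) ?_
  · rw [permute_apply, Sum.map_inl, h, mergeFreq_inl_castSucc, mergeFreq_inl_castSucc,
      permute_apply]
    rcases i with i | i <;> simp
  · rw [permute_apply, Sum.map_inl, hlast, mergeFreq_inl_last, mergeFreq_inl_last]
  · rw [permute_apply, Sum.map_inr, h, mergeFreq_inr_castSucc, mergeFreq_inr_castSucc,
      permute_apply]
    rcases i with i | i <;> simp
  · rw [permute_apply, Sum.map_inr, hlast, mergeFreq_inr_last, mergeFreq_inr_last]

theorem collisionSymbol_map {l : ℕ} (φ : Fin k → Fin l) (i : Fin k ⊕ Fin k) (t η : ℝ)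
    (z : ℝ × ℝ) :
    collisionSymbol ε (Sum.map φ φ i) t η z = collisionSymbol ε i t η z := by
  rcases i with i | i <;> rfl

theorem permOp_freqCollision (hε : 0 < ε) {χ : ℝ × ℝ → ℂ} (hχ : IsCutoff χ)
    {σ : Equiv.Perm (Fin k)} {σ' : Equiv.Perm (Fin (k + 1))}
    (h : ∀ j, σ' j.castSucc = (σ j).castSucc) (hlast : σ' (Fin.last k) = Fin.last k)
    (i : Fin k ⊕ Fin k) (t : ℝ) (f : Kernel (k + 1)) :
    permOp σ (freqCollision hε hχ i t f) =
      freqCollision hε hχ (Sum.map σ σ i) t (permOp σ' f) := by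
  refine Lp.ext ?_
  filter_upwards [coeFn_permOp σ (freqCollision hε hχ i t f),
    (measurePreserving_permute σ).quasiMeasurePreserving.ae (coeFn_freqCollision hε hχ i t f),
    coeFn_freqCollision hε hχ (Sum.map σ σ i) t (permOp σ' f),
    ae_mergeFreq (Sum.map σ σ i) (coeFn_permOp σ' f)] with ξ h1 h2 h3 h4
  rw [h1, h2, h3]
  refine integral_congr_ae ?_
  filter_upwards [h4] with z hz
  rw [hz, permute_mergeFreq h hlast, collisionSymbol_map, permute_apply]

/-- Lowering the frequencies at `i` and at `j` can be done in either order; the results differ only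
in which of the two appended particles comes first. -/
theorem mergeFreq_mergeFreq {i j : Fin k ⊕ Fin k} (ξ : KernelSpace k)
    (z z' : ℝ × ℝ) :
    mergeFreq (Sum.map Fin.castSucc Fin.castSucc j) (mergeFreq i ξ z) z' =
      permute (Equiv.swap (Fin.last k).castSucc (Fin.last (k + 1)))
        (mergeFreq (Sum.map Fin.castSucc Fin.castSucc i) (mergeFreq j ξ z') z) := by
  have hne : ∀ l : Fin k, l.castSucc ≠ Fin.last k := fun l => (Fin.castSucc_lt_last l).ne
  have hne' : ∀ l : Fin k, l.castSucc.castSucc ≠ Fin.last (k + 1) :=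
    fun l => (Fin.castSucc_lt_last _).ne
  have hsw : ∀ l : Fin k, Equiv.swap (Fin.last k).castSucc (Fin.last (k + 1)) l.castSucc.castSucc =
      l.castSucc.castSucc := fun l => Equiv.swap_apply_of_ne_of_ne
    (fun h => hne l (Fin.castSucc_injective _ h)) (hne' l)
  refine kernelSpace_succ_ext (fun l => ?_) ?_ (fun l => ?_) ?_
  · refine Fin.lastCases ?_ (fun l => ?_) l
    · rw [permute_apply, Sum.map_inl, Equiv.swap_apply_left, mergeFreq_inl_last,
        mergeFreq_inl_castSucc, mergeFreq_inl_last]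
      rcases j with j | j <;> simp [(hne _).symm]
    · rw [permute_apply, Sum.map_inl, hsw]
      simp only [mergeFreq_inl_castSucc]
      rcases i with i | i <;> rcases j with j | j <;> simp [sub_right_comm]
  · rw [permute_apply, Sum.map_inl, Equiv.swap_apply_right, mergeFreq_inl_last,
        mergeFreq_inl_castSucc, mergeFreq_inl_last]
    rcases i with j | j <;> simp [(hne _).symm]
  · refine Fin.lastCases ?_ (fun l => ?_) l
    · rw [permute_apply, Sum.map_inr, Equiv.swap_apply_left, mergeFreq_inr_last,
        mergeFreq_inr_castSucc, mergeFreq_inr_last]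
      rcases j with j | j <;> simp [(hne _).symm]
    · rw [permute_apply, Sum.map_inr, hsw]
      simp only [mergeFreq_inr_castSucc]
      rcases i with i | i <;> rcases j with j | j <;> simp [sub_right_comm]
  · rw [permute_apply, Sum.map_inr, Equiv.swap_apply_right, mergeFreq_inr_last,
        mergeFreq_inr_castSucc, mergeFreq_inr_last]
    rcases i with j | j <;> simp [(hne _).symm]

theorem mergeFreq_map_castSucc {i j : Fin k ⊕ Fin k} (hij : i ≠ j) (ξ : KernelSpace k)
    (z : ℝ × ℝ) : mergeFreq i ξ z (Sum.map Fin.castSucc Fin.castSucc j) = ξ j := by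
  rcases j with j | j
  · rw [Sum.map_inl, mergeFreq_inl_castSucc, if_neg hij.symm, sub_zero]
  · rw [Sum.map_inr, mergeFreq_inr_castSucc, if_neg hij.symm, sub_zero]

theorem coeFn_freqCollision_freqCollision (hε : 0 < ε) {χ : ℝ × ℝ → ℂ} (hχ : IsCutoff χ)
    {i j : Fin k ⊕ Fin k} (hij : i ≠ j) (t t' : ℝ) (f : Kernel (k + 2)) :
    freqCollision hε hχ i t (freqCollision hε hχ (Sum.map Fin.castSucc Fin.castSucc j) t' f)
      =ᵐ[volume] fun ξ => ∫ z : ℝ × ℝ, ∫ z' : ℝ × ℝ,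
        χ z * (χ z' * (collisionSymbol ε i t (ξ i) z * (collisionSymbol ε j t' (ξ j) z' *
          f (mergeFreq (Sum.map Fin.castSucc Fin.castSucc j) (mergeFreq i ξ z) z')))) := by
  filter_upwards [coeFn_freqCollision hε hχ i t
    (freqCollision hε hχ (Sum.map Fin.castSucc Fin.castSucc j) t' f),
    ae_mergeFreq i (coeFn_freqCollision hε hχ (Sum.map Fin.castSucc Fin.castSucc j) t' f)]
    with ξ h1 h2
  rw [h1]
  refine integral_congr_ae ?_
  filter_upwards [h2] with z hz
  rw [hz, ← integral_const_mul, ← integral_const_mul]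
  refine integral_congr_ae (Eventually.of_forall fun z' => ?_)
  simp only [mergeFreq_map_castSucc hij, collisionSymbol_map]
  ring

/-- For `i ≠ j` the symbol of either collision involves a frequency that the other leaves alone.
Both compositions are then the same integral over `(z, z')`, in the two orders of integration. -/
theorem freqCollision_comm (hε : 0 < ε) {χ : ℝ × ℝ → ℂ} (hχ : IsCutoff χ)
    {i j : Fin k ⊕ Fin k} (hij : i ≠ j) (t t' : ℝ) (f : Kernel (k + 2)) :
    freqCollision hε hχ i t (freqCollision hε hχ (Sum.map Fin.castSucc Fin.castSucc j) t' f) =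
      freqCollision hε hχ j t' (freqCollision hε hχ (Sum.map Fin.castSucc Fin.castSucc i) t
        (permOp (Equiv.swap (Fin.last k).castSucc (Fin.last (k + 1))) f)) := by
  set i' := Sum.map Fin.castSucc Fin.castSucc i
  set j' := Sum.map Fin.castSucc Fin.castSucc j
  set σ := Equiv.swap (Fin.last k).castSucc (Fin.last (k + 1))
  have hmp : MeasurePreserving (fun p : KernelSpace k × (ℝ × ℝ) × ℝ × ℝ =>
      mergeFreq j' (mergeFreq i p.1 p.2.1) p.2.2) (volume.prod (volume.prod volume)) volume :=
    (measurePreserving_mergeFreq j').comp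
      (((measurePreserving_mergeFreq i).prod (MeasurePreserving.id volume)).comp
        (measurePreserving_prodAssoc volume volume volume).symm)
  refine Lp.ext ?_
  filter_upwards [coeFn_freqCollision_freqCollision hε hχ hij t t' f,
    coeFn_freqCollision_freqCollision hε hχ hij.symm t' t (permOp σ f),
    ae_memLp_slice (Lp.compMeasurePreserving _ hmp f),
    Measure.ae_ae_of_ae_prod (Lp.coeFn_compMeasurePreserving f hmp),
    ae_mergeFreq j (ae_mergeFreq i' (coeFn_permOp σ f))] with ξ h1 h2 h3 h4 h5
  rw [h1, h2, integral_integral_swap]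
  · refine integral_congr_ae ?_
    filter_upwards [h5] with z' hz'
    refine integral_congr_ae ?_
    filter_upwards [hz'] with z hz
    rw [hz, mergeFreq_mergeFreq]
    ring
  -- Absolute convergence for Fubini: the tensor square of the cutoff and almost every slice of `f`
  -- are in `L²`, and the symbols are bounded.
  · have hχ2 : MemLp (fun q : (ℝ × ℝ) × ℝ × ℝ => χ q.1 * χ q.2) 2 (volume.prod volume) := by
      refine (memLp_two_iff_integrable_sq_norm ?_).2 ?_
      · exact hχ.memLp.1.comp_fst.mul hχ.memLp.1.comp_snd
      · simp only [norm_mul, mul_pow]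
        have := (memLp_two_iff_integrable_sq_norm hχ.memLp.1).1 hχ.memLp
        exact this.mul_prod this
    have hint := hχ2.integrable_mul (h3.ae_eq h4)
    have hb := hint.bdd_mul (c := √(weightConst ε * 2) * √(weightConst ε * 2))
      (f := fun q : (ℝ × ℝ) × ℝ × ℝ => collisionSymbol ε i t (ξ i) q.1 *
        collisionSymbol ε j t' (ξ j) q.2)
      ((continuous_collisionSymbol ε i continuous_const continuous_const continuous_fst).mul
        (continuous_collisionSymbol ε j continuous_const continuous_const
          continuous_snd)).aestronglyMeasurable
      (Eventually.of_forall fun q => by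
        rw [norm_mul]
        exact mul_le_mul (norm_collisionSymbol_le hε _ _ _ _) (norm_collisionSymbol_le hε _ _ _ _)
          (norm_nonneg _) (Real.sqrt_nonneg _))
    refine hb.congr (Eventually.of_forall fun q => ?_)
    simp only [Function.uncurry, Pi.mul_apply, Function.comp_apply]
    ring

/-- The collision operators of the hierarchy with the cutoff `χ`, on the Fourier side and in the
interaction picture, with the time dependent coupling `g`. -/
def collisionFamily (hε : 0 < ε) {χ : ℝ × ℝ → ℂ} (hχ : IsCutoff χ) {g : ℝ → ℂ}
    (hg : Continuous g) : CollisionFamily Kernel where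
  b k j t := (g t • (freqCollision hε hχ (Sum.inl j) t -
    freqCollision hε hχ (Sum.inr j) t)).restrictScalars ℝ
  act k σ := (permOp σ).restrictScalars ℝ
  continuous_b k j := by
    have h1 := continuous_freqCollision hε hχ (Sum.inl j)
    have h2 := continuous_freqCollision hε hχ (Sum.inr j)
    exact (hg.comp continuous_fst).smul (h1.sub h2)
  equivariant k σ σ' h hlast j t f := by
    simp only [ContinuousLinearMap.coe_restrictScalars', smul_apply,
      sub_apply, map_smul, map_sub, permOp_freqCollision hε hχ h hlast,
      Sum.map_inl, Sum.map_inr]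
  comm k i j hij r r' f := by
    have h : ∀ {a b : Fin k ⊕ Fin k}, a ≠ b → _ := fun {a b} hab =>
      freqCollision_comm hε hχ hab r r' f
    have h1 := h (a := Sum.inl i) (b := Sum.inl j) (by simpa using hij)
    have h2 := h (a := Sum.inl i) (b := Sum.inr j) (by simp)
    have h3 := h (a := Sum.inr i) (b := Sum.inl j) (by simp)
    have h4 := h (a := Sum.inr i) (b := Sum.inr j) (by simpa using hij)
    simp only [Sum.map_inl, Sum.map_inr] at h1 h2 h3 h4
    simp only [ContinuousLinearMap.coe_restrictScalars', smul_apply,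
      sub_apply, map_smul, map_sub, h1, h2, h3, h4]
    module

theorem collisionFamily_b_apply (hε : 0 < ε) {χ : ℝ × ℝ → ℂ} (hχ : IsCutoff χ) {g : ℝ → ℂ}
    (hg : Continuous g) (j : Fin k) (t : ℝ) (f : Kernel (k + 1)) :
    (collisionFamily hε hχ hg).b k j t f = g t • (freqCollision hε hχ (Sum.inl j) t f -
      freqCollision hε hχ (Sum.inr j) t f) := rfl

theorem collisionFamily_act_apply (hε : 0 < ε) {χ : ℝ × ℝ → ℂ} (hχ : IsCutoff χ) {g : ℝ → ℂ}
    (hg : Continuous g) (σ : Equiv.Perm (Fin k)) (f : Kernel k) :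
    (collisionFamily hε hχ hg).act k σ f = permOp σ f := rfl


/-! ### The mollified collision term on the Fourier side -/

variable {k : ℕ}

/-- The point `(y; y')`, where the argument is `(y, z; y', z')`. -/
def dropVar (ζ : KernelSpace (k + 1)) : KernelSpace k :=
  WithLp.toLp 2 fun i => ζ (Sum.map Fin.castSucc Fin.castSucc i)

theorem dropVar_appendVar (y : KernelSpace k) (z z' : ℝ) : dropVar (appendVar y z z') = y := by
  ext i
  rcases i with i | i
  · exact appendVar_inl_castSucc y z z' i
  · exact appendVar_inr_castSucc y z z' i

theorem appendVar_dropVar (ζ : KernelSpace (k + 1)) :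
    appendVar (dropVar ζ) (ζ (Sum.inl (Fin.last k))) (ζ (Sum.inr (Fin.last k))) = ζ :=
  kernelSpace_succ_ext (fun _ => appendVar_inl_castSucc _ _ _ _) (appendVar_inl_last _ _ _)
    (fun _ => appendVar_inr_castSucc _ _ _ _) (appendVar_inr_last _ _ _)

theorem contDiff_dropVar : ContDiff ℝ (⊤ : ℕ∞) (dropVar (k := k)) := by
  refine (contDiff_piLp 2).2 fun i => ?_
  exact contDiff_piLp_apply 2 (i := Sum.map Fin.castSucc Fin.castSucc i)

theorem IsMollifier.contDiff_rescale {ρ : ℝ → ℝ} (hρ : IsMollifier ρ) (α : ℝ) :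
    ContDiff ℝ (⊤ : ℕ∞) (rescale ρ α) :=
  contDiff_const.mul (hρ.smooth.comp (contDiff_id.div_const α))

theorem IsMollifier.hasCompactSupport_rescale {ρ : ℝ → ℝ} (hρ : IsMollifier ρ) {α : ℝ}
    (hα : 0 < α) : HasCompactSupport (rescale ρ α) := by
  have := (hρ.compactSupport.comp_homeomorph (Homeomorph.mulRight₀ α⁻¹ (inv_ne_zero hα.ne')))
  exact this.mul_left

/-- The test function `ψ(y) ρ_α(y_i - z) ρ_α(y_i - z')` of `(y, z; y', z')`. -/
def mollifiedTest (ρ : ℝ → ℝ) (α : ℝ) (i : Fin k ⊕ Fin k) (ψ : KernelSpace k → ℂ)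
    (ζ : KernelSpace (k + 1)) : ℂ :=
  ψ (dropVar ζ) * (rescale ρ α (dropVar ζ i - ζ (Sum.inl (Fin.last k))) *
    rescale ρ α (dropVar ζ i - ζ (Sum.inr (Fin.last k))) : ℝ)

theorem mollifiedTest_appendVar (ρ : ℝ → ℝ) (α : ℝ) (i : Fin k ⊕ Fin k) (ψ : KernelSpace k → ℂ)
    (y : KernelSpace k) (z z' : ℝ) : mollifiedTest ρ α i ψ (appendVar y z z') =
      ψ y * (rescale ρ α (y i - z) * rescale ρ α (y i - z') : ℝ) := by
  rw [mollifiedTest, dropVar_appendVar, appendVar_inl_last, appendVar_inr_last]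

theorem contDiff_mollifiedTest {ρ : ℝ → ℝ} (hρ : IsMollifier ρ) (α : ℝ) (i : Fin k ⊕ Fin k)
    {ψ : KernelSpace k → ℂ} (hψ : ContDiff ℝ (⊤ : ℕ∞) ψ) :
    ContDiff ℝ (⊤ : ℕ∞) (mollifiedTest ρ α i ψ) := by
  have h1 : ContDiff ℝ (⊤ : ℕ∞) fun ζ : KernelSpace (k + 1) => dropVar ζ i :=
    contDiff_piLp_apply 2 (i := Sum.map Fin.castSucc Fin.castSucc i)
  have h2 : ∀ l, ContDiff ℝ (⊤ : ℕ∞) fun ζ : KernelSpace (k + 1) => ζ l :=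
    fun l => contDiff_piLp_apply 2 (i := l)
  refine (hψ.comp contDiff_dropVar).mul (Complex.ofRealCLM.contDiff.comp ?_)
  exact ((hρ.contDiff_rescale α).comp (h1.sub (h2 _))).mul
    ((hρ.contDiff_rescale α).comp (h1.sub (h2 _)))

theorem hasCompactSupport_mollifiedTest {ρ : ℝ → ℝ} (hρ : IsMollifier ρ) {α : ℝ} (hα : 0 < α)
    (i : Fin k ⊕ Fin k) {ψ : KernelSpace k → ℂ} (hψ : HasCompactSupport ψ) :
    HasCompactSupport (mollifiedTest ρ α i ψ) := by
  have hc := hρ.hasCompactSupport_rescale hα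
  set Φ : KernelSpace k × ℝ × ℝ → KernelSpace (k + 1) :=
    fun p => appendVar p.1 (p.1 i - p.2.1) (p.1 i - p.2.2) with hΦ
  have hΦc : Continuous Φ := continuous_appendVar continuous_fst (by fun_prop) (by fun_prop)
  refine HasCompactSupport.intro ((hψ.prod (hc.prod hc)).image hΦc) fun ζ hζ => ?_
  by_contra hne
  rw [mollifiedTest, ← ne_eq, mul_ne_zero_iff, Complex.ofReal_ne_zero, mul_ne_zero_iff] at hne
  refine hζ ⟨(dropVar ζ, dropVar ζ i - ζ (Sum.inl (Fin.last k)),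
    dropVar ζ i - ζ (Sum.inr (Fin.last k))), ⟨subset_tsupport _ hne.1, subset_tsupport _ hne.2.1,
      subset_tsupport _ hne.2.2⟩, ?_⟩
  simp only [hΦ, sub_sub_cancel]
  exact appendVar_dropVar ζ

theorem integrable_integral_of_measurePreserving {X Y Z : Type*} [MeasurableSpace X]
    [MeasurableSpace Y] [MeasurableSpace Z] {μ : Measure X} {ν : Measure Y} {lam : Measure Z}
    [SFinite μ] [SFinite ν] {Φ : X × Y → Z} (hΦ : MeasurePreserving Φ (μ.prod ν) lam) {f : Z → ℂ}
    (hf : Integrable f lam) :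
    Integrable (fun x => ∫ y, f (Φ (x, y)) ∂ν) μ ∧
      ∫ ζ, f ζ ∂lam = ∫ x, ∫ y, f (Φ (x, y)) ∂ν ∂μ := by
  have hc := hΦ.integrable_comp_of_integrable hf
  refine ⟨hc.integral_prod_left, ?_⟩
  rw [← hΦ.map_eq, integral_map hΦ.measurable.aemeasurable
    (hΦ.map_eq.symm ▸ hf.aestronglyMeasurable)]
  exact integral_prod _ hc

/-- Lowering the `i`-th frequency by `a + b` makes the phase depend on `z` only through `y_i - z`
and `y_i - z'`, the arguments of the mollifiers. -/
theorem inner_appendVar_mergeFreq (i : Fin k ⊕ Fin k) (y ξ : KernelSpace k) (z w : ℝ × ℝ) :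
    inner ℝ (appendVar y z.1 z.2) (mergeFreq i ξ w) =
      inner ℝ y ξ - (y i - z.1) * w.1 - (y i - z.2) * w.2 := by
  have h : inner ℝ (appendVar y z.1 z.2) (mergeFreq i ξ w) =
      inner ℝ y (ξ - EuclideanSpace.single i (w.1 + w.2)) + z.1 * w.1 + z.2 * w.2 := by
    simp only [PiLp.inner_apply, Fintype.sum_sum_type, Fin.sum_univ_castSucc, mergeFreq,
      appendVar_inl_castSucc, appendVar_inr_castSucc, appendVar_inl_last, appendVar_inr_last,
      RCLike.inner_apply, conj_trivial]
    ring
  rw [h, inner_sub_right, EuclideanSpace.inner_single_right]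
  simp
  ring

/-- The Fourier transform of a real function on the line. -/
def fourierReal (ρ : ℝ → ℝ) : ℝ → ℂ := 𝓕 fun x => (ρ x : ℂ)

theorem integral_fourierChar_rescale (ρ : ℝ → ℝ) {α : ℝ} (hα : 0 < α) (a : ℝ) :
    ∫ s, (Real.fourierChar (s * a) : ℂ) * (rescale ρ α s : ℂ) =
      (starRingEnd ℂ) (fourierReal ρ (α * a)) := by
  have h := Measure.integral_comp_div
    (fun x => (Real.fourierChar (α * x * a) : ℂ) * ((ρ x : ℝ) : ℂ)) α
  rw [fourierReal, Real.fourier_eq, ← integral_conj]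
  have h2 : ∫ s, (Real.fourierChar (s * a) : ℂ) * (rescale ρ α s : ℂ) =
      (α : ℂ)⁻¹ * ∫ x, (Real.fourierChar (α * (x / α) * a) : ℂ) * ((ρ (x / α) : ℝ) : ℂ) := by
    rw [← integral_const_mul]
    refine integral_congr_ae (Eventually.of_forall fun s => ?_)
    simp only [rescale, mul_div_cancel₀ s hα.ne']
    push_cast
    ring
  rw [h2, h, abs_of_pos hα, Complex.real_smul, inv_mul_cancel_left₀ (by simpa using hα.ne')]
  refine integral_congr_ae (Eventually.of_forall fun x => ?_)
  simp only [Circle.smul_def, smul_eq_mul, map_mul, Complex.conj_ofReal, ← Circle.coe_inv_eq_conj]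
  rw [← AddChar.map_neg_eq_inv, neg_neg]
  congr 3
  simp
  ring

/-- By `inner_appendVar_mergeFreq` the integrand factorizes after the substitution `s = y_i - z`;
the sign of `s` in the phase produces the complex conjugate. -/
theorem fourier_mollifiedTest {ρ : ℝ → ℝ} (hρ : IsMollifier ρ) {α : ℝ} (hα : 0 < α)
    (i : Fin k ⊕ Fin k) {ψ : KernelSpace k → ℂ} (hψ : ContDiff ℝ (⊤ : ℕ∞) ψ)
    (hψc : HasCompactSupport ψ) (ξ : KernelSpace k) (w : ℝ × ℝ) : 𝓕 (mollifiedTest ρ α i ψ) (mergeFreq i ξ w) =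
      𝓕 ψ ξ * (starRingEnd ℂ) (fourierReal ρ (α * w.1) * fourierReal ρ (α * w.2)) := by
  have hc := (hasCompactSupport_mollifiedTest hρ hα i hψc)
  have hint : Integrable (fun v => Real.fourierChar (-(inner ℝ v (mergeFreq i ξ w))) •
      mollifiedTest ρ α i ψ v) :=
    (Real.fourierIntegral_convergent_iff _).2
      ((contDiff_mollifiedTest hρ α i hψ).continuous.integrable_of_hasCompactSupport hc)
  rw [Real.fourier_eq,
    (integrable_integral_of_measurePreserving (measurePreserving_appendVar k) hint).2,
    Real.fourier_eq, ← integral_mul_const]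
  refine integral_congr_ae (Eventually.of_forall fun y => ?_)
  simp only [inner_appendVar_mergeFreq, mollifiedTest_appendVar]
  have h1 : ∀ z : ℝ × ℝ, Real.fourierChar (-(inner ℝ y ξ - (y i - z.1) * w.1 -
      (y i - z.2) * w.2)) • (ψ y * ((rescale ρ α (y i - z.1) * rescale ρ α (y i - z.2) : ℝ) : ℂ)) =
      Real.fourierChar (-(inner ℝ y ξ)) • ψ y *
        (((Real.fourierChar ((y i - z.1) * w.1) : ℂ) * (rescale ρ α (y i - z.1) : ℂ)) *
          ((Real.fourierChar ((y i - z.2) * w.2) : ℂ) * (rescale ρ α (y i - z.2) : ℂ))) := by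
    intro z
    have : -(inner ℝ y ξ - (y i - z.1) * w.1 - (y i - z.2) * w.2) =
      -(inner ℝ y ξ) + (y i - z.1) * w.1 + (y i - z.2) * w.2 := by ring
    rw [this, AddChar.map_add_eq_mul, AddChar.map_add_eq_mul]
    simp only [Circle.smul_def, Circle.coe_mul, smul_eq_mul]
    push_cast
    ring
  simp only [h1]
  rw [integral_const_mul, integral_prod_mul
    (fun z => (Real.fourierChar ((y i - z) * w.1) : ℂ) * (rescale ρ α (y i - z) : ℂ))
    (fun z => (Real.fourierChar ((y i - z) * w.2) : ℂ) * (rescale ρ α (y i - z) : ℂ)),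
    integral_sub_left_eq_self (fun s => (Real.fourierChar (s * w.1) : ℂ) * (rescale ρ α s : ℂ)),
    integral_sub_left_eq_self (fun s => (Real.fourierChar (s * w.2) : ℂ) * (rescale ρ α s : ℂ)),
    integral_fourierChar_rescale ρ hα, integral_fourierChar_rescale ρ hα, map_mul]

/-- The cutoff that the mollifier produces on the Fourier side. -/
def mollifierCutoff (ρ : ℝ → ℝ) (α : ℝ) (z : ℝ × ℝ) : ℂ :=
  fourierReal ρ (α * z.1) * fourierReal ρ (α * z.2)

theorem IsMollifier.exists_schwartz {ρ : ℝ → ℝ} (hρ : IsMollifier ρ) :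
    ∃ Φ : SchwartzMap ℝ ℂ, (Φ : ℝ → ℂ) = fourierReal ρ := by
  have h1 : HasCompactSupport fun x => (ρ x : ℂ) :=
    hρ.compactSupport.comp_left (g := ((↑) : ℝ → ℂ)) Complex.ofReal_zero
  have h2 : ContDiff ℝ (⊤ : ℕ∞) fun x => (ρ x : ℂ) := Complex.ofRealCLM.contDiff.comp hρ.smooth
  exact ⟨𝓕 (h1.toSchwartzMap h2), SchwartzMap.fourier_coe _⟩

theorem IsMollifier.isCutoff {ρ : ℝ → ℝ} (hρ : IsMollifier ρ) {α : ℝ} (hα : 0 < α) :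
    IsCutoff (mollifierCutoff ρ α) := by
  obtain ⟨Φ, hΦ⟩ := hρ.exists_schwartz
  have hc : Continuous fun x => fourierReal ρ (α * x) := by
    rw [← hΦ]
    exact Φ.continuous.comp (by fun_prop)
  have hi : Integrable fun x => ‖fourierReal ρ (α * x)‖ ^ 2 := by
    have h := (memLp_two_iff_integrable_sq_norm Φ.continuous.aestronglyMeasurable).1
      (Φ.memLp 2 volume)
    rw [hΦ] at h
    exact h.comp_mul_left' hα.ne'
  refine ⟨(hc.comp continuous_fst).mul (hc.comp continuous_snd),
    (memLp_two_iff_integrable_sq_norm ?_).2 ?_⟩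
  · exact ((hc.comp continuous_fst).mul (hc.comp continuous_snd)).aestronglyMeasurable
  · simp only [mollifierCutoff, norm_mul, mul_pow]
    exact hi.mul_prod hi

theorem IsMollifier.norm_mollifierCutoff_le {ρ : ℝ → ℝ} (hρ : IsMollifier ρ) (α : ℝ) (z : ℝ × ℝ) :
    ‖mollifierCutoff ρ α z‖ ≤ 1 := by
  have h : ∀ x, ‖fourierReal ρ x‖ ≤ 1 := by
    intro x
    refine (VectorFourier.norm_fourierIntegral_le_integral_norm _ _ _ _ _).trans (le_of_eq ?_)
    rw [← hρ.integral_eq_one]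
    refine integral_congr_ae (Eventually.of_forall fun x => ?_)
    simp [abs_of_nonneg (hρ.nonneg x)]
  rw [mollifierCutoff, norm_mul]
  exact mul_le_one₀ (h _) (norm_nonneg _) (h _)

theorem IsMollifier.tendsto_mollifierCutoff {ρ : ℝ → ℝ} (hρ : IsMollifier ρ) (z : ℝ × ℝ) :
    Tendsto (fun α => mollifierCutoff ρ α z) (𝓝 0) (𝓝 1) := by
  obtain ⟨Φ, hΦ⟩ := hρ.exists_schwartz
  have h0 : fourierReal ρ 0 = 1 := by
    rw [fourierReal, Real.fourier_eq]
    simp [integral_complex_ofReal, hρ.integral_eq_one]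
  have h : ∀ x, Tendsto (fun α => fourierReal ρ (α * x)) (𝓝 0) (𝓝 1) := by
    intro x
    have hc : Continuous fun α => fourierReal ρ (α * x) := by
      rw [← hΦ]
      exact Φ.continuous.comp (by fun_prop)
    simpa [h0] using hc.tendsto 0
  simpa [mollifierCutoff] using (h z.1).mul (h z.2)

theorem exists_isMollifier : ∃ ρ : ℝ → ℝ, IsMollifier ρ := by
  let f : ContDiffBump (0 : ℝ) := ⟨1, 2, one_pos, one_lt_two⟩
  exact ⟨f.normed volume, f.contDiff_normed, f.hasCompactSupport_normed, f.nonneg_normed,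
    f.integral_normed⟩

/-- A compactly supported smooth function as an element of `L²`. -/
def testKernel (ψ : KernelSpace k → ℂ) (h₁ : ContDiff ℝ (⊤ : ℕ∞) ψ) (h₂ : HasCompactSupport ψ) :
    Kernel k := (h₂.toSchwartzMap h₁).toLp 2

theorem coeFn_testKernel {ψ : KernelSpace k → ℂ} (h₁ : ContDiff ℝ (⊤ : ℕ∞) ψ)
    (h₂ : HasCompactSupport ψ) : testKernel ψ h₁ h₂ =ᵐ[volume] ψ :=
  SchwartzMap.coeFn_toLp _ _ _

theorem coeFn_fourier_testKernel {ψ : KernelSpace k → ℂ} (h₁ : ContDiff ℝ (⊤ : ℕ∞) ψ)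
    (h₂ : HasCompactSupport ψ) : (𝓕 (testKernel ψ h₁ h₂) : Kernel k) =ᵐ[volume] 𝓕 ψ := by
  rw [testKernel, SchwartzMap.toLp_fourier_eq]
  refine (SchwartzMap.coeFn_toLp _ _ _).trans ?_
  rw [SchwartzMap.fourier_coe]
  rfl

/-- The mollified trace is moved onto the test function, and Parseval on the space of `k + 1`
particles followed by the substitution `mergeFreq` turns the mollifier into a frequency cutoff. -/
theorem integral_mul_smearedTrace {ρ : ℝ → ℝ} (hρ : IsMollifier ρ) {α : ℝ} (hα : 0 < α)
    (i : Fin k ⊕ Fin k) {ψ : KernelSpace k → ℂ} (h₁ : ContDiff ℝ (⊤ : ℕ∞) ψ)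
    (h₂ : HasCompactSupport ψ) (u : Kernel (k + 1)) :
    Integrable (fun y => starRingEnd ℂ (ψ y) * smearedTrace ρ α u y (y i)) ∧
    ∫ y, starRingEnd ℂ (ψ y) * smearedTrace ρ α u y (y i) =
      inner ℂ (𝓕 (testKernel ψ h₁ h₂) : Kernel k)
        (intOp _ (hρ.isCutoff hα).memLp (pullOp i (𝓕 u))) := by
  set g := testKernel (mollifiedTest ρ α i ψ) (contDiff_mollifiedTest hρ α i h₁)
    (hasCompactSupport_mollifiedTest hρ hα i h₂) with hg
  have hgu : Integrable fun ζ => starRingEnd ℂ (mollifiedTest ρ α i ψ ζ) * u ζ := by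
    refine (L2.integrable_inner (𝕜 := ℂ) g u).congr ?_
    filter_upwards [coeFn_testKernel (contDiff_mollifiedTest hρ α i h₁)
      (hasCompactSupport_mollifiedTest hρ hα i h₂)] with ζ hζ
    rw [RCLike.inner_apply, hζ, mul_comm]
  have hcomp := integrable_integral_of_measurePreserving (measurePreserving_appendVar k) hgu
  have hpt : ∀ y, ∫ z : ℝ × ℝ, starRingEnd ℂ (mollifiedTest ρ α i ψ (appendVar y z.1 z.2)) *
      u (appendVar y z.1 z.2) = starRingEnd ℂ (ψ y) * smearedTrace ρ α u y (y i) := by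
    intro y
    rw [smearedTrace, ← integral_const_mul]
    refine integral_congr_ae (Eventually.of_forall fun z => ?_)
    simp only [mollifiedTest_appendVar, map_mul, Complex.conj_ofReal]
    ring
  constructor
  · exact hcomp.1.congr (Eventually.of_forall hpt)
  have hleft : inner ℂ g u = ∫ y, starRingEnd ℂ (ψ y) * smearedTrace ρ α u y (y i) := by
    rw [L2.inner_def]
    calc ∫ ζ, inner ℂ (g ζ) (u ζ) = ∫ ζ, starRingEnd ℂ (mollifiedTest ρ α i ψ ζ) * u ζ := by
          refine integral_congr_ae ?_
          filter_upwards [coeFn_testKernel (contDiff_mollifiedTest hρ α i h₁)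
            (hasCompactSupport_mollifiedTest hρ hα i h₂)] with ζ hζ
          rw [RCLike.inner_apply, hζ, mul_comm]
      _ = _ := by
          rw [hcomp.2]
          exact integral_congr_ae (Eventually.of_forall hpt)
  have hgu' := L2.integrable_inner (𝕜 := ℂ) (𝓕 g) (𝓕 u)
  rw [← hleft, ← Lp.inner_fourier_eq, L2.inner_def, L2.inner_def,
    (integrable_integral_of_measurePreserving (measurePreserving_mergeFreq i) hgu').2]
  refine integral_congr_ae ?_
  filter_upwards [coeFn_intOp (hρ.isCutoff hα).memLp (pullOp i (𝓕 u)),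
    coeFn_fourier_testKernel h₁ h₂, Measure.ae_ae_of_ae_prod (coeFn_pullOp i (𝓕 u)),
    ae_mergeFreq i (coeFn_fourier_testKernel (contDiff_mollifiedTest hρ α i h₁)
      (hasCompactSupport_mollifiedTest hρ hα i h₂))] with ξ e1 e2 e3 e4
  rw [e1, e2, RCLike.inner_apply, ← integral_mul_const]
  refine integral_congr_ae ?_
  filter_upwards [e3, e4] with z e3 e4
  simp only [e3, RCLike.inner_apply]
  rw [hg, e4, fourier_mollifiedTest hρ hα i h₁ h₂, mollifierCutoff]
  simp only [map_mul, Complex.conj_conj]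
  ring


/-! ### Free evolution and the weighted interaction picture -/

theorem mulOp_mulOp {X : Type*} [MeasurableSpace X] {μ : Measure X} {m m' m'' : X → ℂ}
    (hm : IsSymbol m) (hm' : IsSymbol m') (hm'' : IsSymbol m'') (h : ∀ x, m x * m' x = m'' x)
    (f : Lp ℂ 2 μ) : mulOp m hm (mulOp m' hm' f) = mulOp m'' hm'' f := by
  refine Lp.ext ?_
  filter_upwards [coeFn_mulOp hm (mulOp m' hm' f), coeFn_mulOp hm' f, coeFn_mulOp hm'' f]
    with x h1 h2 h3
  rw [h1, h2, h3, ← h, mul_assoc]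

theorem continuous_mulOp_uncurry {X : Type*} [MeasurableSpace X] {μ : Measure X}
    {m : ℝ → X → ℂ} (hm : ∀ t, IsSymbol (m t)) (hbd : ∀ t x, ‖m t x‖ ≤ 1)
    (hc : ∀ x, Continuous fun t => m t x) :
    Continuous fun p : ℝ × Lp ℂ 2 μ => mulOp (m p.1) (hm p.1) p.2 := by
  refine continuous_prod_of_continuous_lipschitzWith' _ 1 (fun t => ?_) (fun f => ?_)
  · refine (mulOp (m t) (hm t)).lipschitz.weaken ?_
    rw [← NNReal.coe_le_coe, coe_nnnorm]
    exact ContinuousLinearMap.opNorm_le_bound _ zero_le_one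
      fun f => norm_mulOp_apply_le (hm t) (hbd t) f
  · exact continuous_iff_continuousAt.2 fun t =>
      tendsto_mulOp hm (hm t) hbd (fun x => (hc x).tendsto t) f

theorem continuous_propagatorSymbol {X : Type*} [TopologicalSpace X] {t : X → ℝ}
    {ξ : X → KernelSpace k} (ht : Continuous t) (hξ : Continuous ξ) :
    Continuous fun x => propagatorSymbol (t x) (ξ x) := by
  have := (continuous_dispersion k).comp hξ
  unfold propagatorSymbol
  fun_prop

theorem norm_propagatorSymbol (t : ℝ) (ξ : KernelSpace k) : ‖propagatorSymbol t ξ‖ = 1 := by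
  rw [propagatorSymbol, Complex.norm_exp_ofReal_mul_I]

theorem isSymbol_propagatorSymbol (t : ℝ) : IsSymbol (propagatorSymbol (k := k) t) :=
  ⟨(continuous_propagatorSymbol continuous_const continuous_id).measurable, 1,
    fun ξ => (norm_propagatorSymbol t ξ).le⟩

theorem propagatorSymbol_add (s t : ℝ) (ξ : KernelSpace k) :
    propagatorSymbol s ξ * propagatorSymbol t ξ = propagatorSymbol (s + t) ξ := by
  rw [propagatorSymbol, propagatorSymbol, propagatorSymbol, ← Complex.exp_add]
  congr 1
  push_cast
  ring

theorem fourier_freeEvolution (t : ℝ) (f : Kernel k) :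
    𝓕 (freeEvolution t f) = mulOp _ (isSymbol_propagatorSymbol t) (𝓕 f) := by
  rw [freeEvolution, FourierTransform.fourier_fourierInv_eq]
  refine Lp.ext ?_
  exact (MemLp.coeFn_toLp _).trans (coeFn_mulOp (isSymbol_propagatorSymbol t) (𝓕 f)).symm

/-- The symbol `⟨ξ⟩^{-ε} e^{-it dispersion ξ}` leading from the weighted interaction picture to the
Fourier transform. -/
def evolutionSymbol (ε t : ℝ) (ξ : KernelSpace k) : ℂ :=
  (sobolevSymbol ε ξ : ℂ)⁻¹ * propagatorSymbol t ξ

theorem continuous_evolutionSymbol {X : Type*} [TopologicalSpace X] {t : X → ℝ}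
    {ξ : X → KernelSpace k} (ht : Continuous t) (hξ : Continuous ξ) :
    Continuous fun x => evolutionSymbol ε (t x) (ξ x) := by
  have h1 := (continuous_sobolevSymbol (k := k) ε).comp hξ
  exact ((Complex.continuous_ofReal.comp h1).inv₀ fun x =>
    Complex.ofReal_ne_zero.2 (sobolevSymbol_pos ε _).ne').mul (continuous_propagatorSymbol ht hξ)

theorem norm_evolutionSymbol_le (hε : 0 < ε) (t : ℝ) (ξ : KernelSpace k) :
    ‖evolutionSymbol ε t ξ‖ ≤ 1 := by
  rw [evolutionSymbol, norm_mul, norm_propagatorSymbol, mul_one, norm_inv, Complex.norm_real,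
    Real.norm_of_nonneg (sobolevSymbol_pos ε ξ).le]
  exact inv_le_one_of_one_le₀ (one_le_sobolevSymbol hε ξ)

theorem isSymbol_evolutionSymbol (hε : 0 < ε) (t : ℝ) :
    IsSymbol (evolutionSymbol (k := k) ε t) :=
  ⟨(continuous_evolutionSymbol continuous_const continuous_id).measurable, 1,
    norm_evolutionSymbol_le hε t⟩

/-- The operator from the weighted interaction picture to the Fourier transform. -/
def evolve (hε : 0 < ε) (t : ℝ) : Kernel k →L[ℂ] Kernel k :=
  mulOp _ (isSymbol_evolutionSymbol hε t)

theorem coeFn_evolve (hε : 0 < ε) (t : ℝ) (f : Kernel k) :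
    evolve hε t f =ᵐ[volume] fun ξ => evolutionSymbol ε t ξ * f ξ := coeFn_mulOp _ f

theorem continuous_evolve (hε : 0 < ε) :
    Continuous fun p : ℝ × Kernel k => evolve hε p.1 p.2 :=
  continuous_mulOp_uncurry (fun t => isSymbol_evolutionSymbol hε t) (norm_evolutionSymbol_le hε)
    fun _ => continuous_evolutionSymbol continuous_id continuous_const

theorem norm_evolve_apply_le (hε : 0 < ε) (t : ℝ) (f : Kernel k) : ‖evolve hε t f‖ ≤ ‖f‖ := by
  exact (norm_mulOp_apply_le (isSymbol_evolutionSymbol hε t) (norm_evolutionSymbol_le hε t)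
    f).trans_eq (one_mul _)

theorem evolve_injective (hε : 0 < ε) (t : ℝ) : Function.Injective (evolve (k := k) hε t) := by
  refine (injective_iff_map_eq_zero _).2 fun f hf => Lp.ext ?_
  filter_upwards [coeFn_evolve hε t f, Lp.coeFn_zero ℂ 2 (volume : Measure (KernelSpace k))]
    with ξ h1 h2
  rw [hf, h2] at h1
  rw [h2]
  have h3 : evolutionSymbol ε t ξ ≠ 0 := mul_ne_zero
    (inv_ne_zero (Complex.ofReal_ne_zero.2 (sobolevSymbol_pos ε ξ).ne')) (Complex.exp_ne_zero _)
  exact (mul_eq_zero.1 h1.symm).resolve_left h3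

/-- The symbol of the collision was chosen for this identity: the quotient of the Sobolev weights
gives its modulus, the difference of the dispersions its phase. -/
theorem evolutionSymbol_mergeFreq (t : ℝ) (i : Fin k ⊕ Fin k) (ξ : KernelSpace k) (z : ℝ × ℝ) :
    evolutionSymbol ε t (mergeFreq i ξ z) =
      evolutionSymbol ε t ξ * collisionSymbol ε i t (ξ i) z := by
  have h1 := sobolevSymbol_mergeFreq ε i ξ z
  have h2 := dispersion_sub_dispersion_mergeFreq i ξ z
  have h3 : (sobolevSymbol ε (mergeFreq i ξ z) : ℂ) ≠ 0 :=
    Complex.ofReal_ne_zero.2 (sobolevSymbol_pos ε _).ne'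
  have h4 : (sobolevSymbol ε ξ : ℂ) ≠ 0 := Complex.ofReal_ne_zero.2 (sobolevSymbol_pos ε _).ne'
  have h5 : propagatorSymbol t (mergeFreq i ξ z) =
      propagatorSymbol t ξ * Complex.exp ((t * resonance i (ξ i) z : ℝ) * Complex.I) := by
    rw [propagatorSymbol, propagatorSymbol, ← Complex.exp_add, ← h2]
    congr 1
    push_cast
    ring
  have h6 : (sobolevSymbol ε (mergeFreq i ξ z) : ℂ)⁻¹ =
      (sobolevSymbol ε ξ : ℂ)⁻¹ * (collisionWeight ε (ξ i) z.1 z.2 : ℂ) := by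
    rw [inv_eq_iff_eq_inv, mul_inv, inv_inv, ← div_eq_mul_inv, eq_div_iff, h1]
    · push_cast
      ring
    · rintro h0
      rw [h1, Complex.ofReal_mul, h0, zero_mul] at h4
      exact h4 rfl
  rw [evolutionSymbol, evolutionSymbol, collisionSymbol, h5, h6]
  ring

/-- The weighted interaction picture intertwines the bare traced substitution with `freqCollision`;
this links the hierarchy to the collapsing estimate. -/
theorem intOp_pullOp_evolve (hε : 0 < ε) {χ : ℝ × ℝ → ℂ} (hχ : IsCutoff χ) (i : Fin k ⊕ Fin k)
    (t : ℝ) (f : Kernel (k + 1)) :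
    intOp χ hχ.memLp (pullOp i (evolve hε t f)) = evolve hε t (freqCollision hε hχ i t f) := by
  refine Lp.ext ?_
  filter_upwards [coeFn_intOp hχ.memLp (pullOp i (evolve hε t f)),
    coeFn_evolve hε t (freqCollision hε hχ i t f), coeFn_freqCollision hε hχ i t f,
    Measure.ae_ae_of_ae_prod (coeFn_pullOp i (evolve hε t f)),
    ae_mergeFreq i (coeFn_evolve hε t f)] with ξ h1 h2 h3 h4 h5
  rw [h1, h2, h3, ← integral_const_mul]
  refine integral_congr_ae ?_
  filter_upwards [h4, h5] with z h4 h5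
  rw [h4, h5, evolutionSymbol_mergeFreq]
  ring

/-! ### The weighted Fourier transform -/

open Classical in
/-- The weighted Fourier transform `⟨ξ⟩^ε 𝓕 f`, if it is square integrable. -/
def weightedFourier (ε : ℝ) (f : Kernel k) : Kernel k :=
  if h : MemLp (fun ξ : KernelSpace k => (sobolevSymbol ε ξ : ℂ) * (𝓕 f) ξ) 2 volume then h.toLp
  else 0

theorem enorm_weightedFourier_le (f : Kernel k) :
    ‖weightedFourier ε f‖ₑ ≤ sobolevNorm ε f := by
  unfold weightedFourier
  split_ifs with h
  · rw [Lp.enorm_toLp, sobolevNorm]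
  · simp

theorem coeFn_weightedFourier {f : Kernel k} (hf : sobolevNorm ε f ≠ ∞) :
    weightedFourier ε f =ᵐ[volume] fun ξ => (sobolevSymbol ε ξ : ℂ) * (𝓕 f) ξ := by
  have h : MemLp (fun ξ : KernelSpace k => (sobolevSymbol ε ξ : ℂ) * (𝓕 f) ξ) 2 volume :=
    ⟨(Complex.continuous_ofReal.comp (continuous_sobolevSymbol ε)).aestronglyMeasurable.mul
      (Lp.aestronglyMeasurable _), lt_top_iff_ne_top.2 hf⟩
  rw [weightedFourier, dif_pos h]
  exact h.coeFn_toLp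

/-- The indicator function of the frequencies of weight at most `n`. -/
def weightTruncation (ε : ℝ) (n : ℕ) (ξ : KernelSpace k) : ℂ :=
  Set.indicator {ξ | sobolevSymbol ε ξ ≤ n} 1 ξ

theorem measurable_weightTruncation (n : ℕ) : Measurable (weightTruncation (k := k) ε n) :=
  measurable_one.indicator (measurableSet_le (continuous_sobolevSymbol ε).measurable
    measurable_const)

theorem norm_weightTruncation_le (n : ℕ) (ξ : KernelSpace k) : ‖weightTruncation ε n ξ‖ ≤ 1 := by
  by_cases h : sobolevSymbol ε ξ ≤ n <;> simp [weightTruncation, h]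

theorem eventually_weightTruncation (ξ : KernelSpace k) :
    ∀ᶠ n in atTop, weightTruncation ε n ξ = 1 := by
  filter_upwards [eventually_ge_atTop ⌈sobolevSymbol ε ξ⌉₊] with n hn
  have : sobolevSymbol ε ξ ≤ n := (Nat.le_ceil _).trans (by exact_mod_cast hn)
  simp [weightTruncation, this]

theorem isSymbol_weightTruncation (n : ℕ) : IsSymbol (weightTruncation (k := k) ε n) :=
  ⟨measurable_weightTruncation n, 1, norm_weightTruncation_le n⟩

theorem isSymbol_truncated (n : ℕ) :
    IsSymbol fun ξ : KernelSpace k => weightTruncation ε n ξ * (sobolevSymbol ε ξ : ℂ) := by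
  refine ⟨(measurable_weightTruncation n).mul
    (Complex.continuous_ofReal.comp (continuous_sobolevSymbol ε)).measurable, n, fun ξ => ?_⟩
  by_cases h : sobolevSymbol ε ξ ≤ n
  · simp [weightTruncation, h, abs_of_pos (sobolevSymbol_pos ε ξ)]
  · simp [weightTruncation, h]

/-- The weighted transform is not continuous on `L²`, but it is a pointwise limit of bounded
operators where it exists; this yields its measurability along a family of kernels. -/
theorem tendsto_mulOp_truncated {f : Kernel k} (hf : sobolevNorm ε f ≠ ∞) :
    Tendsto (fun n => mulOp _ (isSymbol_truncated (ε := ε) n) (𝓕 f : Kernel k)) atTop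
      (𝓝 (weightedFourier ε f)) := by
  have h1 : IsSymbol fun _ : KernelSpace k => (1 : ℂ) := ⟨measurable_const, 1, by simp⟩
  have h := tendsto_mulOp (fun n => isSymbol_weightTruncation (k := k) (ε := ε) n) h1
    norm_weightTruncation_le
    (fun ξ => tendsto_const_nhds.congr' ((eventually_weightTruncation ξ).mono fun n h => h.symm))
    (weightedFourier ε f)
  have h2 : mulOp _ h1 (weightedFourier ε f) = weightedFourier ε f := by
    refine Lp.ext ?_
    filter_upwards [coeFn_mulOp h1 (weightedFourier ε f)] with ξ hξ
    rw [hξ, one_mul]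
  rw [h2] at h
  refine h.congr fun n => Lp.ext ?_
  filter_upwards [coeFn_mulOp (isSymbol_weightTruncation n) (weightedFourier ε f),
    coeFn_mulOp (isSymbol_truncated (ε := ε) n) (𝓕 f : Kernel k), coeFn_weightedFourier hf]
    with ξ h3 h4 h5
  rw [h3, h4, h5, mul_assoc]

/-- Monotone convergence, valid also where the Sobolev norm is infinite; hence that norm is
measurable along a family before it is known to be finite. -/
theorem tendsto_enorm_mulOp_truncated (f : Kernel k) :
    Tendsto (fun n => ‖mulOp _ (isSymbol_truncated (ε := ε) n) (𝓕 f : Kernel k)‖ₑ ^ 2) atTop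
      (𝓝 (sobolevNorm ε f ^ 2)) := by
  have h1 : ∀ n, ‖mulOp _ (isSymbol_truncated (ε := ε) n) (𝓕 f : Kernel k)‖ₑ ^ 2 =
      ∫⁻ ξ, ‖weightTruncation ε n ξ * ((sobolevSymbol ε ξ : ℂ) * (𝓕 f : Kernel k) ξ)‖ₑ ^ 2 := by
    intro n
    rw [enorm_sq_eq_lintegral]
    refine lintegral_congr_ae ?_
    filter_upwards [coeFn_mulOp (isSymbol_truncated (ε := ε) n) (𝓕 f : Kernel k)] with ξ hξ
    rw [hξ, mul_assoc]
  simp_rw [h1]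
  rw [sobolevNorm, eLpNorm_two_sq]
  have hm : Measurable fun ξ => (sobolevSymbol ε ξ : ℂ) * (𝓕 f : Kernel k) ξ :=
    (Complex.continuous_ofReal.comp (continuous_sobolevSymbol ε)).measurable.mul
      (Lp.stronglyMeasurable _).measurable
  refine lintegral_tendsto_of_tendsto_of_monotone
    (fun n => (((measurable_weightTruncation n).mul hm).enorm.pow_const 2).aemeasurable)
    (Eventually.of_forall fun ξ n m hnm => ?_) (Eventually.of_forall fun ξ => ?_)
  · have hnm' : (n : ℝ) ≤ m := by exact_mod_cast hnm
    by_cases h : sobolevSymbol ε ξ ≤ n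
    · simp [weightTruncation, h, h.trans hnm']
    · simp [weightTruncation, h]
  · exact tendsto_const_nhds.congr' ((eventually_weightTruncation (ε := ε) ξ).mono fun n h => by
      simp only [h, one_mul])

theorem continuous_mulOp_fourier {m : KernelSpace k → ℂ} (hm : IsSymbol m) :
    Continuous fun f : Kernel k => mulOp m hm (𝓕 f) :=
  (mulOp m hm).continuous.comp (Lp.fourierTransformₗᵢ (KernelSpace k) ℂ).continuous

section Families

variable {X : Type*} [MeasurableSpace X] {μ : Measure X} {F : X → Kernel k}

theorem aemeasurable_sobolevNorm (hF : AEStronglyMeasurable F μ) :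
    AEMeasurable (fun x => sobolevNorm ε (F x)) μ := by
  have h : AEMeasurable (fun x => sobolevNorm ε (F x) ^ 2) μ := by
    refine aemeasurable_of_tendsto_metrizable_ae' (fun n => ?_)
      (Eventually.of_forall fun x => tendsto_enorm_mulOp_truncated (F x))
    exact ((continuous_mulOp_fourier (isSymbol_truncated n)).comp_aestronglyMeasurable
      hF).enorm.pow_const 2
  refine (h.pow_const (1 / 2 : ℝ)).congr (Eventually.of_forall fun x => ?_)
  change (sobolevNorm ε (F x) ^ 2) ^ (1 / 2 : ℝ) = sobolevNorm ε (F x)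
  rw [← ENNReal.rpow_natCast, ← ENNReal.rpow_mul]
  norm_num

theorem ae_sobolevNorm_ne_top (hF : AEStronglyMeasurable F μ)
    (h : ∫⁻ x, sobolevNorm ε (F x) ∂μ ≠ ∞) : ∀ᵐ x ∂μ, sobolevNorm ε (F x) ≠ ∞ :=
  (ae_lt_top' (aemeasurable_sobolevNorm hF) h).mono fun _ h => h.ne

theorem integrable_weightedFourier (hF : AEStronglyMeasurable F μ)
    (h : ∫⁻ x, sobolevNorm ε (F x) ∂μ ≠ ∞) : Integrable (fun x => weightedFourier ε (F x)) μ := by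
  refine ⟨?_, (lintegral_mono fun x => enorm_weightedFourier_le (F x)).trans_lt
    (lt_top_iff_ne_top.2 h)⟩
  refine aestronglyMeasurable_of_tendsto_ae atTop (fun n =>
    (continuous_mulOp_fourier (isSymbol_truncated (ε := ε) n)).comp_aestronglyMeasurable hF) ?_
  filter_upwards [ae_sobolevNorm_ne_top hF h] with x hx
  exact tendsto_mulOp_truncated hx

end Families

/-- The weighted Fourier transform of `f` in the interaction picture at the time `t`. -/
def interaction (ε t : ℝ) (f : Kernel k) : Kernel k :=
  mulOp _ (isSymbol_propagatorSymbol (-t)) (weightedFourier ε f)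

theorem enorm_interaction_le (t : ℝ) (f : Kernel k) :
    ‖interaction ε t f‖ₑ ≤ sobolevNorm ε f := by
  refine le_trans ?_ (enorm_weightedFourier_le f)
  rw [enorm_le_iff_norm_le]
  exact (norm_mulOp_apply_le (isSymbol_propagatorSymbol (-t))
    (fun ξ => (norm_propagatorSymbol (-t) ξ).le) (weightedFourier ε f)).trans_eq (one_mul _)

theorem evolve_interaction (hε : 0 < ε) (t : ℝ) {f : Kernel k} (hf : sobolevNorm ε f ≠ ∞) :
    evolve hε t (interaction ε t f) = 𝓕 f := by
  refine Lp.ext ?_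
  filter_upwards [coeFn_evolve hε t (interaction ε t f),
    coeFn_mulOp (isSymbol_propagatorSymbol (-t)) (weightedFourier ε f),
    coeFn_weightedFourier hf] with ξ h1 h2 h3
  have h4 : (sobolevSymbol ε ξ : ℂ) ≠ 0 := Complex.ofReal_ne_zero.2 (sobolevSymbol_pos ε _).ne'
  have h5 := propagatorSymbol_add t (-t) ξ
  have h6 : propagatorSymbol (t + -t) ξ = 1 := by simp [propagatorSymbol]
  rw [h1, interaction, h2, h3, evolutionSymbol]
  rw [h6] at h5
  calc _ = ((sobolevSymbol ε ξ : ℂ)⁻¹ * sobolevSymbol ε ξ) *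
        (propagatorSymbol t ξ * propagatorSymbol (-t) ξ) * (𝓕 f : Kernel k) ξ := by ring
    _ = _ := by rw [h5, inv_mul_cancel₀ h4]; ring

theorem mulOp_propagatorSymbol_evolve (hε : 0 < ε) (s t : ℝ) (f : Kernel k) :
    mulOp _ (isSymbol_propagatorSymbol (t - s)) (evolve hε s f) = evolve hε t f := by
  refine mulOp_mulOp _ _ _ (fun ξ => ?_) f
  have := propagatorSymbol_add (t - s) s ξ
  rw [sub_add_cancel] at this
  rw [evolutionSymbol, evolutionSymbol, ← this]
  ring

theorem integrableOn_interaction {F : ℝ → Kernel k} {s : Set ℝ}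
    (hF : AEStronglyMeasurable F (volume.restrict s))
    (h : ∫⁻ t in s, sobolevNorm ε (F t) ≠ ∞) :
    IntegrableOn (fun t => interaction ε t (F t)) s := by
  have hc : Continuous fun p : ℝ × Kernel k =>
      mulOp _ (isSymbol_propagatorSymbol (-p.1)) p.2 :=
    continuous_mulOp_uncurry (m := fun t => propagatorSymbol (-t))
      (fun t => isSymbol_propagatorSymbol (-t))
      (fun t ξ => (norm_propagatorSymbol _ ξ).le)
      fun _ => continuous_propagatorSymbol continuous_neg continuous_const
  have hm : AEStronglyMeasurable (fun t => (t, weightedFourier ε (F t))) (volume.restrict s) :=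
    aestronglyMeasurable_id.prodMk (integrable_weightedFourier hF h).aestronglyMeasurable
  have hm' := hc.comp_aestronglyMeasurable hm
  refine ⟨hm', ?_⟩
  exact (lintegral_mono fun t => enorm_interaction_le t (F t)).trans_lt (lt_top_iff_ne_top.2 h)

attribute [irreducible] evolve interaction weightedFourier

/-! ### Permutations and the Fourier transform -/

/-- A permutation of the particles is a linear isometry, with which the Fourier transform commutes
on Schwartz functions; density extends this to `L²`. -/
theorem fourier_permOp (σ : Equiv.Perm (Fin k)) (f : Kernel k) :
    𝓕 (permOp σ f) = permOp σ (𝓕 f : Kernel k) := by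
  obtain ⟨A, hA⟩ := exists_linearIsometryEquiv_eq_permute σ
  have hF : Continuous fun f : Kernel k => (𝓕 f : Kernel k) :=
    (Lp.fourierTransformₗᵢ (KernelSpace k) ℂ).continuous
  have hd : DenseRange (SchwartzMap.toLpCLM ℂ (E := KernelSpace k) ℂ 2 volume) :=
    SchwartzMap.denseRange_toLpCLM ENNReal.ofNat_ne_top
  have hclosed : IsClosed {f : Kernel k | 𝓕 (permOp σ f) = permOp σ (𝓕 f : Kernel k)} :=
    isClosed_eq (hF.comp (permOp σ).continuous) ((permOp σ).continuous.comp hF)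
  refine hd.induction_on f hclosed fun g => ?_
  set g' := SchwartzMap.compCLMOfContinuousLinearEquiv ℂ A.toContinuousLinearEquiv g with hg'
  have h1 : permOp σ (g.toLp 2) = g'.toLp 2 := by
    refine Lp.ext ?_
    filter_upwards [coeFn_permOp σ (g.toLp 2), SchwartzMap.coeFn_toLp g' 2,
      (measurePreserving_permute σ).quasiMeasurePreserving.tendsto_ae.eventually
        (SchwartzMap.coeFn_toLp g 2 volume)]
      with y h1 h2 h3
    rw [h1, h2, h3, ← hA]
    rfl
  change 𝓕 (permOp σ (g.toLp 2)) = permOp σ (𝓕 (g.toLp 2) : Kernel k)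
  rw [h1, SchwartzMap.toLp_fourier_eq, SchwartzMap.toLp_fourier_eq]
  refine Lp.ext ?_
  filter_upwards [coeFn_permOp σ ((𝓕 g).toLp 2), SchwartzMap.coeFn_toLp (𝓕 g') 2,
    (measurePreserving_permute σ).quasiMeasurePreserving.tendsto_ae.eventually
      (SchwartzMap.coeFn_toLp (𝓕 g) 2 volume)]
    with y h1 h2 h3
  rw [h1, h2, h3, SchwartzMap.fourier_coe, SchwartzMap.fourier_coe, ← hA,
    ← Real.fourier_comp_linearIsometry]
  rfl

theorem permOp_evolve (hε : 0 < ε) (σ : Equiv.Perm (Fin k)) (t : ℝ) (f : Kernel k) :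
    permOp σ (evolve hε t f) = evolve hε t (permOp σ f) := by
  have h : ∀ ξ : KernelSpace k, evolutionSymbol ε t (permute σ ξ) = evolutionSymbol ε t ξ := by
    intro ξ
    have h1 : sobolevSymbol ε (permute σ ξ) = sobolevSymbol ε ξ :=
      Equiv.prod_comp (Equiv.sumCongr σ σ) fun i => (1 + (2 * Real.pi * ξ i) ^ 2) ^ (ε / 2)
    have h2 : dispersion (permute σ ξ) = dispersion ξ := by
      unfold dispersion
      simp only [permute_apply, Sum.map_inl, Sum.map_inr]
      rw [Equiv.sum_comp σ fun j => (2 * Real.pi * ξ (Sum.inl j)) ^ 2,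
        Equiv.sum_comp σ fun j => (2 * Real.pi * ξ (Sum.inr j)) ^ 2]
    rw [evolutionSymbol, evolutionSymbol, propagatorSymbol, propagatorSymbol, h1, h2]
  refine Lp.ext ?_
  filter_upwards [coeFn_permOp σ (evolve hε t f),
    (measurePreserving_permute σ).quasiMeasurePreserving.ae (coeFn_evolve hε t f),
    coeFn_evolve hε t (permOp σ f), coeFn_permOp σ f] with ξ h1 h2 h3 h4
  rw [h1, h2, h3, h4, h]


/-! ### Removal of the cutoff -/

theorem exists_tendsto_lintegral_enorm_sub {X E : Type*} [MeasurableSpace X] {μ : Measure X}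
    [NormedAddCommGroup E] [CompleteSpace E] {D : ℕ → X → E} (hD : ∀ n, Integrable (D n) μ)
    {e : ℕ → ℝ≥0∞} (he : Tendsto e atTop (𝓝 0))
    (hDe : ∀ n m, ∫⁻ x, ‖D n x - D m x‖ₑ ∂μ ≤ e n + e m) :
    ∃ G : X → E, Integrable G μ ∧ Tendsto (fun n => ∫⁻ x, ‖D n x - G x‖ₑ ∂μ) atTop (𝓝 0) := by
  have hedist : ∀ n m, edist ((hD n).toL1 (D n)) ((hD m).toL1 (D m)) =
      ∫⁻ x, ‖D n x - D m x‖ₑ ∂μ := by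
    intro n m
    rw [Integrable.edist_toL1_toL1]
    simp only [edist_eq_enorm_sub]
  have hc : CauchySeq fun n => (hD n).toL1 (D n) := by
    rw [EMetric.cauchySeq_iff]
    intro η hη
    obtain ⟨N, hN⟩ := eventually_atTop.1 (he.eventually_lt_const (ENNReal.half_pos hη.ne'))
    refine ⟨N, fun m hm n hn => ?_⟩
    rw [hedist]
    exact (hDe m n).trans_lt ((ENNReal.add_lt_add (hN m hm) (hN n hn)).trans_eq
      (ENNReal.add_halves η))
  obtain ⟨G, hG⟩ := cauchySeq_tendsto_of_complete hc
  refine ⟨G, L1.integrable_coeFn G, ?_⟩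
  rw [tendsto_iff_edist_tendsto_0] at hG
  refine hG.congr fun n => ?_
  rw [L1.edist_def]
  refine lintegral_congr_ae ?_
  filter_upwards [(hD n).coeFn_toL1] with x hx
  rw [hx, edist_eq_enorm_sub]

/-- Cauchy-Schwarz in time turns the `L²` estimate into an `L¹` one and gains the root of the length
of the interval, the source of smallness on short intervals. The cutoff is kept inside the norm on
the right. -/
theorem exists_lintegral_freqCollision_le (hε : 0 < ε) {T : ℝ} (hT : 0 < T) :
    ∃ A : ℝ≥0∞, A ≠ ∞ ∧ ∀ (k : ℕ) (i : Fin k ⊕ Fin k) (χ : ℝ × ℝ → ℂ) (hχ : IsCutoff χ)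
      (hχb : IsSymbol fun p : KernelSpace k × ℝ × ℝ => χ p.2) (f : Kernel (k + 1)) (t₀ t₁ : ℝ),
      0 ≤ t₀ → t₁ ≤ T → ∫⁻ t in Set.Icc t₀ t₁, ‖freqCollision hε hχ i t f‖ₑ ≤
        ENNReal.ofReal (t₁ - t₀) ^ (1 / 2 : ℝ) * A * ‖mulOp _ hχb (pullOp i f)‖ₑ := by
  obtain ⟨S, hS, hSb⟩ := exists_lintegral_freqCollision_sq_le hε hT
  refine ⟨S ^ (1 / 2 : ℝ), by finiteness, fun k i χ hχ hχb f t₀ t₁ h0 h1 => ?_⟩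
  have hc : Continuous fun t => freqCollision hε hχ i t f :=
    (continuous_freqCollision hε hχ i).comp (continuous_id.prodMk continuous_const)
  refine (lintegral_le_sqrt_measure_mul hc.enorm.measurable.aemeasurable).trans ?_
  rw [Real.volume_Icc, mul_assoc]
  gcongr
  have h2 : ∫⁻ t in Set.Icc t₀ t₁, ‖freqCollision hε hχ i t f‖ₑ ^ 2 ≤
      S * ‖mulOp _ hχb (pullOp i f)‖ₑ ^ 2 := by
    refine ((lintegral_mono_set (Set.Icc_subset_Icc h0 h1)).trans (hSb k i χ hχ f)).trans ?_
    rw [enorm_sq_eq_lintegral]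
    refine mul_le_mul_right (le_of_eq (lintegral_congr_ae ?_)) _
    filter_upwards [coeFn_mulOp hχb (pullOp i f)] with p hp
    rw [hp]
  refine (ENNReal.rpow_le_rpow h2 (by norm_num)).trans (le_of_eq ?_)
  rw [ENNReal.mul_rpow_of_nonneg _ _ (by norm_num), ← ENNReal.rpow_natCast, ← ENNReal.rpow_mul]
  norm_num

theorem freqCollision_sub (hε : 0 < ε) {χ χ' : ℝ × ℝ → ℂ} (hχ : IsCutoff χ) (hχ' : IsCutoff χ')
    (i : Fin k ⊕ Fin k) (t : ℝ) (f : Kernel (k + 1)) :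
    freqCollision hε (hχ.sub hχ') i t f = freqCollision hε hχ i t f - freqCollision hε hχ' i t f := by
  rw [freqCollision_apply, freqCollision_apply, freqCollision_apply]
  set F := mulOp _ (isSymbol_collisionSymbol hε i t) (pullOp i f)
  refine Lp.ext ?_
  filter_upwards [coeFn_intOp (hχ.sub hχ').memLp F, coeFn_intOp hχ.memLp F,
    coeFn_intOp hχ'.memLp F, ae_memLp_slice F, Lp.coeFn_sub (intOp χ hχ.memLp F)
      (intOp χ' hχ'.memLp F)] with ξ h1 h2 h3 h4 h5
  have h6 : Integrable fun z => χ z * F (ξ, z) := hχ.memLp.integrable_mul h4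
  have h7 : Integrable fun z => χ' z * F (ξ, z) := hχ'.memLp.integrable_mul h4
  rw [h1, h5, Pi.sub_apply, h2, h3, ← integral_sub h6 h7]
  simp only [sub_mul]

/-- Cutoffs that converge to `1`. -/
structure IsCutoffSeq (χ : ℕ → ℝ × ℝ → ℂ) : Prop where
  cutoff : ∀ n, IsCutoff (χ n)
  norm_le : ∀ n z, ‖χ n z‖ ≤ 1
  tendsto : ∀ z, Tendsto (fun n => χ n z) atTop (𝓝 1)

variable {χ : ℕ → ℝ × ℝ → ℂ}

theorem IsCutoffSeq.isSymbol (h : IsCutoffSeq χ) (k n : ℕ) :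
    IsSymbol fun p : KernelSpace k × ℝ × ℝ => χ n p.2 :=
  ⟨((h.cutoff n).continuous.comp continuous_snd).measurable, 1, fun p => h.norm_le n p.2⟩

theorem IsCutoffSeq.isSymbol_sub_one (h : IsCutoffSeq χ) (k n : ℕ) :
    IsSymbol fun p : KernelSpace k × ℝ × ℝ => χ n p.2 - 1 :=
  ⟨(((h.cutoff n).continuous.comp continuous_snd).sub continuous_const).measurable, 2,
    fun p => (norm_sub_le _ _).trans (by
      have := h.norm_le n p.2
      rw [norm_one]
      linarith)⟩

theorem IsCutoffSeq.isSymbol_sub (h : IsCutoffSeq χ) (k n m : ℕ) :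
    IsSymbol fun p : KernelSpace k × ℝ × ℝ => χ n p.2 - χ m p.2 :=
  ⟨(((h.cutoff n).continuous.comp continuous_snd).sub
    ((h.cutoff m).continuous.comp continuous_snd)).measurable, 2,
    fun p => (norm_sub_le _ _).trans (by linarith [h.norm_le n p.2, h.norm_le m p.2])⟩

theorem IsCutoffSeq.enorm_mulOp_sub_le (h : IsCutoffSeq χ) (n m : ℕ) (F : PairKernel k) :
    ‖mulOp _ (h.isSymbol_sub k n m) F‖ₑ ≤
      ‖mulOp _ (h.isSymbol_sub_one k n) F‖ₑ + ‖mulOp _ (h.isSymbol_sub_one k m) F‖ₑ := by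
  have : mulOp _ (h.isSymbol_sub k n m) F =
      mulOp _ (h.isSymbol_sub_one k n) F - mulOp _ (h.isSymbol_sub_one k m) F := by
    refine Lp.ext ?_
    filter_upwards [coeFn_mulOp (h.isSymbol_sub k n m) F, coeFn_mulOp (h.isSymbol_sub_one k n) F,
      coeFn_mulOp (h.isSymbol_sub_one k m) F, Lp.coeFn_sub (mulOp _ (h.isSymbol_sub_one k n) F)
        (mulOp _ (h.isSymbol_sub_one k m) F)] with p h1 h2 h3 h4
    rw [h1, h4, Pi.sub_apply, h2, h3]
    ring
  rw [this]
  exact enorm_sub_le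

/-- Dominated convergence twice: in the frequencies for fixed `s`, then in `s`, with majorant `2 ‖w
s‖`. -/
theorem IsCutoffSeq.tendsto_lintegral (h : IsCutoffSeq χ) {X : Type*} [MeasurableSpace X]
    {μ : Measure X} {w : X → Kernel (k + 1)} (hw : Integrable w μ) (i : Fin k ⊕ Fin k) :
    Tendsto (fun n => ∫⁻ s, ‖mulOp _ (h.isSymbol_sub_one k n) (pullOp i (w s))‖ₑ ∂μ) atTop
      (𝓝 0) := by
  have h0 : (0 : ℝ≥0∞) = ∫⁻ _, 0 ∂μ := by simp
  rw [h0]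
  have hsym0 : IsSymbol fun _ : KernelSpace k × ℝ × ℝ => (0 : ℂ) := ⟨measurable_const, 0, by simp⟩
  have hle : ∀ n (p : KernelSpace k × ℝ × ℝ), ‖χ n p.2 - 1‖ ≤ 2 := fun n p =>
    (norm_sub_le _ _).trans (by
      have := h.norm_le n p.2
      rw [norm_one]
      linarith)
  refine tendsto_lintegral_filter_of_dominated_convergence' (fun s => 2 * ‖w s‖ₑ) ?_ ?_ ?_ ?_
  · refine Eventually.of_forall fun n => ?_
    exact ((mulOp _ (h.isSymbol_sub_one k n)).continuous.comp_aestronglyMeasurable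
      ((pullOp i).continuous.comp_aestronglyMeasurable hw.aestronglyMeasurable)).enorm
  · refine Eventually.of_forall fun n => Eventually.of_forall fun s => ?_
    have h1 := norm_mulOp_apply_le (h.isSymbol_sub_one k n) (hle n) (pullOp i (w s))
    rw [norm_pullOp] at h1
    have h2 := ENNReal.ofReal_le_ofReal h1
    rwa [ENNReal.ofReal_mul zero_le_two, ofReal_norm, ofReal_norm, ENNReal.ofReal_ofNat] at h2
  · rw [lintegral_const_mul'' _ hw.aestronglyMeasurable.enorm]
    exact ENNReal.mul_ne_top (by simp) hw.2.ne
  · refine Eventually.of_forall fun s => ?_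
    have h1 := tendsto_mulOp (fun n => h.isSymbol_sub_one k n) hsym0 hle
      (fun p => by simpa using (h.tendsto p.2).sub_const 1) (pullOp i (w s))
    have h2 : mulOp _ hsym0 (pullOp i (w s)) = 0 := by
      refine Lp.ext ?_
      filter_upwards [coeFn_mulOp hsym0 (pullOp i (w s)), Lp.coeFn_zero ℂ 2
        ((volume : Measure (KernelSpace k)).prod (volume : Measure (ℝ × ℝ)))] with p h3 h4
      rw [h3, h4, zero_mul]
      rfl
    rw [h2] at h1
    simpa using h1.enorm

/-- The collision operators without cutoff exist on primitives, as limits in `L¹` of the operators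
with cutoff. -/
theorem IsCutoffSeq.exists_limit (hε : 0 < ε) {T : ℝ} (hT : 0 < T) (h : IsCutoffSeq χ)
    {w : ℝ → Kernel (k + 1)} (hw : IntegrableOn w (Set.Icc 0 T)) (i : Fin k ⊕ Fin k) :
    ∃ G : ℝ → Kernel k, IntegrableOn G (Set.Icc 0 T) ∧
      Tendsto (fun n => ∫⁻ r in Set.Icc 0 T,
        ‖freqCollision hε (h.cutoff n) i r (∫ s in (0 : ℝ)..r, w s) - G r‖ₑ) atTop (𝓝 0) := by
  obtain ⟨A, hA, hAb⟩ := exists_lintegral_freqCollision_le hε hT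
  set A' := ENNReal.ofReal (T - 0) ^ (1 / 2 : ℝ) * A with hA'
  have hA't : A' ≠ ∞ := by finiteness
  have hv := continuousOn_primitive_Icc hw
  have hlim := ENNReal.Tendsto.const_mul (a := A') (h.tendsto_lintegral hw i) (Or.inr hA't)
  rw [mul_zero] at hlim
  refine exists_tendsto_lintegral_enorm_sub (fun n => ?_) hlim fun n m => ?_
  · refine ContinuousOn.integrableOn_Icc ?_
    exact (continuous_freqCollision hε (h.cutoff n) i).comp_continuousOn
      (continuousOn_id.prodMk hv)
  -- The difference of two cutoff operators is the operator with cutoff `χ n - χ m`. The collapsing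
  -- estimate, whose constant ignores the cutoff, thus yields a Cauchy sequence in `L¹`.
  · have hcont : Continuous fun p : ℝ × Kernel (k + 1) =>
        freqCollision hε ((h.cutoff n).sub (h.cutoff m)) i p.1 p.2 :=
      continuous_freqCollision hε _ i
    have key := lintegral_apply_primitive_le (a := 0) (b := T)
      (β := fun r => (freqCollision hε ((h.cutoff n).sub (h.cutoff m)) i r).restrictScalars ℝ)
      hcont hw
    simp only [ContinuousLinearMap.coe_restrictScalars'] at key
    simp only [← freqCollision_sub]
    refine key.trans ?_
    have hmeas : ∀ l, AEMeasurable
        (fun s => ‖mulOp _ (h.isSymbol_sub_one k l) (pullOp i (w s))‖ₑ)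
        (volume.restrict (Set.Icc 0 T)) := fun l =>
      ((mulOp _ (h.isSymbol_sub_one k l)).continuous.comp_aestronglyMeasurable
        ((pullOp i).continuous.comp_aestronglyMeasurable hw.aestronglyMeasurable)).enorm
    rw [← mul_add, ← lintegral_add_left' (hmeas n),
      ← lintegral_const_mul' _ _ hA't]
    · refine lintegral_mono fun s => ?_
      refine (hAb k i _ ((h.cutoff n).sub (h.cutoff m)) (h.isSymbol_sub k n m) (w s) 0 T le_rfl
        le_rfl).trans ?_
      exact mul_le_mul_right (h.enorm_mulOp_sub_le n m _) _


/-! ### Duhamel's formula and the symmetry of the source -/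

theorem ae_eq_zero_of_primitive_eq_zero {E : Type*} [NormedAddCommGroup E] [NormedSpace ℝ E]
    [CompleteSpace E] {f : ℝ → E} {T : ℝ} (hT : 0 ≤ T) (hf : IntegrableOn f (Set.Icc 0 T))
    (h : ∀ t ∈ Set.Icc 0 T, ∫ s in (0 : ℝ)..t, f s = 0) :
    ∀ᵐ t ∂volume.restrict (Set.Icc 0 T), f t = 0 := by
  have hi : IntervalIntegrable f volume 0 T :=
    (intervalIntegrable_iff_integrableOn_Icc_of_le hT).2 hf
  rw [← Measure.restrict_congr_set Ioo_ae_eq_Icc, ae_restrict_iff' measurableSet_Ioo]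
  filter_upwards [hi.ae_hasDerivAt_integral] with t ht hmem
  rw [Set.uIcc_of_le hT] at ht
  have h1 := ht (Set.Ioo_subset_Icc_self hmem) 0 (Set.left_mem_Icc.2 hT)
  have h2 : (fun x => ∫ s in (0 : ℝ)..x, f s) =ᶠ[𝓝 t] fun _ => 0 := by
    filter_upwards [Ioo_mem_nhds hmem.1 hmem.2] with x hx
    exact h x (Set.Ioo_subset_Icc_self hx)
  exact h1.unique ((hasDerivAt_const t 0).congr_of_eventuallyEq h2)

theorem lensFactor_mem (ω τ : ℝ) : 0 ≤ lensFactor ω τ ∧ lensFactor ω τ ≤ 1 := by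
  refine ⟨Real.rpow_nonneg (by positivity) _, Real.rpow_le_one_of_one_le_of_nonpos ?_ (by norm_num)⟩
  nlinarith [sq_nonneg (ω * τ)]

/-- The coupling `i b₀ g(t)`. -/
def coupling (ω b₀ t : ℝ) : ℂ := Complex.I * b₀ * lensFactor ω t

theorem continuous_coupling (ω b₀ : ℝ) : Continuous (coupling ω b₀) := by
  have : Continuous (lensFactor ω) := by
    unfold lensFactor
    refine Continuous.rpow_const (by fun_prop) fun t => Or.inl ?_
    positivity
  unfold coupling
  fun_prop

theorem norm_coupling_le {ω b₀ : ℝ} (hb₀ : 0 ≤ b₀) (t : ℝ) : ‖coupling ω b₀ t‖ ≤ b₀ := by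
  obtain ⟨h0, h1⟩ := lensFactor_mem ω t
  rw [coupling, norm_mul, norm_mul, Complex.norm_I, one_mul, Complex.norm_real, Complex.norm_real,
    Real.norm_of_nonneg hb₀, Real.norm_of_nonneg h0]
  exact mul_le_of_le_one_right hb₀ h1

theorem enorm_coupling_le {ω b₀ : ℝ} (hb₀ : 0 ≤ b₀) (t : ℝ) :
    ‖coupling ω b₀ t‖ₑ ≤ ENNReal.ofReal b₀ := by
  rw [← ofReal_norm]
  exact ENNReal.ofReal_le_ofReal (norm_coupling_le hb₀ t)

/-- The inhomogeneity of the hierarchy, on the Fourier side and in the weighted interaction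
picture. -/
def source (ε ω b₀ : ℝ) (Bu : (k : ℕ) → Fin k → ℝ → Kernel k) (k : ℕ) (t : ℝ) : Kernel k :=
  ∑ j, coupling ω b₀ t • interaction ε t (Bu k j t)

/-- A solution of the hierarchy with the initial datum zero and with the a priori bound. -/
structure IsBoundedSolution (ω b₀ T ε C : ℝ) (u : (k : ℕ) → ℝ → Kernel k)
    (Bu : (k : ℕ) → Fin k → ℝ → Kernel k) : Prop extends IsSolution ω b₀ T u Bu where
  coupling_nonneg : 0 ≤ b₀
  time_pos : 0 < T
  eps_pos : 0 < ε
  const_pos : 0 < C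
  initial : ∀ k, 1 ≤ k → u k 0 = 0
  bound : ∀ (k : ℕ) (j : Fin k),
    ∫⁻ τ in Set.Icc 0 T, sobolevNorm ε (Bu k j τ) ≤ ENNReal.ofReal (C ^ k)

namespace IsBoundedSolution

variable {ω b₀ T C : ℝ} {u : (k : ℕ) → ℝ → Kernel k} {Bu : (k : ℕ) → Fin k → ℝ → Kernel k}

theorem lintegral_ne_top (h : IsBoundedSolution ω b₀ T ε C u Bu)
    (j : Fin k) : ∫⁻ τ in Set.Icc 0 T, sobolevNorm ε (Bu k j τ) ≠ ∞ :=
  ((h.bound k j).trans_lt ENNReal.ofReal_lt_top).ne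

theorem integrableOn_interaction (h : IsBoundedSolution ω b₀ T ε C u Bu)
    (j : Fin k) :
    IntegrableOn (fun t => interaction ε t (Bu k j t)) (Set.Icc 0 T) :=
  GPHierarchy.integrableOn_interaction (h.integrable k j).aestronglyMeasurable
    (h.lintegral_ne_top j)

theorem integrableOn_coupling_smul (h : IsBoundedSolution ω b₀ T ε C u Bu)
    (j : Fin k) :
    IntegrableOn (fun t => coupling ω b₀ t • interaction ε t (Bu k j t)) (Set.Icc 0 T) :=
  (h.integrableOn_interaction j).bdd_smul b₀
    (continuous_coupling ω b₀).aestronglyMeasurable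
    (Eventually.of_forall fun t => norm_coupling_le h.coupling_nonneg t)

theorem integrableOn_source (h : IsBoundedSolution ω b₀ T ε C u Bu)
    (k : ℕ) : IntegrableOn (source ε ω b₀ Bu k) (Set.Icc 0 T) :=
  integrable_finsetSum _ fun j _ => h.integrableOn_coupling_smul j

theorem lintegral_source_le (h : IsBoundedSolution ω b₀ T ε C u Bu)
    (k : ℕ) : ∫⁻ t in Set.Icc 0 T, ‖source ε ω b₀ Bu k t‖ₑ ≤
    ENNReal.ofReal (k * (b₀ * C ^ k)) := by
  calc ∫⁻ t in Set.Icc 0 T, ‖source ε ω b₀ Bu k t‖ₑ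
      ≤ ∫⁻ t in Set.Icc 0 T, ∑ j, ‖coupling ω b₀ t • interaction ε t (Bu k j t)‖ₑ :=
        lintegral_mono fun t => enorm_sum_le _ _
    _ = ∑ j, ∫⁻ t in Set.Icc 0 T, ‖coupling ω b₀ t • interaction ε t (Bu k j t)‖ₑ :=
        lintegral_finsetSum' _ fun j _ => (h.integrableOn_coupling_smul j).aestronglyMeasurable.enorm
    _ ≤ ∑ _j : Fin k, ENNReal.ofReal (b₀ * C ^ k) := by
        refine Finset.sum_le_sum fun j _ => ?_
        calc ∫⁻ t in Set.Icc 0 T, ‖coupling ω b₀ t • interaction ε t (Bu k j t)‖ₑ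
            ≤ ∫⁻ t in Set.Icc 0 T, ENNReal.ofReal b₀ * sobolevNorm ε (Bu k j t) := by
              refine lintegral_mono fun t => ?_
              rw [enorm_smul]
              exact mul_le_mul' (enorm_coupling_le h.coupling_nonneg t) (enorm_interaction_le _ _)
          _ = ENNReal.ofReal b₀ * ∫⁻ t in Set.Icc 0 T, sobolevNorm ε (Bu k j t) :=
              lintegral_const_mul' _ _ ENNReal.ofReal_ne_top
          _ ≤ _ := by
              rw [ENNReal.ofReal_mul h.coupling_nonneg]
              exact mul_le_mul_right (h.bound k j) _
    _ = _ := by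
        rw [Finset.sum_const, Finset.card_univ, Fintype.card_fin, nsmul_eq_mul,
          ENNReal.ofReal_mul (Nat.cast_nonneg k), ENNReal.ofReal_natCast]

/-- In the interaction picture `U(τ - s)` splits into a factor in `τ`, which leaves the integral,
and a factor in `s`, which is absorbed in the source. The Sobolev norm of the collision term is
finite for almost every `s`, so inserting and removing the weight is harmless. -/
theorem fourier_eq (h : IsBoundedSolution ω b₀ T ε C u Bu)
    (hk : 1 ≤ k) {τ : ℝ} (hτ : τ ∈ Set.Icc 0 T) :
    𝓕 (u k τ) = evolve h.eps_pos τ (∫ s in (0 : ℝ)..τ, source ε ω b₀ Bu k s) := by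
  have hfree0 : freeEvolution τ (u k 0) = 0 := by
    have h0 : (𝓕 (0 : Kernel k) : Kernel k) = 0 :=
      map_zero (Lp.fourierTransformₗᵢ (KernelSpace k) ℂ)
    have h1 := fourier_freeEvolution τ (u k 0)
    rw [h.initial k hk, h0, map_zero] at h1
    rw [h.initial k hk]
    exact (Lp.fourierTransformₗᵢ (KernelSpace k) ℂ).map_eq_zero_iff.1 h1
  have hsub : Set.Ioc 0 τ ⊆ Set.Icc 0 T := fun s hs => ⟨hs.1.le, hs.2.trans hτ.2⟩
  have hii : ∀ j : Fin k, IntervalIntegrable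
      (fun s => coupling ω b₀ s • interaction ε s (Bu k j s)) volume 0 τ := fun j =>
    (intervalIntegrable_iff_integrableOn_Ioc_of_le hτ.1).2
      ((h.integrableOn_coupling_smul j).mono_set hsub)
  have hj : ∀ j : Fin k, (Complex.I * (b₀ : ℂ)) • (𝓕 (∫ s in (0 : ℝ)..τ,
      freeEvolution (τ - s) ((lensFactor ω s : ℂ) • Bu k j s)) : Kernel k) =
      evolve h.eps_pos τ (∫ s in (0 : ℝ)..τ, coupling ω b₀ s • interaction ε s (Bu k j s)) := by
    intro j
    have e1 : (𝓕 (∫ s in (0 : ℝ)..τ,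
        freeEvolution (τ - s) ((lensFactor ω s : ℂ) • Bu k j s)) : Kernel k) =
        ∫ s in (0 : ℝ)..τ, (𝓕 (freeEvolution (τ - s) ((lensFactor ω s : ℂ) • Bu k j s)) : Kernel k) :=
      by
        rw [intervalIntegral.integral_of_le hτ.1, intervalIntegral.integral_of_le hτ.1]
        exact ((Lp.fourierTransformₗᵢ (KernelSpace k) ℂ).toContinuousLinearEquiv.integral_comp_comm
          _).symm
    rw [e1, ← ContinuousLinearMap.intervalIntegral_comp_comm _ (hii j),
      ← intervalIntegral.integral_smul, intervalIntegral.integral_of_le hτ.1,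
      intervalIntegral.integral_of_le hτ.1]
    refine integral_congr_ae ?_
    filter_upwards [ae_restrict_of_ae_restrict_of_subset hsub (ae_sobolevNorm_ne_top
      (h.integrable k j).aestronglyMeasurable (h.lintegral_ne_top j))] with s hs
    have e2 : (𝓕 ((lensFactor ω s : ℂ) • Bu k j s) : Kernel k) =
      (lensFactor ω s : ℂ) • 𝓕 (Bu k j s) :=
      map_smul (Lp.fourierTransformₗᵢ (KernelSpace k) ℂ) _ _
    rw [fourier_freeEvolution, e2, map_smul, ← evolve_interaction h.eps_pos s hs,
      mulOp_propagatorSymbol_evolve, map_smul, smul_smul, coupling]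
  have hsm : ∀ (a : ℂ) (f : Kernel k), (𝓕 (a • f) : Kernel k) = a • 𝓕 f :=
    map_smul (Lp.fourierTransformₗᵢ (KernelSpace k) ℂ)
  rw [h.duhamel k hk τ hτ, hfree0, zero_add, hsm]
  have hsum : (𝓕 (∑ j : Fin k, ∫ s in (0 : ℝ)..τ,
      freeEvolution (τ - s) ((lensFactor ω s : ℂ) • Bu k j s)) : Kernel k) = ∑ j : Fin k, 𝓕 (∫ s in (0 : ℝ)..τ,
      freeEvolution (τ - s) ((lensFactor ω s : ℂ) • Bu k j s)) :=
    map_sum (Lp.fourierTransformₗᵢ (KernelSpace k) ℂ) _ _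
  rw [hsum, Finset.smul_sum, Finset.sum_congr rfl fun j _ => hj j, ← map_sum]
  congr 1
  unfold source
  rw [intervalIntegral.integral_finsetSum fun j _ => hii j]

/-- Symmetry is assumed of `u` only. It passes to the primitive of the source because `evolve` is
injective and commutes with permutations, and then to the source itself by Lebesgue differentiation.
-/
theorem ae_permOp_source (h : IsBoundedSolution ω b₀ T ε C u Bu)
    (σ : Equiv.Perm (Fin k)) :
    ∀ᵐ s ∂volume.restrict (Set.Icc 0 T), permOp σ (source ε ω b₀ Bu k s) = source ε ω b₀ Bu k s := by
  -- Symmetry and Duhamel's formula are assumed for `1 ≤ k`; at level `0` the source is an empty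
  -- sum.
  rcases Nat.eq_zero_or_pos k with rfl | hk
  · refine Eventually.of_forall fun s => ?_
    simp [source]
  have hi := h.integrableOn_source k
  have hi' : IntegrableOn (fun s => permOp σ (source ε ω b₀ Bu k s)) (Set.Icc 0 T) :=
    (permOp σ).integrable_comp hi
  have key := ae_eq_zero_of_primitive_eq_zero h.time_pos.le (hi'.sub hi) fun t ht => ?_
  · filter_upwards [key] with s hs
    exact sub_eq_zero.1 hs
  have hsub : Set.Ioc 0 t ⊆ Set.Icc 0 T := fun s hs => ⟨hs.1.le, hs.2.trans ht.2⟩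
  have hii : IntervalIntegrable (source ε ω b₀ Bu k) volume 0 t :=
    (intervalIntegrable_iff_integrableOn_Ioc_of_le ht.1).2 (hi.mono_set hsub)
  have hii' : IntervalIntegrable (fun s => permOp σ (source ε ω b₀ Bu k s)) volume 0 t :=
    (intervalIntegrable_iff_integrableOn_Ioc_of_le ht.1).2 (hi'.mono_set hsub)
  simp only [Pi.sub_apply]
  rw [intervalIntegral.integral_sub hii' hii, ContinuousLinearMap.intervalIntegral_comp_comm _ hii,
    sub_eq_zero]
  apply evolve_injective h.eps_pos t
  rw [← permOp_evolve, ← h.fourier_eq hk ht, ← fourier_permOp]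
  congr 1
  refine Lp.ext ((coeFn_permOp σ _).trans (h.symmetric k hk t ht σ))

end IsBoundedSolution


/-! ### Identification of the limit with the collision term -/

theorem contDiff_ofReal_comp {E : Type*} [NormedAddCommGroup E] [NormedSpace ℝ E] {ψ : E → ℝ}
    (h : ContDiff ℝ (⊤ : ℕ∞) ψ) : ContDiff ℝ (⊤ : ℕ∞) fun y => (ψ y : ℂ) :=
  Complex.ofRealCLM.contDiff.comp h

theorem hasCompactSupport_ofReal_comp {E : Type*} [TopologicalSpace E] {ψ : E → ℝ}
    (h : HasCompactSupport ψ) : HasCompactSupport fun y => (ψ y : ℂ) :=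
  h.comp_left (g := ((↑) : ℝ → ℂ)) Complex.ofReal_zero

theorem inner_testKernel {ψ : KernelSpace k → ℝ} (h₁ : ContDiff ℝ (⊤ : ℕ∞) ψ)
    (h₂ : HasCompactSupport ψ) (f : Kernel k) :
    inner ℂ (testKernel (fun y => (ψ y : ℂ)) (contDiff_ofReal_comp h₁)
      (hasCompactSupport_ofReal_comp h₂)) f = ∫ y, (ψ y : ℂ) * f y := by
  rw [L2.inner_def]
  refine integral_congr_ae ?_
  filter_upwards [coeFn_testKernel (contDiff_ofReal_comp h₁) (hasCompactSupport_ofReal_comp h₂)]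
    with y hy
  rw [RCLike.inner_apply, hy, Complex.conj_ofReal, mul_comm]

/-- The Fourier transform is unitary, and real test functions already separate locally integrable
complex functions. -/
theorem eq_zero_of_inner_fourier_testKernel {x : Kernel k}
    (h : ∀ (ψ : KernelSpace k → ℝ) (h₁ : ContDiff ℝ (⊤ : ℕ∞) ψ) (h₂ : HasCompactSupport ψ),
      inner ℂ (𝓕 (testKernel (fun y => (ψ y : ℂ)) (contDiff_ofReal_comp h₁)
        (hasCompactSupport_ofReal_comp h₂)) : Kernel k) x = 0) : x = 0 := by
  have hx : (𝓕 (𝓕⁻ x : Kernel k) : Kernel k) = x := FourierTransform.fourier_fourierInv_eq x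
  have h0 : (𝓕⁻ x : Kernel k) = 0 := by
    refine Lp.ext ?_
    have hli : LocallyIntegrable (𝓕⁻ x : Kernel k) (volume : Measure (KernelSpace k)) :=
      (Lp.memLp _).locallyIntegrable (by norm_num)
    have hae := ae_eq_zero_of_integral_contDiff_smul_eq_zero hli fun ψ h₁ h₂ => by
      have h1 := h ψ h₁ h₂
      rw [← hx, Lp.inner_fourier_eq, inner_testKernel h₁ h₂] at h1
      simpa using h1
    filter_upwards [hae, Lp.coeFn_zero ℂ 2 (volume : Measure (KernelSpace k))] with y h1 h2
    rw [h1, h2]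
    rfl
  rw [← hx, h0]
  exact map_zero (Lp.fourierTransformₗᵢ (KernelSpace k) ℂ)

theorem IsMollifier.isCutoffSeq {ρ : ℝ → ℝ} (hρ : IsMollifier ρ) :
    IsCutoffSeq fun n : ℕ => mollifierCutoff ρ (1 / ((n : ℝ) + 1)) :=
  ⟨fun _ => hρ.isCutoff Nat.one_div_pos_of_nat, fun _ => hρ.norm_mollifierCutoff_le _,
    fun z => (hρ.tendsto_mollifierCutoff z).comp tendsto_one_div_add_atTop_nhds_zero_nat⟩

theorem exists_norm_mul_inner_evolve_le (hε : 0 < ε) {θ : ℝ → ℝ} (hθ : Continuous θ)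
    (hθc : HasCompactSupport θ) (Φ : Kernel k) : ∃ M : ℝ, 0 ≤ M ∧
      ∀ t x, ‖(θ t : ℂ) * inner ℂ Φ (evolve hε t x)‖ ≤ M * ‖x‖ := by
  obtain ⟨K, hK⟩ := hθc.exists_bound_of_continuous hθ
  have hK0 : 0 ≤ K := (norm_nonneg _).trans (hK 0)
  refine ⟨K * ‖Φ‖, by positivity, fun t x => ?_⟩
  rw [norm_mul, Complex.norm_real, mul_assoc]
  refine mul_le_mul (hK t) ?_ (norm_nonneg _) hK0
  exact (norm_inner_le_norm _ _).trans
    (mul_le_mul_of_nonneg_left (norm_evolve_apply_le hε t x) (norm_nonneg _))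

theorem integrableOn_mul_inner_evolve (hε : 0 < ε) {s : Set ℝ} {θ : ℝ → ℝ} (hθ : Continuous θ)
    (hθc : HasCompactSupport θ) (Φ : Kernel k) {D : ℝ → Kernel k} (hD : IntegrableOn D s) :
    IntegrableOn (fun t => (θ t : ℂ) * inner ℂ Φ (evolve hε t (D t))) s := by
  obtain ⟨M, -, hM⟩ := exists_norm_mul_inner_evolve_le hε hθ hθc Φ
  have hc : Continuous fun p : ℝ × Kernel k => (θ p.1 : ℂ) * inner ℂ Φ (evolve hε p.1 p.2) :=
    (Complex.continuous_ofReal.comp (hθ.comp continuous_fst)).mul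
      (continuous_const.inner (continuous_evolve hε))
  have hm := hc.comp_aestronglyMeasurable
    (f := fun t => (t, D t)) (aestronglyMeasurable_id.prodMk hD.aestronglyMeasurable)
  exact (hD.norm.const_mul M).mono' hm (Eventually.of_forall fun t => hM t (D t))

namespace IsBoundedSolution

variable {ω b₀ T C : ℝ} {u : (k : ℕ) → ℝ → Kernel k} {Bu : (k : ℕ) → Fin k → ℝ → Kernel k}

/-- The collision term of the solution with the cutoff that a mollifier produces, on the Fourier
side and in the weighted interaction picture. -/
def cutoffCollision (h : IsBoundedSolution ω b₀ T ε C u Bu) {ρ : ℝ → ℝ} (hρ : IsMollifier ρ)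
    (j : Fin k) (n : ℕ) (r : ℝ) : Kernel k :=
  freqCollision h.eps_pos ((IsMollifier.isCutoffSeq hρ).cutoff n) (Sum.inl j) r
      (∫ s in (0 : ℝ)..r, source ε ω b₀ Bu (k + 1) s) -
    freqCollision h.eps_pos ((IsMollifier.isCutoffSeq hρ).cutoff n) (Sum.inr j) r
      (∫ s in (0 : ℝ)..r, source ε ω b₀ Bu (k + 1) s)

theorem integrableOn_freqCollision (h : IsBoundedSolution ω b₀ T ε C u Bu) {χ : ℝ × ℝ → ℂ}
    (hχ : IsCutoff χ) (i : Fin k ⊕ Fin k) : IntegrableOn (fun r => freqCollision h.eps_pos hχ i r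
      (∫ s in (0 : ℝ)..r, source ε ω b₀ Bu (k + 1) s)) (Set.Icc 0 T) :=
  ContinuousOn.integrableOn_Icc ((continuous_freqCollision h.eps_pos hχ i).comp_continuousOn
    (continuousOn_id.prodMk (continuousOn_primitive_Icc (h.integrableOn_source (k + 1)))))

theorem integrableOn_cutoffCollision (h : IsBoundedSolution ω b₀ T ε C u Bu) {ρ : ℝ → ℝ}
    (hρ : IsMollifier ρ) (j : Fin k) (n : ℕ) :
    IntegrableOn (h.cutoffCollision hρ j n) (Set.Icc 0 T) :=
  (h.integrableOn_freqCollision _ _).sub (h.integrableOn_freqCollision _ _)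

/-- Parseval for each of the two traces, followed by the intertwining relation `intOp_pullOp_evolve`
applied to the primitive of the source. -/
theorem integral_mul_smearedCollision (h : IsBoundedSolution ω b₀ T ε C u Bu) {ρ : ℝ → ℝ}
    (hρ : IsMollifier ρ) (n : ℕ) (j : Fin k) {ψ : KernelSpace k → ℝ}
    (h₁ : ContDiff ℝ (⊤ : ℕ∞) ψ) (h₂ : HasCompactSupport ψ) {τ : ℝ} (hτ : τ ∈ Set.Icc 0 T) :
    ∫ y, (ψ y : ℂ) * smearedCollision ρ (1 / ((n : ℝ) + 1)) j (u (k + 1) τ) y =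
      inner ℂ (𝓕 (testKernel (fun y => (ψ y : ℂ)) (contDiff_ofReal_comp h₁)
        (hasCompactSupport_ofReal_comp h₂)) : Kernel k)
          (evolve h.eps_pos τ (h.cutoffCollision hρ j n τ)) := by
  have key := fun i => integral_mul_smearedTrace hρ (Nat.one_div_pos_of_nat (n := n)) i
    (contDiff_ofReal_comp h₁) (hasCompactSupport_ofReal_comp h₂) (u (k + 1) τ)
  simp only [Complex.conj_ofReal] at key
  simp only [smearedCollision, mul_sub]
  rw [integral_sub (key _).1 (key _).1, (key _).2, (key _).2, h.fourier_eq (by omega) hτ,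
    intOp_pullOp_evolve, intOp_pullOp_evolve, cutoffCollision, map_sub, inner_sub_right]

theorem exists_tendsto_cutoffCollision (h : IsBoundedSolution ω b₀ T ε C u Bu) {ρ : ℝ → ℝ}
    (hρ : IsMollifier ρ) (j : Fin k) : ∃ G : ℝ → Kernel k, IntegrableOn G (Set.Icc 0 T) ∧
      Tendsto (fun n => ∫⁻ r in Set.Icc 0 T, ‖h.cutoffCollision hρ j n r - G r‖ₑ) atTop
        (𝓝 0) := by
  have hχ := IsMollifier.isCutoffSeq hρ
  obtain ⟨G₁, hG₁, hlim₁⟩ := hχ.exists_limit h.eps_pos h.time_pos (h.integrableOn_source (k + 1))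
    (Sum.inl j)
  obtain ⟨G₂, hG₂, hlim₂⟩ := hχ.exists_limit h.eps_pos h.time_pos (h.integrableOn_source (k + 1))
    (Sum.inr j)
  refine ⟨fun r => G₁ r - G₂ r, hG₁.sub hG₂, ?_⟩
  have hadd := hlim₁.add hlim₂
  rw [add_zero] at hadd
  refine tendsto_of_tendsto_of_tendsto_of_le_of_le tendsto_const_nhds hadd (fun _ => zero_le)
    fun n => ?_
  refine le_trans ?_ (lintegral_add_left' ((h.integrableOn_freqCollision (hχ.cutoff n)
    (Sum.inl j)).sub hG₁).aestronglyMeasurable.enorm _).le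
  refine lintegral_mono fun r => ?_
  simp only [cutoffCollision]
  rw [sub_sub_sub_comm]
  exact enorm_sub_le

/-- Both sides are limits of the same pairings with `θ(r) ψ(y)`: one by convergence in `L¹`, the
other by the distributional definition of the collision term along `α = 1 / (n + 1)`. -/
theorem integral_mul_inner_eq (h : IsBoundedSolution ω b₀ T ε C u Bu) {ρ : ℝ → ℝ}
    (hρ : IsMollifier ρ) (j : Fin k) {G : ℝ → Kernel k} (hG : IntegrableOn G (Set.Icc 0 T))
    (hDG : Tendsto (fun n => ∫⁻ r in Set.Icc 0 T, ‖h.cutoffCollision hρ j n r - G r‖ₑ) atTop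
      (𝓝 0)) {θ : ℝ → ℝ} (hθ : ContDiff ℝ (⊤ : ℕ∞) θ) (hθc : HasCompactSupport θ)
    (hθs : tsupport θ ⊆ Set.Ioo 0 T) {ψ : KernelSpace k → ℝ} (h₁ : ContDiff ℝ (⊤ : ℕ∞) ψ)
    (h₂ : HasCompactSupport ψ) {Φ : Kernel k}
    (hΦ : Φ = 𝓕 (testKernel (fun y => (ψ y : ℂ)) (contDiff_ofReal_comp h₁)
      (hasCompactSupport_ofReal_comp h₂))) :
    ∫ r in Set.Ioo 0 T, (θ r : ℂ) * inner ℂ Φ (evolve h.eps_pos r (G r)) =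
      ∫ r in Set.Ioo 0 T,
        (θ r : ℂ) * inner ℂ Φ (evolve h.eps_pos r (interaction ε r (Bu k j r))) := by
  have hIoo : Set.Ioo 0 T ⊆ Set.Icc 0 T := Set.Ioo_subset_Icc_self
  have hpair : ∀ F : ℝ → Kernel k, IntegrableOn F (Set.Icc 0 T) → IntegrableOn (fun r =>
      (θ r : ℂ) * inner ℂ Φ (evolve h.eps_pos r (F r))) (Set.Ioo 0 T) := fun F hF =>
    integrableOn_mul_inner_evolve h.eps_pos hθ.continuous hθc Φ (hF.mono_set hIoo)
  obtain ⟨M₀, hM₀, hMle₀⟩ := exists_norm_mul_inner_evolve_le h.eps_pos hθ.continuous hθc Φ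
  set M : ℝ≥0∞ := ENNReal.ofReal M₀
  have hM : M ≠ ∞ := ENNReal.ofReal_ne_top
  have hMle : ∀ t x, ‖(θ t : ℂ) * inner ℂ Φ (evolve h.eps_pos t x)‖ₑ ≤ M * ‖x‖ₑ := by
    intro t x
    rw [← ofReal_norm, ← ofReal_norm, ← ENNReal.ofReal_mul hM₀]
    exact ENNReal.ofReal_le_ofReal (hMle₀ t x)
  have hlimG : Tendsto (fun n => ∫ r in Set.Ioo 0 T,
      (θ r : ℂ) * inner ℂ Φ (evolve h.eps_pos r (h.cutoffCollision hρ j n r))) atTop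
      (𝓝 (∫ r in Set.Ioo 0 T, (θ r : ℂ) * inner ℂ Φ (evolve h.eps_pos r (G r)))) := by
    refine tendsto_integral_of_L1 _ (hpair G hG).aestronglyMeasurable
      (Eventually.of_forall fun n => hpair _ (h.integrableOn_cutoffCollision hρ j n)) ?_
    have hM0 := ENNReal.Tendsto.const_mul (a := M) hDG (Or.inr hM)
    rw [mul_zero] at hM0
    refine tendsto_of_tendsto_of_tendsto_of_le_of_le tendsto_const_nhds hM0 (fun _ => zero_le)
      fun n => ?_
    change _ ≤ M * ∫⁻ r in Set.Icc 0 T, _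
    rw [← lintegral_const_mul' _ _ hM]
    refine (lintegral_mono fun r => ?_).trans (lintegral_mono_set hIoo)
    rw [← mul_sub, ← inner_sub_right, ← map_sub]
    exact hMle r _
  set φ : ℝ × KernelSpace k → ℂ := fun p => ((θ p.1 * ψ p.2 : ℝ) : ℂ) with hφ
  have hφd : ContDiff ℝ (⊤ : ℕ∞) φ :=
    contDiff_ofReal_comp ((hθ.comp contDiff_fst).mul (h₁.comp contDiff_snd))
  have hφ0 : ∀ p ∉ tsupport θ ×ˢ tsupport ψ, φ p = 0 := by
    intro p hp
    rw [Set.mem_prod, not_and_or] at hp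
    rcases hp with hp | hp
    · simp [hφ, image_eq_zero_of_notMem_tsupport hp]
    · simp [hφ, image_eq_zero_of_notMem_tsupport hp]
  have hφc : HasCompactSupport φ := HasCompactSupport.intro (hθc.prod h₂) hφ0
  have hφs : tsupport φ ⊆ Set.Ioo 0 T ×ˢ Set.univ := by
    refine (closure_minimal (fun p hp => ?_)
      ((isClosed_tsupport θ).prod (isClosed_tsupport ψ))).trans
      (Set.prod_mono hθs (Set.subset_univ _))
    by_contra hne
    exact hp (hφ0 p hne)
  have hcol := (h.collision k j ρ hρ φ hφd hφc hφs).comp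
    (tendsto_nhdsWithin_iff.2 ⟨tendsto_one_div_add_atTop_nhds_zero_nat (𝕜 := ℝ),
      Eventually.of_forall fun _ => Set.mem_Ioi.2 Nat.one_div_pos_of_nat⟩)
  have hpull : ∀ (r : ℝ) (F : KernelSpace k → ℂ),
      ∫ y, φ (r, y) * F y = (θ r : ℂ) * ∫ y, (ψ y : ℂ) * F y := by
    intro r F
    rw [← integral_const_mul]
    refine integral_congr_ae (Eventually.of_forall fun y => ?_)
    simp only [hφ]
    push_cast
    ring
  have hlimB : Tendsto (fun n => ∫ r in Set.Ioo 0 T,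
      (θ r : ℂ) * inner ℂ Φ (evolve h.eps_pos r (h.cutoffCollision hρ j n r))) atTop
      (𝓝 (∫ r in Set.Ioo 0 T, ∫ y, φ (r, y) * Bu k j r y)) := by
    refine hcol.congr fun n => ?_
    refine setIntegral_congr_fun measurableSet_Ioo fun r hr => ?_
    simp only [hpull]
    rw [h.integral_mul_smearedCollision hρ n j h₁ h₂ (hIoo hr), hΦ]
  rw [tendsto_nhds_unique hlimG hlimB]
  refine integral_congr_ae ?_
  filter_upwards [ae_restrict_of_ae_restrict_of_subset hIoo (ae_sobolevNorm_ne_top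
    (h.integrable k j).aestronglyMeasurable (h.lintegral_ne_top j))] with r hr
  rw [hpull, evolve_interaction h.eps_pos r hr, hΦ, Lp.inner_fourier_eq, inner_testKernel h₁ h₂]

/-- The limits of the collision terms with cutoff are the collision terms of the hierarchy. -/
theorem ae_eq_interaction (h : IsBoundedSolution ω b₀ T ε C u Bu) {ρ : ℝ → ℝ}
    (hρ : IsMollifier ρ) (j : Fin k) {G : ℝ → Kernel k} (hG : IntegrableOn G (Set.Icc 0 T))
    (hDG : Tendsto (fun n => ∫⁻ r in Set.Icc 0 T, ‖h.cutoffCollision hρ j n r - G r‖ₑ) atTop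
      (𝓝 0)) :
    ∀ᵐ r ∂volume.restrict (Set.Icc 0 T), G r = interaction ε r (Bu k j r) := by
  have hw := h.integrableOn_interaction j
  have hX : IntegrableOn (fun r => evolve h.eps_pos r (G r - interaction ε r (Bu k j r)))
      (Set.Icc 0 T) := by
    have hd := hG.sub hw
    have hm := (continuous_evolve (k := k) h.eps_pos).comp_aestronglyMeasurable
      (f := fun t => (t, G t - interaction ε t (Bu k j t)))
      (aestronglyMeasurable_id.prodMk hd.aestronglyMeasurable)
    exact hd.norm.mono' hm (Eventually.of_forall fun t => norm_evolve_apply_le _ _ _)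
  have hIoo : Set.Ioo 0 T ⊆ Set.Icc 0 T := Set.Ioo_subset_Icc_self
  -- The difference is tested in time first, as a function with values in `L²`; the resulting vector
  -- is then tested in space.
  have hzero := (isOpen_Ioo (a := (0 : ℝ)) (b := T)).ae_eq_zero_of_integral_contDiff_smul_eq_zero
    (μ := volume) (hX.mono_set hIoo).locallyIntegrableOn fun θ hθ hθc hθs => ?_
  · rw [← Measure.restrict_congr_set Ioo_ae_eq_Icc, ae_restrict_iff' measurableSet_Ioo]
    filter_upwards [hzero] with r hr hmem
    have := (evolve_injective h.eps_pos r) ((hr hmem).trans (map_zero _).symm)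
    exact sub_eq_zero.1 this
  rw [← setIntegral_eq_integral_of_forall_compl_eq_zero (s := Set.Ioo 0 T) fun t ht => by
    rw [image_eq_zero_of_notMem_tsupport fun hmem => ht (hθs hmem), zero_smul]]
  refine eq_zero_of_inner_fourier_testKernel fun ψ h₁ h₂ => ?_
  set Φ : Kernel k := 𝓕 (testKernel (fun y => (ψ y : ℂ)) (contDiff_ofReal_comp h₁)
    (hasCompactSupport_ofReal_comp h₂)) with hΦ
  have hpair : ∀ F : ℝ → Kernel k, IntegrableOn F (Set.Icc 0 T) → IntegrableOn (fun r =>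
      (θ r : ℂ) * inner ℂ Φ (evolve h.eps_pos r (F r))) (Set.Ioo 0 T) := fun F hF =>
    integrableOn_mul_inner_evolve h.eps_pos hθ.continuous hθc Φ (hF.mono_set hIoo)
  have hθX : IntegrableOn (fun r => θ r •
      evolve h.eps_pos r (G r - interaction ε r (Bu k j r))) (Set.Ioo 0 T) := by
    obtain ⟨K, hK⟩ := hθc.exists_bound_of_continuous hθ.continuous
    exact (hX.mono_set hIoo).bdd_smul K hθ.continuous.aestronglyMeasurable
      (Eventually.of_forall hK)
  rw [← integral_inner hθX]
  have hsplit : ∀ r, inner ℂ Φ (θ r • evolve h.eps_pos r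
      (G r - interaction ε r (Bu k j r))) =
      (θ r : ℂ) * inner ℂ Φ (evolve h.eps_pos r (G r)) -
        (θ r : ℂ) * inner ℂ Φ (evolve h.eps_pos r (interaction ε r (Bu k j r))) := by
    intro r
    rw [map_sub, ← mul_sub, ← inner_sub_right, ← inner_smul_right]
    rfl
  simp only [hsplit]
  rw [integral_sub (hpair _ hG) (hpair _ hw), sub_eq_zero]
  exact h.integral_mul_inner_eq hρ j hG hDG hθ hθc hθs h₁ h₂ hΦ

theorem tendsto_cutoffCollision (h : IsBoundedSolution ω b₀ T ε C u Bu) {ρ : ℝ → ℝ}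
    (hρ : IsMollifier ρ) (j : Fin k) :
    Tendsto (fun n => ∫⁻ r in Set.Icc 0 T,
      ‖h.cutoffCollision hρ j n r - interaction ε r (Bu k j r)‖ₑ) atTop (𝓝 0) := by
  obtain ⟨G, hG, hlim⟩ := h.exists_tendsto_cutoffCollision hρ j
  refine hlim.congr fun n => lintegral_congr_ae ?_
  filter_upwards [h.ae_eq_interaction hρ j hG hlim] with r hr
  rw [hr]

end IsBoundedSolution


/-! ### Uniqueness on short intervals and continuation -/

theorem exists_lintegral_collisionFamily_le (hε : 0 < ε) {T b₀ : ℝ} (hT : 0 < T) (hb₀ : 0 ≤ b₀)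
    (ω : ℝ) : ∃ K : ℝ≥0∞, K ≠ ∞ ∧ ∀ (χ : ℕ → ℝ × ℝ → ℂ) (hχ : IsCutoffSeq χ) (m k : ℕ) (j : Fin k)
      (f : Kernel (k + 1)) (t₀ t₁ : ℝ), 0 ≤ t₀ → t₁ ≤ T →
        ∫⁻ r in Set.Icc t₀ t₁,
          ‖(collisionFamily hε (hχ.cutoff m) (continuous_coupling ω b₀)).b k j r f‖ₑ ≤
            K * ENNReal.ofReal (t₁ - t₀) ^ (1 / 2 : ℝ) * ‖f‖ₑ := by
  obtain ⟨A, hA, hAb⟩ := exists_lintegral_freqCollision_le hε hT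
  refine ⟨ENNReal.ofReal b₀ * (2 * A), by finiteness, fun χ hχ m k j f t₀ t₁ h0 h1 => ?_⟩
  have hi : ∀ i, ∫⁻ r in Set.Icc t₀ t₁, ‖freqCollision hε (hχ.cutoff m) i r f‖ₑ ≤
      ENNReal.ofReal (t₁ - t₀) ^ (1 / 2 : ℝ) * A * ‖f‖ₑ := by
    intro i
    refine (hAb k i _ (hχ.cutoff m) (hχ.isSymbol k m) f t₀ t₁ h0 h1).trans ?_
    refine mul_le_mul_right ?_ _
    rw [enorm_le_iff_norm_le]
    refine (norm_mulOp_apply_le (hχ.isSymbol k m) (fun p => hχ.norm_le m p.2) _).trans ?_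
    rw [one_mul, norm_pullOp]
  have hc : Measurable fun r => ‖freqCollision hε (hχ.cutoff m) (Sum.inl j) r f‖ₑ :=
    ((continuous_freqCollision hε (hχ.cutoff m) (Sum.inl j)).comp
      (continuous_id.prodMk continuous_const)).enorm.measurable
  calc ∫⁻ r in Set.Icc t₀ t₁,
        ‖(collisionFamily hε (hχ.cutoff m) (continuous_coupling ω b₀)).b k j r f‖ₑ
      ≤ ∫⁻ r in Set.Icc t₀ t₁, ENNReal.ofReal b₀ *
          (‖freqCollision hε (hχ.cutoff m) (Sum.inl j) r f‖ₑ +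
            ‖freqCollision hε (hχ.cutoff m) (Sum.inr j) r f‖ₑ) := by
        refine lintegral_mono fun r => ?_
        rw [collisionFamily_b_apply, enorm_smul]
        exact mul_le_mul' (enorm_coupling_le hb₀ r) enorm_sub_le
    _ = ENNReal.ofReal b₀ *
          ((∫⁻ r in Set.Icc t₀ t₁, ‖freqCollision hε (hχ.cutoff m) (Sum.inl j) r f‖ₑ) +
          ∫⁻ r in Set.Icc t₀ t₁, ‖freqCollision hε (hχ.cutoff m) (Sum.inr j) r f‖ₑ) := by
        rw [lintegral_const_mul' _ _ ENNReal.ofReal_ne_top, lintegral_add_left hc]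
    _ ≤ ENNReal.ofReal b₀ * (ENNReal.ofReal (t₁ - t₀) ^ (1 / 2 : ℝ) * A * ‖f‖ₑ +
          ENNReal.ofReal (t₁ - t₀) ^ (1 / 2 : ℝ) * A * ‖f‖ₑ) := by
        gcongr
        · exact hi _
        · exact hi _
    _ = _ := by ring

theorem exists_norm_collisionFamily_le (hε : 0 < ε) {b₀ : ℝ} (hb₀ : 0 ≤ b₀) (ω : ℝ)
    {χ : ℝ × ℝ → ℂ} (hχ : IsCutoff χ) (j : Fin k) :
    ∃ K : ℝ, ∀ t, ‖(collisionFamily hε hχ (continuous_coupling ω b₀)).b k j t‖ ≤ K := by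
  set N := (eLpNorm χ 2 volume).toReal * Real.sqrt (weightConst ε * 2)
  refine ⟨b₀ * (N + N), fun t => ContinuousLinearMap.opNorm_le_bound _ (by positivity)
    fun f => ?_⟩
  rw [collisionFamily_b_apply, norm_smul, mul_assoc, add_mul]
  exact mul_le_mul (norm_coupling_le hb₀ t) ((norm_sub_le _ _).trans
    (add_le_add (norm_freqCollision_apply_le hε hχ _ t f)
      (norm_freqCollision_apply_le hε hχ _ t f))) (norm_nonneg _) hb₀

/-- Here `4 ^ n * (8 C) ^ (-n) * C ^ (k + n) = C ^ k * 2 ^ (-n)`, which outweighs the linear factor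
`k + n`. -/
theorem tendsto_growth {b₀ C : ℝ} (hb₀ : 0 ≤ b₀) (hC : 0 < C) (k : ℕ) :
    Tendsto (fun n : ℕ => 2 ^ (2 * n + k) * ENNReal.ofReal (1 / (8 * C)) ^ n *
      ENNReal.ofReal ((k + n : ℕ) * (b₀ * C ^ (k + n)))) atTop (𝓝 0) := by
  have h1 : ∀ n : ℕ, 2 ^ (2 * n + k) * ENNReal.ofReal (1 / (8 * C)) ^ n *
      ENNReal.ofReal ((k + n : ℕ) * (b₀ * C ^ (k + n))) =
      ENNReal.ofReal (2 ^ k * b₀ * C ^ k * (k * (1 / 2) ^ n + n * (1 / 2) ^ n)) := by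
    intro n
    rw [← ENNReal.ofReal_pow (by positivity), ← ENNReal.ofReal_ofNat 2,
      ← ENNReal.ofReal_pow (by positivity), ← ENNReal.ofReal_mul (by positivity),
      ← ENNReal.ofReal_mul (by positivity)]
    congr 1
    have h2 : (2 : ℝ) ^ (2 * n + k) * (1 / (8 * C)) ^ n * C ^ (k + n) =
        2 ^ k * C ^ k * (1 / 2) ^ n := by
      rw [pow_add, pow_mul, pow_add]
      have : ((2 : ℝ) ^ 2) ^ n * (1 / (8 * C)) ^ n * C ^ n = (1 / 2) ^ n := by
        rw [← mul_pow, ← mul_pow]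
        congr 1
        field_simp
        norm_num
      rw [← this]
      ring
    push_cast
    linear_combination ((k : ℝ) + n) * b₀ * h2
  simp_rw [h1]
  have h3 : Tendsto (fun n : ℕ => 2 ^ k * b₀ * C ^ k *
      (k * (1 / 2 : ℝ) ^ n + n * (1 / 2 : ℝ) ^ n)) atTop (𝓝 0) := by
    have e1 := (tendsto_pow_atTop_nhds_zero_of_lt_one (r := (1 / 2 : ℝ)) (by norm_num)
      (by norm_num)).const_mul (k : ℝ)
    have e2 := tendsto_self_mul_const_pow_of_lt_one (r := (1 / 2 : ℝ)) (by norm_num) (by norm_num)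
    simpa using (e1.add e2).const_mul (2 ^ k * b₀ * C ^ k)
  simpa using ENNReal.tendsto_ofReal h3

namespace IsBoundedSolution

variable {ω b₀ T C : ℝ} {u : (k : ℕ) → ℝ → Kernel k} {Bu : (k : ℕ) → Fin k → ℝ → Kernel k}

/-- The solution satisfies the linear system for `w` in the limit of vanishing cutoff; this is the
input `hconv` of the abstract uniqueness theorem. -/
theorem tendsto_sum_collisionFamily (h : IsBoundedSolution ω b₀ T ε C u Bu) {ρ : ℝ → ℝ}
    (hρ : IsMollifier ρ) (k : ℕ) :
    Tendsto (fun n => ∫⁻ r in Set.Icc 0 T,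
      ‖∑ j, (collisionFamily h.eps_pos ((IsMollifier.isCutoffSeq hρ).cutoff n)
          (continuous_coupling ω b₀)).b k j r (∫ s in (0 : ℝ)..r, source ε ω b₀ Bu (k + 1) s) -
        source ε ω b₀ Bu k r‖ₑ) atTop (𝓝 0) := by
  have hlim := ENNReal.Tendsto.const_mul (a := ENNReal.ofReal b₀)
    (tendsto_finsetSum Finset.univ fun j _ => h.tendsto_cutoffCollision hρ (k := k) j)
    (Or.inr ENNReal.ofReal_ne_top)
  rw [Finset.sum_const_zero, mul_zero] at hlim
  refine tendsto_of_tendsto_of_tendsto_of_le_of_le tendsto_const_nhds hlim (fun _ => zero_le)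
    fun n => ?_
  calc ∫⁻ r in Set.Icc 0 T, ‖∑ j, (collisionFamily h.eps_pos ((IsMollifier.isCutoffSeq hρ).cutoff n)
          (continuous_coupling ω b₀)).b k j r (∫ s in (0 : ℝ)..r, source ε ω b₀ Bu (k + 1) s) -
        source ε ω b₀ Bu k r‖ₑ
      ≤ ∫⁻ r in Set.Icc 0 T, ENNReal.ofReal b₀ *
          ∑ j, ‖h.cutoffCollision hρ j n r - interaction ε r (Bu k j r)‖ₑ := by
        refine lintegral_mono fun r => ?_
        simp only [source, collisionFamily_b_apply]
        rw [← Finset.sum_sub_distrib, Finset.mul_sum]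
        refine (enorm_sum_le _ _).trans (Finset.sum_le_sum fun j _ => ?_)
        rw [← smul_sub, enorm_smul]
        exact mul_le_mul_left (enorm_coupling_le h.coupling_nonneg r) _
    _ = ENNReal.ofReal b₀ * ∑ j, ∫⁻ r in Set.Icc 0 T,
          ‖h.cutoffCollision hρ j n r - interaction ε r (Bu k j r)‖ₑ := by
        rw [lintegral_const_mul' _ _ ENNReal.ofReal_ne_top, lintegral_finsetSum']
        exact fun j _ => ((h.integrableOn_cutoffCollision hρ j n).sub
          (h.integrableOn_interaction j)).aestronglyMeasurable.enorm

/-- Uniqueness on a short time interval at whose left end the solution vanishes. -/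
theorem exists_step (h : IsBoundedSolution ω b₀ T ε C u Bu) : ∃ δ : ℝ, 0 < δ ∧
    ∀ t₀ t₁ : ℝ, 0 ≤ t₀ → t₁ ≤ T → t₁ - t₀ ≤ δ →
      (∀ k, ∫ s in (0 : ℝ)..t₀, source ε ω b₀ Bu k s = 0) →
      ∀ k, ∀ t ∈ Set.Icc t₀ t₁, ∫ s in (0 : ℝ)..t, source ε ω b₀ Bu k s = 0 := by
  obtain ⟨K, hK, hKb⟩ := exists_lintegral_collisionFamily_le h.eps_pos h.time_pos h.coupling_nonneg ω
  obtain ⟨ρ, hρ⟩ := exists_isMollifier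
  have hχ := IsMollifier.isCutoffSeq hρ
  have hC := h.const_pos
  -- The iteration produces a factor `4 ^ n` from the combinatorics and `C ^ n` from the a priori
  -- bound; this choice leaves `2 ^ (-n)`.
  set κ : ℝ≥0∞ := ENNReal.ofReal (1 / (8 * C)) with hκ
  have hκ0 : 0 < κ := ENNReal.ofReal_pos.2 (by positivity)
  obtain ⟨δ, hδK, hδ⟩ : ∃ δ : ℝ, K * ENNReal.ofReal δ ^ (1 / 2 : ℝ) < κ ∧ 0 < δ := by
    have h1 : Tendsto (fun δ : ℝ => K * ENNReal.ofReal δ ^ (1 / 2 : ℝ)) (𝓝 0) (𝓝 0) := by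
      have h2 := ((ENNReal.continuous_rpow_const (y := (1 / 2 : ℝ))).comp
        ENNReal.continuous_ofReal).tendsto 0
      have h3 := ENNReal.Tendsto.const_mul (a := K) h2 (Or.inr hK)
      simpa using h3
    have h4 : ∀ᶠ δ : ℝ in 𝓝[>] 0, K * ENNReal.ofReal δ ^ (1 / 2 : ℝ) < κ :=
      (h1.mono_left nhdsWithin_le_nhds).eventually_lt_const hκ0
    exact (h4.and self_mem_nhdsWithin).exists
  refine ⟨δ, hδ, fun t₀ t₁ h0 h1 h01 hzero k t ht => ?_⟩
  have hsub : Set.Icc t₀ t₁ ⊆ Set.Icc 0 T := Set.Icc_subset_Icc h0 h1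
  -- Since the primitives vanish at `t₀`, the system written with primitives from `0` is the same
  -- system started at `t₀`.
  have hii : ∀ k, ∀ r ∈ Set.Icc t₀ t₁, ∫ s in t₀..r, source ε ω b₀ Bu k s =
      ∫ s in (0 : ℝ)..r, source ε ω b₀ Bu k s := by
    intro k r hr
    have hr0 : t₀ ≤ T := hr.1.trans (hr.2.trans h1)
    have hint : ∀ {a b : ℝ}, 0 ≤ a → a ≤ b → b ≤ T →
        IntervalIntegrable (source ε ω b₀ Bu k) volume a b := fun ha hab hb =>
      (intervalIntegrable_iff_integrableOn_Icc_of_le hab).2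
        ((h.integrableOn_source k).mono_set (Set.Icc_subset_Icc ha hb))
    rw [← intervalIntegral.integral_add_adjacent_intervals (hint le_rfl h0 hr0)
      (hint h0 hr.1 (hr.2.trans h1)), hzero, zero_add]
  rw [← hii k t ht]
  refine CollisionFamily.primitive_eq_zero
    (c := fun n => collisionFamily h.eps_pos (hχ.cutoff n) (continuous_coupling ω b₀)) (κ := κ)
    (w := source ε ω b₀ Bu) (t₀ := t₀) (t₁ := t₁)
    (fun m k j f => (hKb _ hχ m k j f t₀ t₁ h0 h1).trans ?_) ENNReal.ofReal_ne_top
    (fun m k j => exists_norm_collisionFamily_le h.eps_pos h.coupling_nonneg ω _ j)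
    (fun m k => ?_) (fun k => (h.integrableOn_source k).mono_set hsub) (fun k => ?_) (fun k => ?_)
    k ht
  · refine mul_le_mul_left (le_trans ?_ hδK.le) _
    gcongr
  · refine ae_all_iff.2 fun σ => ?_
    filter_upwards [ae_restrict_of_ae_restrict_of_subset hsub (h.ae_permOp_source σ)] with s hs
    rw [collisionFamily_act_apply, hs]
  · refine tendsto_of_tendsto_of_tendsto_of_le_of_le tendsto_const_nhds
      (h.tendsto_sum_collisionFamily hρ k) (fun _ => zero_le) fun n => ?_
    refine le_trans (le_of_eq ?_) (lintegral_mono_set hsub)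
    refine setLIntegral_congr_fun measurableSet_Icc fun r hr => ?_
    simp only [hii (k + 1) r hr]
  · refine tendsto_of_tendsto_of_tendsto_of_le_of_le tendsto_const_nhds
      (tendsto_growth h.coupling_nonneg hC k) (fun _ => zero_le) fun n => ?_
    refine mul_le_mul_right ((lintegral_mono_set hsub).trans ?_) _
    exact h.lintegral_source_le (k + n)

theorem integral_source_eq_zero (h : IsBoundedSolution ω b₀ T ε C u Bu) (k : ℕ) {t : ℝ}
    (ht : t ∈ Set.Icc 0 T) : ∫ s in (0 : ℝ)..t, source ε ω b₀ Bu k s = 0 := by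
  obtain ⟨δ, hδ, hstep⟩ := h.exists_step
  -- The step `δ` depends neither on the starting time nor on `k`, so multiples of `δ` exhaust `[0,
  -- T]`; at each one all levels `k` must vanish together.
  have key : ∀ n : ℕ, ∀ k, ∀ t ∈ Set.Icc 0 T, t ≤ n * δ →
      ∫ s in (0 : ℝ)..t, source ε ω b₀ Bu k s = 0 := by
    intro n
    induction n with
    | zero =>
      intro k t ht htn
      have : t = 0 := le_antisymm (by simpa using htn) ht.1
      rw [this, intervalIntegral.integral_same]
    | succ n ih =>
      intro k t ht htn
      rcases le_or_gt t (n * δ) with hle | hlt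
      · exact ih k t ht hle
      · have hn0 : (0 : ℝ) ≤ n * δ := by positivity
        refine hstep (n * δ) t hn0 ht.2 ?_ (fun k => ih k _ ⟨hn0, hlt.le.trans ht.2⟩ le_rfl) k t
          ⟨hlt.le, le_rfl⟩
        push_cast at htn
        linarith
  obtain ⟨n, hn⟩ := exists_nat_ge (t / δ)
  exact key n k t ht ((div_le_iff₀ hδ).1 hn)

theorem eq_zero (h : IsBoundedSolution ω b₀ T ε C u Bu) (hk : 1 ≤ k) {τ : ℝ}
    (hτ : τ ∈ Set.Icc 0 T) : u k τ = 0 := by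
  have h1 := h.fourier_eq hk hτ
  rw [h.integral_source_eq_zero k hτ, map_zero] at h1
  exact (Lp.fourierTransformₗᵢ (KernelSpace k) ℂ).map_eq_zero_iff.1 h1

end IsBoundedSolution

theorem sobolevNorm_zero (k : ℕ) (ε : ℝ) : sobolevNorm ε (0 : Kernel k) = 0 := by
  have h0 : (𝓕 (0 : Kernel k) : Kernel k) = 0 :=
    map_zero (Lp.fourierTransformₗᵢ (KernelSpace k) ℂ)
  rw [sobolevNorm, h0]
  refine (eLpNorm_congr_ae ?_).trans eLpNorm_zero
  filter_upwards [Lp.coeFn_zero ℂ 2 (volume : Measure (KernelSpace k))] with ξ hξ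
  rw [hξ]
  simp

end
end GPHierarchy

theorem mainTheorem5 (ω b₀ T ε C : ℝ) (hb₀ : 0 ≤ b₀) (hT : 0 < T) (hε : 0 < ε) (hC : 0 < C)
    (u : (k : ℕ) → ℝ → GPHierarchy.Kernel k)
    (Bu : (k : ℕ) → Fin k → ℝ → GPHierarchy.Kernel k)
    (hsol : GPHierarchy.IsSolution ω b₀ T u Bu)
    (hzero : ∀ k, 1 ≤ k → u k 0 = 0)
    (hbound : ∀ (k : ℕ) (j : Fin k),
      ∫⁻ τ in Set.Icc 0 T, GPHierarchy.sobolevNorm ε (Bu k j τ) ≤ ENNReal.ofReal (C ^ k)) :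
    ∀ k, 1 ≤ k → ∀ τ ∈ Set.Icc 0 T,
      GPHierarchy.sobolevNorm ε (u k τ) = 0 ∧ u k τ = 0 := by
  intro k hk τ hτ
  have h : GPHierarchy.IsBoundedSolution ω b₀ T ε C u Bu :=
    ⟨hsol, hb₀, hT, hε, hC, hzero, hbound⟩
  have h0 := h.eq_zero hk hτ
  exact ⟨by rw [h0, GPHierarchy.sobolevNorm_zero], h0⟩
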